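/- Call the points of $\mathbb{Z}^2\subset\mathbb{R}^2$ lattice points. A (convex) lattice polygon is a two-dimensional convex hull of finitely many lattice points. Its genus is the number of lattice points in its interior. Its lattice width is the smallest width $b-a$ of a horizontal strip $\mathbb{R}\times[a,b]$ that contains $A\Delta$ for some matrix $A\in\mathrm{SL}_2(\mathbb{Z})$. A unimodular triangulation of a lattice polygon $\Delta$ is a collection of lattice triangles (triangles whose vertices are lattice points) of area $\tfrac12$ whose union is $\Delta$ and such that any two distinct triangles of the collection intersect in a common face (an edge, a vertex, or the empty set). Let $\ell\ge 3$ be an integer, and let $\Delta$ be a convex lattice polygon of genus $g$ and lattice width at least $\ell+1$. Then $\Delta$ admits at most $$2^{\left(3+\frac{2}{\ell}\right)g+4\sqrt{g+8/3}-1}$$ unimodular triangulations. -/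

import Mathlib

namespace LatticePlane

/-- The plane `ℝ²`; only its vector space structure, its topology and Lebesgue measure are used. -/
abbrev Plane : Type := Fin 2 → ℝ

/-- The integer vector `z` as a point of the plane. The lattice points are the values of this map. -/
def latticePoint (z : Fin 2 → ℤ) : Plane := fun i => (z i : ℝ)

/-- Convex lattice polygons: two-dimensional convex hulls of finitely many lattice points. -/
def IsLatticePolygon (P : Set Plane) : Prop :=
  (∃ S : Finset (Fin 2 → ℤ), P = convexHull ℝ (latticePoint '' (S : Set (Fin 2 → ℤ)))) ∧
    (interior P).Nonempty

/-- The genus of a lattice polygon: the number of its interior lattice points. -/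
noncomputable def genus (P : Set Plane) : ℕ :=
  {z : Fin 2 → ℤ | latticePoint z ∈ interior P}.ncard

/-- `Q` is the image of `P` under a matrix in `SL₂(ℤ)`. -/
def Equivalent (P Q : Set Plane) : Prop :=
  ∃ A : Matrix.SpecialLinearGroup (Fin 2) ℤ,
    Q = (fun x : Plane =>
      ((A : Matrix (Fin 2) (Fin 2) ℤ).map (fun n : ℤ => (n : ℝ))).mulVec x) '' P

/-- The horizontal strip `ℝ × [a, b]`, of width `b - a`. -/
def horizontalStrip (a b : ℝ) : Set Plane := {x | a ≤ x 1 ∧ x 1 ≤ b}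

/-- The lattice width of `P`: the smallest width of a horizontal strip that contains some polygon
equivalent to `P`. -/
noncomputable def latticeWidth (P : Set Plane) : ℝ :=
  sInf {w : ℝ | ∃ Q : Set Plane, Equivalent P Q ∧
    ∃ a b : ℝ, a ≤ b ∧ w = b - a ∧ Q ⊆ horizontalStrip a b}

/-- A subdivision of `P`: a family of lattice polygons that cover `P`, any two of which meet in a
common face (an edge, a vertex, or the empty set). Two distinct two-dimensional polygons cannot both
have their intersection as an improper face unless they are equal, so faces may be taken to be
exposed faces in the sense of `IsExposed` (which admits the empty set and the whole polygon). -/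
structure IsSubdivision (P : Set Plane) (T : Set (Set Plane)) : Prop where
  isLatticePolygon : ∀ Q ∈ T, IsLatticePolygon Q
  sUnion_eq : ⋃₀ T = P
  inter_isFace : ∀ Q ∈ T, ∀ R ∈ T, Q ≠ R → IsExposed ℝ Q (Q ∩ R) ∧ IsExposed ℝ R (Q ∩ R)

/-- A nondegenerate triangle whose vertices are lattice points. -/
def IsLatticeTriangle (Q : Set Plane) : Prop :=
  ∃ v : Fin 3 → Fin 2 → ℤ,
    AffineIndependent ℝ (fun i => latticePoint (v i)) ∧
      Q = convexHull ℝ (Set.range fun i => latticePoint (v i))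

/-- A unimodular triangulation of `P`: a subdivision into lattice triangles of area `1 / 2`. -/
structure IsUnimodularTriangulation (P : Set Plane) (T : Set (Set Plane)) : Prop where
  isSubdivision : IsSubdivision P T
  isLatticeTriangle : ∀ Q ∈ T, IsLatticeTriangle Q
  area_eq : ∀ Q ∈ T, MeasureTheory.volume Q = 1 / 2

end LatticePlane

/-! The proof combines Anclin's bound, which counts triangulations by the number M of interior
points of ½ℤ² that are not lattice points, with an estimate of M by genus and width.

Anclin's bound. In a unimodular triangulation every point of P in ½ℤ² outside ℤ² is the midpoint of
exactly one edge, and the edges determine the triangulation (`eq_of_isEdge_iff`). Edges with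
midpoint on the boundary are forced. Order the inner midpoints by the generic functional `height`.
Once the edges with lower midpoints are fixed, at most two edges are possible at the next midpoint
(`eq_of_three`). Indeed, among three candidates one lies between the other two in direction. Beside
it there is a lower midpoint in P, and the edge there is common to all three triangulations;
whatever its direction, it crosses one of the candidates (`exists_frame`, `false_of_frame`).
Encoding the binary choices gives at most 2^M triangulations (`ncard_isUnimodularTriangulation_le`).

Estimate of M. Choosing a basis of functionals with successively minimal widths
(`exists_reduced_basis`) puts the polygon in a box [0, N] × [0, W] with ℓ + 1 ≤ W ≤ N, where its
widths in the two diagonal directions are at least N. Let L(y) be the length of the horizontal chord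
at height y. Counting row by row gives M ≤ 3g + L(0) + L(W) + 2W - 3 (`ncard_innerMidpoints_le`).
Concavity of L together with g ≥ ∑ (L(i) - 1), summed over 0 < i < W, gives L(0) + L(W) ≤ 2 + 2g/(W
- 1). The diagonal widths limit how much of the box can be cut off at the corners, so the trapezoid
sum of the chords is at least WN - W²/4 ≥ 3W²/4 (`IsReduced.sum_chord_ge`). This yields 3W² ≤ 12g +
32, that is, W ≤ 2√(g + 8/3) (`IsReduced.bounds`). Together, M ≤ (3 + 2/ℓ)g + 4√(g + 8/3) - 1. -/

namespace LatticePlane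

open Finset

/-! ### Counting families of functions by successive binary choices -/

/-- If a family of objects is determined by the values `F T s`, `s ∈ I`, and for every `s` the values
at the points preceding `s` leave at most two values at `s`, then there are at most `2 ^ #I`
objects. -/
theorem finite_and_ncard_le_two_pow {X ι β : Type*} (I : Finset ι) (φ : ι → ℝ)
    (F : X → ι → β) (𝓕 : Set X)
    (hinj : ∀ T ∈ 𝓕, ∀ T' ∈ 𝓕, (∀ s ∈ I, F T s = F T' s) → T = T')
    (hthree : ∀ s ∈ I, ∀ T₁ ∈ 𝓕, ∀ T₂ ∈ 𝓕, ∀ T₃ ∈ 𝓕,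
      (∀ s' ∈ I, φ s' < φ s → F T₁ s' = F T₂ s') →
      (∀ s' ∈ I, φ s' < φ s → F T₁ s' = F T₃ s') →
      F T₁ s = F T₂ s ∨ F T₁ s = F T₃ s ∨ F T₂ s = F T₃ s) :
    𝓕.Finite ∧ 𝓕.ncard ≤ 2 ^ #I := by
  classical
  rcases isEmpty_or_nonempty X with hX | hX
  · have : 𝓕 = ∅ := Set.eq_empty_of_isEmpty 𝓕
    simp [this]
  -- The reference member `c T s` is chosen from the predicate `p T s` alone, so it depends only on
  -- the values of `T` that precede `s`. The code of `T` records where `T` agrees with its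
  -- reference.
  let p : X → ι → X → Prop := fun T s T₀ =>
    T₀ ∈ 𝓕 ∧ ∀ s' ∈ I, φ s' < φ s → F T s' = F T₀ s'
  let c : X → ι → X := fun T s => Classical.epsilon (p T s)
  have hc : ∀ T ∈ 𝓕, ∀ s, p T s (c T s) := fun T hT s =>
    Classical.epsilon_spec (p := p T s) ⟨T, hT, fun _ _ _ => rfl⟩
  let code : X → Finset ι := fun T => I.filter fun s => F T s = F (c T s) s
  have hcode : Set.InjOn code 𝓕 := by
    intro T hT T' hT' h
    refine hinj T hT T' hT' ?_
    -- At the first point of disagreement both objects have the same reference, and both agree with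
    -- it or both disagree. In the second case `hthree`, applied to the two objects and the
    -- reference, leaves only equality of the two.
    by_contra! hne
    obtain ⟨s₁, hs₁, hs₁'⟩ := hne
    obtain ⟨s, hs, hmin⟩ := (I.filter fun s => F T s ≠ F T' s).exists_min_image φ
      ⟨s₁, by simp [hs₁, hs₁']⟩
    rw [mem_filter] at hs
    have hag : ∀ s' ∈ I, φ s' < φ s → F T s' = F T' s' := by
      intro s' hs' hlt
      by_contra hne
      exact absurd (hmin s' (by simp [hs', hne])) (not_le.2 hlt)
    have hcc : c T s = c T' s := by
      have : p T s = p T' s := by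
        funext T₀
        refine propext ⟨fun h => ⟨h.1, fun s' h1 h2 => ?_⟩, fun h => ⟨h.1, fun s' h1 h2 => ?_⟩⟩
        · rw [← hag s' h1 h2]; exact h.2 s' h1 h2
        · rw [hag s' h1 h2]; exact h.2 s' h1 h2
      simp only [c, this]
    have hmem : s ∈ code T ↔ s ∈ code T' := by rw [h]
    simp only [code, mem_filter, hs.1, true_and, ← hcc] at hmem
    rcases hthree s hs.1 T hT T' hT' (c T s) (hc T hT s).1 hag (hc T hT s).2 with h' | h' | h'
    · exact hs.2 h'
    · exact hs.2 (h'.trans (hmem.1 h').symm)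
    · exact hs.2 ((hmem.2 h').trans h'.symm)
  have hmaps : Set.MapsTo code 𝓕 (I.powerset : Set (Finset ι)) := fun T _ =>
    Finset.mem_coe.2 (Finset.mem_powerset.2 (filter_subset _ _))
  refine ⟨Set.Finite.of_injOn hmaps hcode I.powerset.finite_toSet, ?_⟩
  have := Set.ncard_le_ncard_of_injOn code hmaps hcode I.powerset.finite_toSet
  rwa [Set.ncard_coe_finset, card_powerset] at this

/-! ### Systems of edges -/

/-- The determinant of two integer vectors. -/
def det (u v : Fin 2 → ℤ) : ℤ := u 0 * v 1 - u 1 * v 0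

/-- The point `s / 2`. -/
noncomputable def halfPoint (s : Fin 2 → ℤ) : Plane := fun i => (s i : ℝ) / 2

/-- `s / 2` is not a lattice point. -/
def IsOddVector (s : Fin 2 → ℤ) : Prop := Odd (s 0) ∨ Odd (s 1)

/-- A linear functional that is injective on the lattice. -/
noncomputable def height (s : Fin 2 → ℤ) : ℝ := s 0 + Real.sqrt 2 * s 1

theorem height_add (s t : Fin 2 → ℤ) : height (s + t) = height s + height t := by
  simp [height]; ring

theorem height_injective : Function.Injective height := by
  intro s t h
  have h2 : Irrational (Real.sqrt 2) := irrational_sqrt_two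
  simp only [height] at h
  have h1 : s 1 = t 1 := by
    by_contra hne
    have hne' : ((s 1 : ℝ) - t 1) ≠ 0 := sub_ne_zero.2 (by exact_mod_cast hne)
    refine h2 ⟨((t 0 - s 0 : ℤ) : ℚ) / ((s 1 - t 1 : ℤ) : ℚ), ?_⟩
    push_cast
    rw [div_eq_iff hne']
    linarith
  have h0 : s 0 = t 0 := by
    rw [h1] at h
    exact_mod_cast add_right_cancel h
  funext i
  fin_cases i <;> assumption

/-- The combinatorial properties of the set of edges of a unimodular triangulation of `P`. -/
structure IsEdgeSystem (P : Set Plane) (E : (Fin 2 → ℤ) → (Fin 2 → ℤ) → Prop) : Prop where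
  symm : ∀ {a b}, E a b → E b a
  mem : ∀ {a b}, E a b → latticePoint a ∈ P
  exists_det_eq_one : ∀ {a b}, E a b → ∃ c, det (b - a) c = 1
  eq_of_cross : ∀ {a b c d} {lam mu : ℝ}, E a b → E c d → |lam| < 1 → |mu| < 1 →
    (∀ i, ((a i : ℝ) + b i) + lam * (b i - a i) = (c i + d i) + mu * (d i - c i)) →
    (a = c ∧ b = d) ∨ (a = d ∧ b = c)
  exists_edge : ∀ s, halfPoint s ∈ P → IsOddVector s → ∃ a b, E a b ∧ a + b = s

variable {P : Set Plane} {E E₁ E₂ E₃ : (Fin 2 → ℤ) → (Fin 2 → ℤ) → Prop}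

/-- Two edges with different midpoints do not cross; the edges are given by the coordinates of
their midpoints and directions with respect to a common frame. -/
theorem IsEdgeSystem.not_cross (h : IsEdgeSystem P E) {p q c d a e g : Fin 2 → ℤ}
    (hpq : E p q) (hcd : E c d) (hne : p + q ≠ c + d) {s₁ s₂ d₁ d₂ t₁ t₂ f₁ f₂ : ℤ}
    (hs : ∀ i, p i + q i = 2 * a i + s₁ * e i + s₂ * g i)
    (hd : ∀ i, q i - p i = d₁ * e i + d₂ * g i)
    (ht : ∀ i, c i + d i = 2 * a i + t₁ * e i + t₂ * g i)
    (hf : ∀ i, d i - c i = f₁ * e i + f₂ * g i)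
    (h1 : |(t₁ - s₁) * f₂ - (t₂ - s₂) * f₁| < |d₁ * f₂ - d₂ * f₁|)
    (h2 : |(t₁ - s₁) * d₂ - (t₂ - s₂) * d₁| < |d₁ * f₂ - d₂ * f₁|) : False := by
  have hD : (0 : ℤ) < |d₁ * f₂ - d₂ * f₁| := lt_of_le_of_lt (abs_nonneg _) h1
  have hD' : ((d₁ : ℝ) * f₂ - d₂ * f₁) ≠ 0 := by
    have := abs_pos.1 hD
    exact_mod_cast this
  -- By Cramer's rule, the parameters at which the two lines meet are quotients of 2 × 2
  -- determinants; the hypotheses say that both quotients have absolute value below 1.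
  have key : ∀ n : ℤ, |n| < |d₁ * f₂ - d₂ * f₁| → |(n : ℝ) / ((d₁ : ℝ) * f₂ - d₂ * f₁)| < 1 := by
    intro n hn
    rw [abs_div, div_lt_one (abs_pos.2 hD')]
    exact_mod_cast hn
  have := h.eq_of_cross hpq hcd (key _ h1) (key _ h2) (by
    intro i
    have hs' : (p i : ℝ) + q i = 2 * a i + s₁ * e i + s₂ * g i := by exact_mod_cast hs i
    have hd' : (q i : ℝ) - p i = d₁ * e i + d₂ * g i := by exact_mod_cast hd i
    have ht' : (c i : ℝ) + d i = 2 * a i + t₁ * e i + t₂ * g i := by exact_mod_cast ht i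
    have hf' : (d i : ℝ) - c i = f₁ * e i + f₂ * g i := by exact_mod_cast hf i
    rw [hs', hd', ht', hf']
    push_cast
    obtain ⟨m, hm⟩ : ∃ m : ℝ, m = (d₁ : ℝ) * f₂ - d₂ * f₁ := ⟨_, rfl⟩
    rw [← hm] at hD' ⊢
    field_simp
    rw [hm]
    ring)
  rcases this with ⟨rfl, rfl⟩ | ⟨rfl, rfl⟩
  · exact hne rfl
  · exact hne (add_comm _ _)

/-- Cramer's rule; multiplication by `ε` replaces division by the determinant. -/
theorem eq_combination {e g : Fin 2 → ℤ} {ε : ℤ} (hε : ε * ε = 1) (h : det e g = ε)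
    (v : Fin 2 → ℤ) (i : Fin 2) : v i = (ε * det v g) * e i + (ε * det e v) * g i := by
  simp only [det] at *
  have : v i = ε * ε * v i := by rw [hε, one_mul]
  rw [this]
  nth_rw 2 [← h]
  fin_cases i <;> simp <;> ring

/-- The vectors `c` and `c'` witness that `u` and `v` are primitive, and parallel primitive vectors
agree up to sign. -/
theorem eq_or_eq_neg_of_det_eq_zero {u v c c' : Fin 2 → ℤ} (hu : det u c = 1) (hv : det v c' = 1)
    (h : det u v = 0) : v = u ∨ v = -u := by
  have hvu : ∀ i, v i = det v c * u i := by
    intro i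
    have := eq_combination (ε := 1) (by norm_num) hu v i
    rw [h] at this
    linarith
  have hk : det v c * det u c' = 1 := by
    rw [← hv]
    conv_rhs => rw [det, hvu 0, hvu 1]
    rw [det]; simp only [det]; ring
  rcases Int.isUnit_iff.1 (IsUnit.of_mul_eq_one _ hk) with h1 | h1
  · left; funext i; rw [hvu i, h1, one_mul]
  · right; funext i; rw [hvu i, h1]; simp

end LatticePlane

/-! ### Unimodular frames at an edge and the crossing argument. -/

namespace LatticePlane

open Finset

variable {P : Set Plane} {E E₁ E₂ E₃ : (Fin 2 → ℤ) → (Fin 2 → ℤ) → Prop}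

theorem convex_three_mem (hP : Convex ℝ P) {x y z : Plane} (hx : x ∈ P) (hy : y ∈ P) (hz : z ∈ P)
    {α β γ : ℝ} (hα : 0 ≤ α) (hβ : 0 ≤ β) (hγ : 0 ≤ γ) (h : α + β + γ = 1) :
    α • x + β • y + γ • z ∈ P := by
  have := hP.sum_mem (t := (univ : Finset (Fin 3))) (w := ![α, β, γ]) (z := ![x, y, z])
    (by intro i _; fin_cases i <;> simpa) (by simp [Fin.sum_univ_three, h])
    (by intro i _; fin_cases i <;> simpa)
  simpa [Fin.sum_univ_three] using this

/-- A member of a lattice basis is not divisible by 2. -/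
theorem isOddVector_of_det {e g : Fin 2 → ℤ} {ε : ℤ} (hε : ε = 1 ∨ ε = -1) (h : det e g = ε)
    {s c : Fin 2 → ℤ} (hs : ∀ i, s i = 2 * c i + g i) : IsOddVector s := by
  by_contra hcon
  simp only [IsOddVector, not_or, Int.not_odd_iff_even] at hcon
  obtain ⟨⟨m, hm⟩, ⟨n, hn⟩⟩ := hcon
  have h0 : g 0 = 2 * (m - c 0) := by have := hs 0; lia
  have h1 : g 1 = 2 * (n - c 1) := by have := hs 1; lia
  have h2 : 2 * (e 0 * (n - c 1) - e 1 * (m - c 0)) = ε := by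
    rw [← h, det, h0, h1]; ring
  generalize e 0 * (n - c 1) - e 1 * (m - c 0) = r at h2
  rcases hε with rfl | rfl <;> omega

/-- The lower endpoint `a` of an edge `a b` together with a second edge `a₁ b₁` with the same midpoint
determines a unimodular frame in which `a₁` lies in a narrow cone, provided both edges belong to
systems with the same edges below. -/
theorem exists_frame (hP : Convex ℝ P) (hE₁ : IsEdgeSystem P E₁) (hE₂ : IsEdgeSystem P E₂)
    {a b a₁ b₁ : Fin 2 → ℤ} (h₁ : E₁ a₁ b₁) (h₂ : E₂ a b) (hsum : a₁ + b₁ = a + b)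
    (hab : height a < height b) (hab₁ : height a₁ < height b₁)
    (hagree : ∀ c d, height (c + d) < height (a + b) → E₂ c d → E₁ c d)
    {ε : ℤ} (hε : ε = 1 ∨ ε = -1) (hD : 0 < ε * det (b - a) (a₁ - a)) :
    ∃ (g : Fin 2 → ℤ) (x D : ℤ), det (b - a) g = ε ∧ 0 < D ∧ x ≤ 0 ∧ 1 - 2 * x ≤ D ∧
      ∀ i, a₁ i = a i + x * (b i - a i) + D * g i := by
  have hεε : ε * ε = 1 := by rcases hε with rfl | rfl <;> rfl
  obtain ⟨c, hc⟩ := hE₂.exists_det_eq_one h₂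
  obtain ⟨D, hDdef⟩ : ∃ D, D = ε * det (b - a) (a₁ - a) := ⟨_, rfl⟩
  rw [← hDdef] at hD
  obtain ⟨y, hy⟩ : ∃ y, y = det (a₁ - a) c := ⟨_, rfl⟩
  -- The second basis vector is free up to multiples of `b - a`. Division with remainder by `D`
  -- brings the first coordinate `x` of `a₁ - a` into the interval (-D, 0].
  obtain ⟨g, hg⟩ : ∃ g : Fin 2 → ℤ, g = fun i => ε * c i - ((-y) / D) * (b i - a i) := ⟨_, rfl⟩
  have hdet : det (b - a) g = ε := by
    have : det (b - a) g = ε * det (b - a) c := by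
      simp only [det, hg, Pi.sub_apply]; ring
    rw [this, hc, mul_one]
  obtain ⟨x, hx⟩ : ∃ x, x = ε * det (a₁ - a) g := ⟨_, rfl⟩
  have hx' : x = -((-y) % D) := by
    have : x = ε * ε * det (a₁ - a) c + ((-y) / D) * (ε * det (b - a) (a₁ - a)) := by
      rw [hx]; simp only [det, hg, Pi.sub_apply]; ring
    rw [this, ← hDdef, ← hy, hεε, Int.emod_def]; ring
  have hx0 : x ≤ 0 := by have := Int.emod_nonneg (-y) hD.ne'; omega
  have hxD : -D < x := by have := Int.emod_lt_of_pos (-y) hD; omega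
  have ha₁ : ∀ i, a₁ i = a i + x * (b i - a i) + D * g i := by
    intro i
    have := eq_combination hεε hdet (a₁ - a) i
    rw [← hx, ← hDdef] at this
    simp only [Pi.sub_apply] at this
    linarith
  have hb₁ : ∀ i, b₁ i = b i - x * (b i - a i) - D * g i := by
    intro i
    have := congrFun hsum i
    simp only [Pi.add_apply] at this
    linarith [ha₁ i]
  have hDR : (0 : ℝ) < D := by exact_mod_cast hD
  have hxR : (x : ℝ) ≤ 0 := by exact_mod_cast hx0
  have hxDR : (1 : ℝ) - x ≤ D := by exact_mod_cast (by omega : (1 : ℤ) - x ≤ D)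
  -- the midpoint of `a` and `a + g`
  have hmem : halfPoint (a + (a + g)) ∈ P := by
    have := convex_three_mem hP (hE₂.mem h₂) (hE₁.mem h₁) (hE₂.mem (hE₂.symm h₂))
      (α := 1 - 1 / (2 * D) - (-x) / (2 * D)) (β := 1 / (2 * D)) (γ := (-x) / (2 * D))
      (by
        rw [show (1 : ℝ) - 1 / (2 * D) - (-x) / (2 * D) = (2 * D - 1 + x) / (2 * D) by
          field_simp; ring]
        apply div_nonneg <;> linarith) (by positivity)
      (div_nonneg (by linarith) (by linarith)) (by ring)
    convert this using 1
    funext i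
    have : (a₁ i : ℝ) = a i + x * (b i - a i) + D * g i := by exact_mod_cast ha₁ i
    simp only [halfPoint, latticePoint, Pi.add_apply, Pi.smul_apply, smul_eq_mul, this]
    push_cast
    field_simp
    ring
  -- Since `a₁` is the lower endpoint, `height a₁ - height a` is less than half of `height b -
  -- height a`, while `x + D ≥ 1`.
  have hlow : height (a + (a + g)) < height (a + b) := by
    have h1 : D * (height (a + (a + g)) - height (a + b)) =
        (height a₁ - height a) - (x + D) * (height b - height a) := by
      have e0 : (a₁ 0 : ℝ) = a 0 + x * (b 0 - a 0) + D * g 0 := by exact_mod_cast ha₁ 0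
      have e1 : (a₁ 1 : ℝ) = a 1 + x * (b 1 - a 1) + D * g 1 := by exact_mod_cast ha₁ 1
      simp only [height, Pi.add_apply, e0, e1]
      push_cast
      ring
    have h2 : height a₁ + height b₁ = height a + height b := by
      rw [← height_add, ← height_add, hsum]
    have h3 : D * (height (a + (a + g)) - height (a + b)) < 0 := by
      rw [h1]; nlinarith
    by_contra! hcon
    nlinarith
  -- The second coordinates of the endpoints are integers with sum 1, so one of them is at least 1;
  -- that endpoint is called `q`.
  have hex : ∃ c d, E₂ c d ∧ c + d = a + (a + g) ∧ 1 ≤ ε * det (b - a) (d - a) := by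
    obtain ⟨c, d, hcd, hcds⟩ := hE₂.exists_edge _ hmem
      (isOddVector_of_det (c := a) hε hdet (fun i => by simp only [Pi.add_apply]; ring))
    have h1 : ε * det (b - a) (d - a) + ε * det (b - a) (c - a) = 1 := by
      have h0 := congrFun hcds 0
      have h1 := congrFun hcds 1
      simp only [Pi.add_apply] at h0 h1
      have : det (b - a) (d - a) + det (b - a) (c - a) = det (b - a) g := by
        simp only [det, Pi.sub_apply]
        rw [show g 0 = c 0 + d 0 - 2 * a 0 by linarith, show g 1 = c 1 + d 1 - 2 * a 1 by linarith]
        ring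
      rw [← mul_add, this, hdet, hεε]
    rcases le_or_gt 1 (ε * det (b - a) (d - a)) with h | h
    · exact ⟨c, d, hcd, hcds, h⟩
    · exact ⟨d, c, hE₂.symm hcd, by rw [add_comm]; exact hcds, by omega⟩
  obtain ⟨p, q, hpq, hpqs, hY⟩ := hex
  obtain ⟨X, hX⟩ : ∃ X, X = ε * det (q - a) g := ⟨_, rfl⟩
  obtain ⟨Y, hYdef⟩ : ∃ Y, Y = ε * det (b - a) (q - a) := ⟨_, rfl⟩
  rw [← hYdef] at hY
  have hq : ∀ i, q i = a i + X * (b i - a i) + Y * g i := by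
    intro i
    have := eq_combination hεε hdet (q - a) i
    rw [← hX, ← hYdef] at this
    simp only [Pi.sub_apply] at this
    linarith
  have hp : ∀ i, p i = a i - X * (b i - a i) + (1 - Y) * g i := by
    intro i
    have := congrFun hpqs i
    simp only [Pi.add_apply] at this
    linarith [hq i]
  have hne₁ : b₁ + a₁ ≠ p + q := by
    rw [add_comm, hsum, hpqs]
    intro h; rw [h] at hlow; exact lt_irrefl _ hlow
  have hne₂ : a + b ≠ p + q := by
    rw [hpqs]
    intro h; rw [h] at hlow; exact lt_irrefl _ hlow
  have hcross₁ : ∀ (_ : |(0 - 1) * (2 * Y - 1) - (1 - 0) * (2 * X)| <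
        |(2 * x - 1) * (2 * Y - 1) - 2 * D * (2 * X)|)
      (_ : |(0 - 1) * (2 * D) - (1 - 0) * (2 * x - 1)| <
        |(2 * x - 1) * (2 * Y - 1) - 2 * D * (2 * X)|), False := by
    refine hE₁.not_cross (a := a) (e := b - a) (g := g) (hE₁.symm h₁)
      (hagree p q (by rw [hpqs]; exact hlow) hpq) hne₁ ?_ ?_ ?_ ?_
    all_goals
      intro i
      simp only [hp, hq, ha₁, hb₁, Pi.sub_apply]
      ring
  have hcross₂ : ∀ (_ : |(0 - 1) * (2 * Y - 1) - (1 - 0) * (2 * X)| <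
        |1 * (2 * Y - 1) - 0 * (2 * X)|)
      (_ : |(0 - 1) * 0 - (1 - 0) * 1| < |1 * (2 * Y - 1) - 0 * (2 * X)|), False := by
    refine hE₂.not_cross (a := a) (e := b - a) (g := g) h₂ hpq hne₂ ?_ ?_ ?_ ?_
    all_goals
      intro i
      simp only [hp, hq, Pi.sub_apply]
      ring
  refine ⟨g, x, D, hdet, hD, hx0, ?_, ha₁⟩
  by_contra! hcon
  -- In frame coordinates the edge `p q` has midpoint (0, 1/2) and direction (2X, 2Y - 1). It
  -- crosses `a b` if it leans steeply to the left; in all other cases it crosses `a₁ b₁`, as `D < 1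
  -- - 2x` makes that edge flat.
  rcases lt_trichotomy X 0 with hX0 | hX0 | hX0
  · rcases le_or_gt (2 * Y - 1) (-X) with h | h
    · have key : (2 * D + 1) * (-X) ≤ (2 * x - 1) * (2 * Y - 1) - 2 * D * (2 * X) := by nlinarith
      have key2 : 2 * D + 1 ≤ (2 * D + 1) * (-X) := by nlinarith
      have key3 : 2 * (-X) < (2 * D + 1) * (-X) := by nlinarith
      refine hcross₁ ?_ ?_ <;> rw [lt_abs, abs_lt] <;> left <;> constructor <;> linarith
    · refine hcross₂ ?_ ?_ <;> rw [lt_abs, abs_lt] <;> left <;> constructor <;> linarith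
  · subst hX0
    have key : (1 - 2 * x) * (2 * Y - 1) = -((2 * x - 1) * (2 * Y - 1)) := by ring
    have hx1 : x < 0 := by omega
    have key2 : (1 - 2 * x) * 1 ≤ (1 - 2 * x) * (2 * Y - 1) := by nlinarith
    have key3 : 1 * (2 * Y - 1) < (1 - 2 * x) * (2 * Y - 1) := by nlinarith
    refine hcross₁ ?_ ?_ <;> rw [lt_abs] <;> right <;> rw [abs_lt] <;> constructor <;> linarith
  · have key : 2 * Y - 1 ≤ (1 - 2 * x) * (2 * Y - 1) := by nlinarith
    have key2 : 4 * X ≤ 2 * D * (2 * X) := by nlinarith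
    have key3 : 2 * D ≤ 2 * D * X := by nlinarith
    have key4 : (1 - 2 * x) * (2 * Y - 1) = -((2 * x - 1) * (2 * Y - 1)) := by ring
    refine hcross₁ ?_ ?_ <;> rw [lt_abs] <;> right <;> rw [abs_lt] <;> constructor <;> linarith

/-- Three edges with a common midpoint that belong to systems with the same edges below: the
contradiction in a frame. -/
theorem false_of_frame (hP : Convex ℝ P) (hE₁ : IsEdgeSystem P E₁) (hE₂ : IsEdgeSystem P E₂)
    (hE₃ : IsEdgeSystem P E₃) {a b a₁ b₁ a₃ b₃ : Fin 2 → ℤ} (h₁ : E₁ a₁ b₁) (h₂ : E₂ a b)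
    (h₃ : E₃ a₃ b₃) (hsum₁ : a₁ + b₁ = a + b) (hsum₃ : a₃ + b₃ = a + b)
    (hagree₁ : ∀ c d, height (c + d) < height (a + b) → E₂ c d → E₁ c d)
    (hagree₃ : ∀ c d, height (c + d) < height (a + b) → E₂ c d → E₃ c d)
    {ε : ℤ} (hε : ε = 1 ∨ ε = -1) {g : Fin 2 → ℤ} (hg : det (b - a) g = ε)
    (hg0 : height g < 0) {x₁ D₁ x₃ D₃ : ℤ} (hx₁ : x₁ ≤ 0) (hD₁ : 1 - x₁ ≤ D₁)
    (hx₃ : x₃ ≤ 0) (hD₃ : 0 < D₃) (ha₁ : ∀ i, a₁ i = a i + x₁ * (b i - a i) + D₁ * g i)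
    (ha₃ : ∀ i, a₃ i = a i + x₃ * (b i - a i) - D₃ * g i) : False := by
  have hεε : ε * ε = 1 := by rcases hε with rfl | rfl <;> rfl
  have hb₁ : ∀ i, b₁ i = b i - x₁ * (b i - a i) - D₁ * g i := by
    intro i
    have := congrFun hsum₁ i
    simp only [Pi.add_apply] at this
    linarith [ha₁ i]
  have hb₃ : ∀ i, b₃ i = b i - x₃ * (b i - a i) + D₃ * g i := by
    intro i
    have := congrFun hsum₃ i
    simp only [Pi.add_apply] at this
    linarith [ha₃ i]
  have hDR : (0 : ℝ) < D₁ := by exact_mod_cast (by omega : (0 : ℤ) < D₁)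
  have hxR : (x₁ : ℝ) ≤ 0 := by exact_mod_cast hx₁
  have hxDR : (1 : ℝ) - x₁ ≤ D₁ := by exact_mod_cast hD₁
  -- This midpoint has frame coordinates (1/2, 1/2). It lies in the triangle `a`, `a₁`, `b` because
  -- `1 - x₁ ≤ D₁`, and it is lower than the midpoint of `a b` because `g` points down.
  have hmem : halfPoint (b + (a + g)) ∈ P := by
    have := convex_three_mem hP (hE₂.mem h₂) (hE₁.mem h₁) (hE₂.mem (hE₂.symm h₂))
      (α := 1 / 2 - 1 / (2 * D₁) - (-x₁) / (2 * D₁)) (β := 1 / (2 * D₁))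
      (γ := 1 / 2 + (-x₁) / (2 * D₁))
      (by
        rw [show (1 : ℝ) / 2 - 1 / (2 * D₁) - (-x₁) / (2 * D₁) = (D₁ - 1 + x₁) / (2 * D₁) by
          field_simp; ring]
        apply div_nonneg <;> linarith) (by positivity)
      (add_nonneg (by norm_num) (div_nonneg (by linarith) (by linarith))) (by ring)
    convert this using 1
    funext i
    have : (a₁ i : ℝ) = a i + x₁ * (b i - a i) + D₁ * g i := by exact_mod_cast ha₁ i
    simp only [halfPoint, latticePoint, Pi.add_apply, Pi.smul_apply, smul_eq_mul, this]
    push_cast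
    field_simp
    ring
  have hlow : height (b + (a + g)) < height (a + b) := by
    rw [height_add, height_add a g, height_add a b]; linarith
  have hex : ∃ c d, E₂ c d ∧ c + d = b + (a + g) ∧ 1 ≤ ε * det (b - a) (d - a) := by
    obtain ⟨c, d, hcd, hcds⟩ := hE₂.exists_edge _ hmem
      (isOddVector_of_det (e := b - a) (g := (b - a) + g) (ε := ε) (c := a) hε
        (by rw [← hg]; simp only [det, Pi.add_apply, Pi.sub_apply]; ring)
        (fun i => by simp only [Pi.add_apply, Pi.sub_apply]; ring))
    have h1 : ε * det (b - a) (d - a) + ε * det (b - a) (c - a) = 1 := by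
      have h0 := congrFun hcds 0
      have h1 := congrFun hcds 1
      simp only [Pi.add_apply] at h0 h1
      have : det (b - a) (d - a) + det (b - a) (c - a) = det (b - a) g := by
        simp only [det, Pi.sub_apply]
        rw [show g 0 = c 0 + d 0 - a 0 - b 0 by linarith,
          show g 1 = c 1 + d 1 - a 1 - b 1 by linarith]
        ring
      rw [← mul_add, this, hg, hεε]
    rcases le_or_gt 1 (ε * det (b - a) (d - a)) with h | h
    · exact ⟨c, d, hcd, hcds, h⟩
    · exact ⟨d, c, hE₂.symm hcd, by rw [add_comm]; exact hcds, by omega⟩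
  obtain ⟨p, q, hpq, hpqs, hY⟩ := hex
  obtain ⟨X, hX⟩ : ∃ X, X = ε * det (q - a) g := ⟨_, rfl⟩
  obtain ⟨Y, hYdef⟩ : ∃ Y, Y = ε * det (b - a) (q - a) := ⟨_, rfl⟩
  rw [← hYdef] at hY
  have hq : ∀ i, q i = a i + X * (b i - a i) + Y * g i := by
    intro i
    have := eq_combination hεε hg (q - a) i
    rw [← hX, ← hYdef] at this
    simp only [Pi.sub_apply] at this
    linarith
  have hp : ∀ i, p i = b i - X * (b i - a i) + (1 - Y) * g i := by
    intro i
    have := congrFun hpqs i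
    simp only [Pi.add_apply] at this
    linarith [hq i]
  have hne : a + b ≠ p + q := by
    rw [hpqs]
    intro h; rw [h] at hlow; exact lt_irrefl _ hlow
  have hlow' : height (p + q) < height (a + b) := by rw [hpqs]; exact hlow
  have hcross₁ : ∀ (_ : |(1 - 1) * (2 * Y - 1) - (1 - 0) * (2 * X - 1)| <
        |(2 * x₁ - 1) * (2 * Y - 1) - 2 * D₁ * (2 * X - 1)|)
      (_ : |(1 - 1) * (2 * D₁) - (1 - 0) * (2 * x₁ - 1)| <
        |(2 * x₁ - 1) * (2 * Y - 1) - 2 * D₁ * (2 * X - 1)|), False := by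
    refine hE₁.not_cross (a := a) (e := b - a) (g := g) (hE₁.symm h₁)
      (hagree₁ p q hlow' hpq) (by rwa [add_comm, hsum₁]) ?_ ?_ ?_ ?_
    all_goals
      intro i
      simp only [hp, hq, ha₁, hb₁, Pi.sub_apply]
      ring
  have hcross₃ : ∀ (_ : |(1 - 1) * (2 * Y - 1) - (1 - 0) * (2 * X - 1)| <
        |(1 - 2 * x₃) * (2 * Y - 1) - 2 * D₃ * (2 * X - 1)|)
      (_ : |(1 - 1) * (2 * D₃) - (1 - 0) * (1 - 2 * x₃)| <
        |(1 - 2 * x₃) * (2 * Y - 1) - 2 * D₃ * (2 * X - 1)|), False := by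
    refine hE₃.not_cross (a := a) (e := b - a) (g := g) h₃
      (hagree₃ p q hlow' hpq) (by rwa [hsum₃]) ?_ ?_ ?_ ?_
    all_goals
      intro i
      simp only [hp, hq, ha₃, hb₃, Pi.sub_apply]
      ring
  have hcross₂ : ∀ (_ : |(1 - 1) * (2 * Y - 1) - (1 - 0) * (2 * X - 1)| <
        |1 * (2 * Y - 1) - 0 * (2 * X - 1)|)
      (_ : |(1 - 1) * 0 - (1 - 0) * 1| < |1 * (2 * Y - 1) - 0 * (2 * X - 1)|), False := by
    refine hE₂.not_cross (a := a) (e := b - a) (g := g) h₂ hpq hne ?_ ?_ ?_ ?_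
    all_goals
      intro i
      simp only [hp, hq, Pi.sub_apply]
      ring
  -- The common edge has direction (2X - 1, 2Y - 1) with `Y ≥ 1`. It leans far to the right and
  -- crosses `a₁ b₁`, or far to the left and crosses `a₃ b₃`, or it is steep and crosses `a b`.
  rcases le_or_gt (2 * Y - 1) (2 * X - 1) with h | h
  · have key : (2 * Y - 1) ≤ (1 - 2 * x₁) * (2 * Y - 1) := by nlinarith
    have key2 : 2 * X - 1 < 2 * D₁ * (2 * X - 1) := by nlinarith
    have key3 : 1 - 2 * x₁ ≤ (1 - 2 * x₁) * (2 * Y - 1) := by nlinarith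
    have key4 : (1 - 2 * x₁) * (2 * Y - 1) = -((2 * x₁ - 1) * (2 * Y - 1)) := by ring
    refine hcross₁ ?_ ?_ <;> rw [lt_abs] <;> right <;> rw [abs_lt] <;> constructor <;> linarith
  rcases le_or_gt (2 * X - 1) (-(2 * Y - 1)) with h' | h'
  · have key : (2 * Y - 1) ≤ (1 - 2 * x₃) * (2 * Y - 1) := by nlinarith
    have key2 : 1 - 2 * X < 2 * D₃ * (1 - 2 * X) := by nlinarith
    have key3 : 1 - 2 * x₃ ≤ (1 - 2 * x₃) * (2 * Y - 1) := by nlinarith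
    have key4 : 2 * D₃ * (1 - 2 * X) = -(2 * D₃ * (2 * X - 1)) := by ring
    refine hcross₃ ?_ ?_ <;> rw [lt_abs, abs_lt] <;> left <;> constructor <;> linarith
  · have hY2 : 2 ≤ Y := by omega
    refine hcross₂ ?_ ?_ <;> rw [lt_abs, abs_lt] <;> left <;> constructor <;> linarith

end LatticePlane

/-! ### At most two edges at the next midpoint, and the count for systems of edges. -/

namespace LatticePlane

open Finset

variable {P : Set Plane} {E E₁ E₂ E₃ : (Fin 2 → ℤ) → (Fin 2 → ℤ) → Prop}

theorem height_sub (s t : Fin 2 → ℤ) : height (s - t) = height s - height t := by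
  have := height_add (s - t) t
  rw [sub_add_cancel] at this
  linarith

/-- Three edges with a common midpoint in three systems with the same edges below do not exist, if
the second edge is between the other two. -/
theorem false_of_middle (hP : Convex ℝ P) (hE₁ : IsEdgeSystem P E₁) (hE₂ : IsEdgeSystem P E₂)
    (hE₃ : IsEdgeSystem P E₃) {s a b a₁ b₁ a₃ b₃ : Fin 2 → ℤ} (h₁ : E₁ a₁ b₁) (h₂ : E₂ a b)
    (h₃ : E₃ a₃ b₃) (hsum₁ : a₁ + b₁ = s) (hsum₂ : a + b = s) (hsum₃ : a₃ + b₃ = s)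
    (hab₁ : height a₁ < height b₁) (hab : height a < height b) (hab₃ : height a₃ < height b₃)
    (hagree₁ : ∀ c d, height (c + d) < height s → E₂ c d → E₁ c d)
    (hagree₃ : ∀ c d, height (c + d) < height s → E₂ c d → E₃ c d)
    (hdet₁ : 0 < det (b₁ - a₁) (b - a)) (hdet₃ : 0 < det (b - a) (b₃ - a₃)) : False := by
  subst hsum₂
  have hd : ∀ {p q : Fin 2 → ℤ}, p + q = a + b →
      2 * det (b - a) (p - a) = det (q - p) (b - a) := by
    intro p q h
    have e0 := congrFun h 0
    have e1 := congrFun h 1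
    simp only [Pi.add_apply] at e0 e1
    simp only [det, Pi.sub_apply]
    rw [show q 0 = a 0 + b 0 - p 0 by linarith, show q 1 = a 1 + b 1 - p 1 by linarith]
    ring
  have hanti : ∀ u v : Fin 2 → ℤ, det u v = - det v u := fun u v => by simp only [det]; ring
  obtain ⟨g, x, D, hg, hD, hx, hxD, ha⟩ := exists_frame hP hE₁ hE₂ h₁ h₂ hsum₁ hab hab₁ hagree₁
    (ε := 1) (Or.inl rfl) (by have := hd hsum₁; linarith)
  obtain ⟨g', x', D', hg', hD', hx', hxD', ha'⟩ := exists_frame hP hE₃ hE₂ h₃ h₂ hsum₃ hab hab₃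
    hagree₃ (ε := -1) (Or.inr rfl) (by
      have h1 := hd hsum₃; have h2 := hanti (b - a) (b₃ - a₃); linarith)
  -- The bound `1 - 2 * y ≤ C` of the narrow cone, with `p` the lower endpoint, makes the frame
  -- vector rise by less than half of what `b - a` rises.
  have hlow : ∀ {p q w : Fin 2 → ℤ} {y C : ℤ}, p + q = a + b → height p < height q → 0 < C →
      1 - 2 * y ≤ C → (∀ i, p i = a i + y * (b i - a i) + C * w i) →
      2 * height w < height b - height a := by
    intro p q w y C hpq hlt hC hyC hp
    have h1 : C * height w = (height p - height a) - y * (height b - height a) := by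
      have e0 : (p 0 : ℝ) = a 0 + y * (b 0 - a 0) + C * w 0 := by exact_mod_cast hp 0
      have e1 : (p 1 : ℝ) = a 1 + y * (b 1 - a 1) + C * w 1 := by exact_mod_cast hp 1
      simp only [height, e0, e1]
      ring
    have h2 : height p + height q = height a + height b := by
      rw [← height_add, ← height_add, hpq]
    have hCR : (0 : ℝ) < C := by exact_mod_cast hC
    have hyR : (1 : ℝ) - 2 * y ≤ C := by exact_mod_cast hyC
    by_contra! hcon
    nlinarith
  have hlg := hlow hsum₁ hab₁ hD hxD ha
  have hlg' := hlow hsum₃ hab₃ hD' hxD' ha'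
  -- The frame vectors on the two sides of `a b` have opposite determinants with `b - a`, so their
  -- sum is a multiple of `b - a`. The height bounds give `k < 1`, and then one of the two vectors
  -- must point down.
  obtain ⟨k, hk⟩ : ∃ k : ℤ, ∀ i, g i + g' i = k * (b i - a i) := by
    refine ⟨1 * det (g + g') g, fun i => ?_⟩
    have h0 : det (b - a) (g + g') = 0 := by
      have : det (b - a) (g + g') = det (b - a) g + det (b - a) g' := by
        simp only [det, Pi.add_apply]; ring
      rw [this, hg, hg']; rfl
    have := eq_combination (ε := 1) (by norm_num) hg (g + g') i
    rw [h0] at this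
    simpa using this
  have hkh : height g + height g' = k * (height b - height a) := by
    have e0 : (g 0 : ℝ) + g' 0 = k * (b 0 - a 0) := by exact_mod_cast hk 0
    have e1 : (g 1 : ℝ) + g' 1 = k * (b 1 - a 1) := by exact_mod_cast hk 1
    simp only [height]
    linear_combination e0 + Real.sqrt 2 * e1
  have hk0 : k ≤ 0 := by
    by_contra! hcon
    have : (1 : ℝ) ≤ k := by exact_mod_cast hcon
    nlinarith
  have hk0R : (k : ℝ) ≤ 0 := by exact_mod_cast hk0
  have hneg : height g < 0 ∨ height g' < 0 := by
    by_contra! hcon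
    have h0 : height g = 0 := by nlinarith [hcon.1, hcon.2]
    have : g = 0 := height_injective (by rw [h0]; simp [height])
    rw [this] at hg
    simp [det] at hg
  rcases hneg with hneg | hneg
  -- Substituting `g' = k (b - a) - g` expresses `a₃` in the frame of `g`; its first coordinate `x'
  -- + D' k` stays nonpositive since `k ≤ 0`.
  · exact false_of_frame hP hE₁ hE₂ hE₃ h₁ h₂ h₃ hsum₁ hsum₃ hagree₁ hagree₃ (Or.inl rfl) hg hneg
      (x₁ := x) (D₁ := D) (x₃ := x' + D' * k) (D₃ := D') hx (by linarith) (by nlinarith) hD' ha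
      (fun i => by rw [ha' i]; linear_combination D' * hk i)
  · exact false_of_frame hP hE₃ hE₂ hE₁ h₃ h₂ h₁ hsum₃ hsum₁ hagree₃ hagree₁ (Or.inr rfl) hg' hneg
      (x₁ := x') (D₁ := D') (x₃ := x + D * k) (D₃ := D) hx' (by linarith) (by nlinarith) hD ha'
      (fun i => by rw [ha i]; linear_combination D * hk i)

theorem det_ne_zero_of_ne (hE₁ : IsEdgeSystem P E₁) (hE₂ : IsEdgeSystem P E₂)
    {s a b c d : Fin 2 → ℤ} (h₁ : E₁ a b) (h₂ : E₂ c d) (hs₁ : a + b = s) (hs₂ : c + d = s)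
    (hab : height a < height b) (hcd : height c < height d) (hne : a ≠ c) :
    det (b - a) (d - c) ≠ 0 := by
  intro h0
  obtain ⟨u, hu⟩ := hE₁.exists_det_eq_one h₁
  obtain ⟨v, hv⟩ := hE₂.exists_det_eq_one h₂
  have hsum := hs₁.trans hs₂.symm
  rcases eq_or_eq_neg_of_det_eq_zero hu hv h0 with h | h
  · apply hne
    funext i
    have h1 := congrFun h i
    have h2 := congrFun hsum i
    simp only [Pi.add_apply, Pi.sub_apply] at h1 h2
    omega
  · have : height (d - c) = height (-(b - a)) := by rw [h]
    rw [neg_sub, height_sub, height_sub] at this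
    linarith

/-- Three distinct candidates have pairwise nonparallel directions. Whatever the signs of the three
determinants, one candidate can play the middle role in `false_of_middle`. -/
theorem eq_of_three (hP : Convex ℝ P) (hE₁ : IsEdgeSystem P E₁) (hE₂ : IsEdgeSystem P E₂)
    (hE₃ : IsEdgeSystem P E₃) {s a₁ b₁ a₂ b₂ a₃ b₃ : Fin 2 → ℤ} (h₁ : E₁ a₁ b₁) (h₂ : E₂ a₂ b₂)
    (h₃ : E₃ a₃ b₃) (hs₁ : a₁ + b₁ = s) (hs₂ : a₂ + b₂ = s) (hs₃ : a₃ + b₃ = s)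
    (hab₁ : height a₁ < height b₁) (hab₂ : height a₂ < height b₂) (hab₃ : height a₃ < height b₃)
    (h12 : ∀ c d, height (c + d) < height s → (E₁ c d ↔ E₂ c d))
    (h13 : ∀ c d, height (c + d) < height s → (E₁ c d ↔ E₃ c d)) :
    a₁ = a₂ ∨ a₁ = a₃ ∨ a₂ = a₃ := by
  by_contra! hne
  obtain ⟨n12, n13, n23⟩ := hne
  have x0 := det_ne_zero_of_ne hE₁ hE₂ h₁ h₂ hs₁ hs₂ hab₁ hab₂ n12
  have y0 := det_ne_zero_of_ne hE₂ hE₃ h₂ h₃ hs₂ hs₃ hab₂ hab₃ n23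
  have w0 := det_ne_zero_of_ne hE₃ hE₁ h₃ h₁ hs₃ hs₁ hab₃ hab₁ n13.symm
  have hanti : ∀ u v : Fin 2 → ℤ, det u v = - det v u := fun u v => by simp only [det]; ring
  have x1 := hanti (b₁ - a₁) (b₂ - a₂)
  have y1 := hanti (b₂ - a₂) (b₃ - a₃)
  have w1 := hanti (b₃ - a₃) (b₁ - a₁)
  have a12 : ∀ c d, height (c + d) < height s → E₁ c d → E₂ c d := fun c d h => (h12 c d h).1
  have a21 : ∀ c d, height (c + d) < height s → E₂ c d → E₁ c d := fun c d h => (h12 c d h).2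
  have a13 : ∀ c d, height (c + d) < height s → E₁ c d → E₃ c d := fun c d h => (h13 c d h).1
  have a31 : ∀ c d, height (c + d) < height s → E₃ c d → E₁ c d := fun c d h => (h13 c d h).2
  have a23 : ∀ c d, height (c + d) < height s → E₂ c d → E₃ c d :=
    fun c d h h' => a13 c d h (a21 c d h h')
  have a32 : ∀ c d, height (c + d) < height s → E₃ c d → E₂ c d :=
    fun c d h h' => a12 c d h (a31 c d h h')
  rcases lt_or_gt_of_ne x0 with hx | hx <;> rcases lt_or_gt_of_ne y0 with hy | hy
  · exact false_of_middle hP hE₃ hE₂ hE₁ h₃ h₂ h₁ hs₃ hs₂ hs₁ hab₃ hab₂ hab₁ a23 a21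
      (by linarith) (by linarith)
  · rcases lt_or_gt_of_ne w0 with hw | hw
    · exact false_of_middle hP hE₂ hE₁ hE₃ h₂ h₁ h₃ hs₂ hs₁ hs₃ hab₂ hab₁ hab₃ a12 a13
        (by linarith) (by linarith)
    · exact false_of_middle hP hE₂ hE₃ hE₁ h₂ h₃ h₁ hs₂ hs₃ hs₁ hab₂ hab₃ hab₁ a32 a31
        (by linarith) (by linarith)
  · rcases lt_or_gt_of_ne w0 with hw | hw
    · exact false_of_middle hP hE₁ hE₃ hE₂ h₁ h₃ h₂ hs₁ hs₃ hs₂ hab₁ hab₃ hab₂ a31 a32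
        (by linarith) (by linarith)
    · exact false_of_middle hP hE₃ hE₁ hE₂ h₃ h₁ h₂ hs₃ hs₁ hs₂ hab₃ hab₁ hab₂ a13 a12
        (by linarith) (by linarith)
  · exact false_of_middle hP hE₁ hE₂ hE₃ h₁ h₂ h₃ hs₁ hs₂ hs₃ hab₁ hab₂ hab₃ a21 a23
      (by linarith) (by linarith)

theorem IsEdgeSystem.halfPoint_mem (hP : Convex ℝ P) (hE : IsEdgeSystem P E) {a b : Fin 2 → ℤ}
    (h : E a b) : halfPoint (a + b) ∈ P := by
  have := hP (hE.mem h) (hE.mem (hE.symm h)) (a := (1 : ℝ) / 2) (b := 1 / 2) (by norm_num)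
    (by norm_num) (by norm_num)
  convert this using 1
  funext i
  simp [halfPoint, latticePoint]
  ring

theorem IsEdgeSystem.isOddVector (hE : IsEdgeSystem P E) {a b : Fin 2 → ℤ}
    (h : E a b) : IsOddVector (a + b) := by
  obtain ⟨c, hc⟩ := hE.exists_det_eq_one h
  refine isOddVector_of_det (e := -c) (g := b - a) (ε := 1) (c := a) (Or.inl rfl) ?_ ?_
  · rw [← hc]; simp only [det, Pi.sub_apply, Pi.neg_apply]; ring
  · intro i; simp only [Pi.add_apply, Pi.sub_apply]; ring

theorem IsEdgeSystem.height_ne (hE : IsEdgeSystem P E) {a b : Fin 2 → ℤ}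
    (h : E a b) : height a ≠ height b := by
  intro heq
  obtain ⟨c, hc⟩ := hE.exists_det_eq_one h
  rw [height_injective heq] at hc
  simp [det] at hc

theorem IsEdgeSystem.exists_edge_lt (hE : IsEdgeSystem P E) {s : Fin 2 → ℤ}
    (hs : halfPoint s ∈ P) (hs' : IsOddVector s) :
    ∃ a b, E a b ∧ a + b = s ∧ height a < height b := by
  obtain ⟨a, b, hab, hsum⟩ := hE.exists_edge s hs hs'
  rcases lt_or_gt_of_ne (hE.height_ne hab) with h | h
  · exact ⟨a, b, hab, hsum, h⟩
  · exact ⟨b, a, hE.symm hab, by rw [add_comm]; exact hsum, h⟩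

/-- The set of edges with midpoint `s / 2`. -/
def edgesAt (E : (Fin 2 → ℤ) → (Fin 2 → ℤ) → Prop) (s : Fin 2 → ℤ) :
    Set ((Fin 2 → ℤ) × (Fin 2 → ℤ)) := {p | E p.1 p.2 ∧ p.1 + p.2 = s}

theorem IsEdgeSystem.eq_of_sum_eq (hE : IsEdgeSystem P E) {a b c d : Fin 2 → ℤ}
    (h : E a b) (h' : E c d) (hs : a + b = c + d) : (a = c ∧ b = d) ∨ (a = d ∧ b = c) := by
  refine hE.eq_of_cross (lam := 0) (mu := 0) h h' (by simp) (by simp) fun i => ?_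
  have := congrFun hs i
  simp only [Pi.add_apply] at this
  have h2 : (a i : ℝ) + b i = c i + d i := by exact_mod_cast this
  linarith

theorem edgesAt_subset (hE₁ : IsEdgeSystem P E₁) (hE₂ : IsEdgeSystem P E₂) {a b : Fin 2 → ℤ}
    (h₁ : E₁ a b) (h₂ : E₂ a b) : edgesAt E₁ (a + b) ⊆ edgesAt E₂ (a + b) := by
  rintro ⟨c, d⟩ ⟨hcd, hs⟩
  refine ⟨?_, hs⟩
  rcases hE₁.eq_of_sum_eq hcd h₁ hs with ⟨rfl, rfl⟩ | ⟨rfl, rfl⟩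
  · exact h₂
  · exact hE₂.symm h₂

theorem edgesAt_eq (hE₁ : IsEdgeSystem P E₁) (hE₂ : IsEdgeSystem P E₂) {a b : Fin 2 → ℤ}
    (h₁ : E₁ a b) (h₂ : E₂ a b) : edgesAt E₁ (a + b) = edgesAt E₂ (a + b) :=
  (edgesAt_subset hE₁ hE₂ h₁ h₂).antisymm (edgesAt_subset hE₂ hE₁ h₂ h₁)

/-- A supporting functional at a point that is not interior. -/
theorem exists_functional (hP : Convex ℝ P) (hint : (interior P).Nonempty) {x : Plane}
    (hx : x ∉ interior P) :
    ∃ α β : ℝ, (α ≠ 0 ∨ β ≠ 0) ∧ ∀ y ∈ P, α * y 0 + β * y 1 ≤ α * x 0 + β * x 1 := by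
  obtain ⟨f, hf⟩ := geometric_hahn_banach_open_point hP.interior isOpen_interior hx
  have hfe : ∀ y : Plane, f y = f (Pi.single 0 1) * y 0 + f (Pi.single 1 1) * y 1 := by
    intro y
    have : y = y 0 • (Pi.single 0 1 : Plane) + y 1 • (Pi.single 1 1 : Plane) := by
      funext i; fin_cases i <;> simp
    conv_lhs => rw [this]
    rw [map_add, map_smul, map_smul, smul_eq_mul, smul_eq_mul]
    ring
  refine ⟨f (Pi.single 0 1), f (Pi.single 1 1), ?_, fun y hy => ?_⟩
  · by_contra! hcon
    obtain ⟨z, hz⟩ := hint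
    have := hf z hz
    rw [hfe z, hfe x, hcon.1, hcon.2] at this
    simp at this
  · rw [← hfe, ← hfe]
    have hcl : y ∈ closure (interior P) := by
      rw [hP.closure_interior_eq_closure_of_nonempty_interior hint]
      exact subset_closure hy
    exact closure_minimal (t := {z | f z ≤ f x}) (fun z hz => (hf z hz).le)
      (isClosed_le f.continuous continuous_const) hcl

/-- The edges whose midpoints are on the boundary are the same for all systems. -/
theorem edge_of_not_mem_interior (hP : Convex ℝ P) (hint : (interior P).Nonempty)
    (hE₁ : IsEdgeSystem P E₁) (hE₂ : IsEdgeSystem P E₂) {a b : Fin 2 → ℤ} (h : E₁ a b)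
    (hs : halfPoint (a + b) ∉ interior P) : E₂ a b := by
  obtain ⟨c, d, hcd, hsum⟩ := hE₂.exists_edge _ (hE₁.halfPoint_mem hP h) (hE₁.isOddVector h)
  obtain ⟨α, β, hαβ, hle⟩ := exists_functional hP hint hs
  -- The functional attains its maximum on `P` at the midpoint, so it is constant along every
  -- segment of `P` with this midpoint. Both edges are therefore parallel, and being primitive with
  -- the same midpoint they coincide.
  have key : ∀ p q : Fin 2 → ℤ, latticePoint p ∈ P → latticePoint q ∈ P → p + q = a + b →
      α * (q 0 - p 0) + β * (q 1 - p 1) = 0 := by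
    intro p q hp hq hpq
    have h1 := hle _ hp
    have h2 := hle _ hq
    have e0 : (p 0 : ℝ) + q 0 = a 0 + b 0 := by exact_mod_cast congrFun hpq 0
    have e1 : (p 1 : ℝ) + q 1 = a 1 + b 1 := by exact_mod_cast congrFun hpq 1
    simp only [latticePoint, halfPoint, Pi.add_apply, Int.cast_add, ← e0, ← e1] at h1 h2
    linarith
  have k1 := key a b (hE₁.mem h) (hE₁.mem (hE₁.symm h)) rfl
  have k2 := key c d (hE₂.mem hcd) (hE₂.mem (hE₂.symm hcd)) hsum
  have hdet : det (b - a) (d - c) = 0 := by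
    have : ((b 0 - a 0 : ℝ) * (d 1 - c 1) - (b 1 - a 1) * (d 0 - c 0)) = 0 := by
      rcases hαβ with h0 | h0
      · refine (mul_eq_zero.1 ?_).resolve_left h0
        linear_combination (d 1 - c 1 : ℝ) * k1 - (b 1 - a 1 : ℝ) * k2
      · refine (mul_eq_zero.1 ?_).resolve_left h0
        linear_combination -(d 0 - c 0 : ℝ) * k1 + (b 0 - a 0 : ℝ) * k2
    simp only [det, Pi.sub_apply]
    exact_mod_cast this
  obtain ⟨u, hu⟩ := hE₁.exists_det_eq_one h
  obtain ⟨v, hv⟩ := hE₂.exists_det_eq_one hcd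
  rcases eq_or_eq_neg_of_det_eq_zero hu hv hdet with h' | h'
  · have hc : c = a := by
      funext i
      have h1 := congrFun h' i
      have h2 := congrFun hsum i
      simp only [Pi.add_apply, Pi.sub_apply] at h1 h2
      omega
    subst hc
    rwa [add_left_cancel hsum] at hcd
  · have hc : c = b := by
      funext i
      have h1 := congrFun h' i
      have h2 := congrFun hsum i
      simp only [Pi.add_apply, Pi.sub_apply, Pi.neg_apply] at h1 h2
      omega
    subst hc
    rw [add_comm a c] at hsum
    rw [add_left_cancel hsum] at hcd
    exact hE₂.symm hcd

/-- A family of objects that are determined by systems of edges in `P` has at most `2 ^ n` members,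
where `n` is the number of interior points of `P` that are midpoints of edges. -/
theorem ncard_le_of_isEdgeSystem {X : Type*} (hP : Convex ℝ P) (hint : (interior P).Nonempty)
    (𝓕 : Set X) (E : X → (Fin 2 → ℤ) → (Fin 2 → ℤ) → Prop)
    (hE : ∀ T ∈ 𝓕, IsEdgeSystem P (E T))
    (hinj : ∀ T ∈ 𝓕, ∀ T' ∈ 𝓕, (∀ a b, E T a b ↔ E T' a b) → T = T')
    (I : Finset (Fin 2 → ℤ)) (hI : ∀ s, s ∈ I ↔ halfPoint s ∈ interior P ∧ IsOddVector s) :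
    𝓕.Finite ∧ 𝓕.ncard ≤ 2 ^ #I := by
  refine finite_and_ncard_le_two_pow I height (fun T s => edgesAt (E T) s) 𝓕 ?_ ?_
  · have key : ∀ T ∈ 𝓕, ∀ T' ∈ 𝓕, (∀ s ∈ I, edgesAt (E T) s = edgesAt (E T') s) →
        ∀ a b, E T a b → E T' a b := by
      intro T hT T' hT' h a b hab
      by_cases hs : halfPoint (a + b) ∈ interior P
      · have h1 := h (a + b) ((hI _).2 ⟨hs, (hE T hT).isOddVector hab⟩)
        have h2 : (a, b) ∈ edgesAt (E T) (a + b) := ⟨hab, rfl⟩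
        rw [h1] at h2
        exact h2.1
      · exact edge_of_not_mem_interior hP hint (hE T hT) (hE T' hT') hab hs
    intro T hT T' hT' h
    exact hinj T hT T' hT' fun a b =>
      ⟨key T hT T' hT' h a b, key T' hT' T hT (fun s hs => (h s hs).symm) a b⟩
  · intro s hs T₁ hT₁ T₂ hT₂ T₃ hT₃ h12 h13
    have key : ∀ T ∈ 𝓕, ∀ T' ∈ 𝓕,
        (∀ s' ∈ I, height s' < height s → edgesAt (E T) s' = edgesAt (E T') s') →
        ∀ c d, height (c + d) < height s → E T c d → E T' c d := by
      intro T hT T' hT' h c d hlt hcd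
      by_cases hs : halfPoint (c + d) ∈ interior P
      · have h1 := h (c + d) ((hI _).2 ⟨hs, (hE T hT).isOddVector hcd⟩) hlt
        have h2 : (c, d) ∈ edgesAt (E T) (c + d) := ⟨hcd, rfl⟩
        rw [h1] at h2
        exact h2.1
      · exact edge_of_not_mem_interior hP hint (hE T hT) (hE T' hT') hcd hs
    obtain ⟨hsP, hsodd⟩ := (hI s).1 hs
    have hsP := interior_subset hsP
    obtain ⟨a₁, b₁, e₁, s₁, l₁⟩ := (hE T₁ hT₁).exists_edge_lt hsP hsodd
    obtain ⟨a₂, b₂, e₂, s₂, l₂⟩ := (hE T₂ hT₂).exists_edge_lt hsP hsodd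
    obtain ⟨a₃, b₃, e₃, s₃, l₃⟩ := (hE T₃ hT₃).exists_edge_lt hsP hsodd
    have hsame : ∀ {T T' a b c d}, T ∈ 𝓕 → T' ∈ 𝓕 → E T a b → E T' c d → a + b = s → c + d = s →
        a = c → edgesAt (E T) s = edgesAt (E T') s := by
      intro T T' a b c d hT hT' h h' hab hcd hac
      subst hac
      have : b = d := add_left_cancel (hab.trans hcd.symm)
      subst this
      rw [← hab]
      exact edgesAt_eq (hE T hT) (hE T' hT') h h'
    rcases eq_of_three hP (hE T₁ hT₁) (hE T₂ hT₂) (hE T₃ hT₃) e₁ e₂ e₃ s₁ s₂ s₃ l₁ l₂ l₃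
      (fun c d h => ⟨key T₁ hT₁ T₂ hT₂ h12 c d h,
        key T₂ hT₂ T₁ hT₁ (fun s hs hl => (h12 s hs hl).symm) c d h⟩)
      (fun c d h => ⟨key T₁ hT₁ T₃ hT₃ h13 c d h,
        key T₃ hT₃ T₁ hT₁ (fun s hs hl => (h13 s hs hl).symm) c d h⟩) with h | h | h
    · exact Or.inl (hsame hT₁ hT₂ e₁ e₂ s₁ s₂ h)
    · exact Or.inr (Or.inl (hsame hT₁ hT₃ e₁ e₃ s₁ s₃ h))
    · exact Or.inr (Or.inr (hsame hT₂ hT₃ e₂ e₃ s₂ s₃ h))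

end LatticePlane

/-! ### Unimodular triangles and the edges of a triangulation. -/

namespace LatticePlane

open Finset

variable {P : Set Plane} {T T' : Set (Set Plane)}

/-- The triangle with vertices `a`, `b`, `c`. -/
def triangle (a b c : Fin 2 → ℤ) : Set Plane :=
  {x | ∃ β γ : ℝ, 0 ≤ β ∧ 0 ≤ γ ∧ β + γ ≤ 1 ∧
    ∀ i, x i = a i + β * (b i - a i) + γ * (c i - a i)}

theorem triangle_eq_convexHull (a b c : Fin 2 → ℤ) :
    triangle a b c = convexHull ℝ {latticePoint a, latticePoint b, latticePoint c} := by
  apply Set.Subset.antisymm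
  · rintro x ⟨β, γ, hβ, hγ, h, hx⟩
    have := convex_three_mem (convex_convexHull ℝ {latticePoint a, latticePoint b, latticePoint c})
      (subset_convexHull ℝ _ (by simp : latticePoint a ∈ _))
      (subset_convexHull ℝ _ (by simp : latticePoint b ∈ _))
      (subset_convexHull ℝ _ (by simp : latticePoint c ∈ _))
      (α := 1 - β - γ) (by linarith) hβ hγ (by ring)
    convert this using 1
    funext i
    simp only [hx, Pi.add_apply, Pi.smul_apply, smul_eq_mul, latticePoint]
    ring
  · apply convexHull_min
    · rintro x (rfl | rfl | rfl)
      · exact ⟨0, 0, by simp [latticePoint]⟩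
      · exact ⟨1, 0, by simp [latticePoint]⟩
      · exact ⟨0, 1, by simp [latticePoint]⟩
    · rintro x ⟨β, γ, hβ, hγ, h, hx⟩ y ⟨β', γ', hβ', hγ', h', hy⟩ s t hs ht hst
      refine ⟨s * β + t * β', s * γ + t * γ', by positivity, by positivity, by nlinarith, ?_⟩
      intro i
      simp only [Pi.add_apply, Pi.smul_apply, smul_eq_mul, hx, hy]
      linear_combination (a i : ℝ) * hst

theorem triangle_swap (a b c : Fin 2 → ℤ) : triangle b a c = triangle a b c := by
  rw [triangle_eq_convexHull, triangle_eq_convexHull, Set.insert_comm]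

theorem triangle_rotate (a b c : Fin 2 → ℤ) : triangle b c a = triangle a b c := by
  rw [triangle_eq_convexHull, triangle_eq_convexHull, Set.pair_comm (latticePoint c),
    Set.insert_comm]

theorem convex_triangle (a b c : Fin 2 → ℤ) : Convex ℝ (triangle a b c) := by
  rw [triangle_eq_convexHull]; exact convex_convexHull ℝ _

theorem isClosed_triangle (a b c : Fin 2 → ℤ) : IsClosed (triangle a b c) := by
  rw [triangle_eq_convexHull]
  exact ((Set.toFinite _).isCompact_convexHull (𝕜 := ℝ)).isClosed

theorem left_mem_triangle (a b c : Fin 2 → ℤ) : latticePoint a ∈ triangle a b c :=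
  ⟨0, 0, by simp [latticePoint]⟩

theorem volume_standard_triangle :
    MeasureTheory.volume {x : Plane | 0 ≤ x 0 ∧ 0 ≤ x 1 ∧ x 0 + x 1 ≤ 1} = 1 / 2 := by
  have hmeas : MeasurableSet {p : ℝ × ℝ | 0 ≤ p.1 ∧ 0 ≤ p.2 ∧ p.1 + p.2 ≤ 1} := by
    apply IsClosed.measurableSet
    exact (isClosed_le continuous_const continuous_fst).inter
      ((isClosed_le continuous_const continuous_snd).inter
        (isClosed_le (continuous_fst.add continuous_snd) continuous_const))
  have h := (MeasureTheory.volume_preserving_finTwoArrow ℝ).measure_preimage hmeas.nullMeasurableSet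
  have heq : (MeasurableEquiv.finTwoArrow : (Fin 2 → ℝ) ≃ᵐ ℝ × ℝ) ⁻¹'
      {p : ℝ × ℝ | 0 ≤ p.1 ∧ 0 ≤ p.2 ∧ p.1 + p.2 ≤ 1} =
      {x : Plane | 0 ≤ x 0 ∧ 0 ≤ x 1 ∧ x 0 + x 1 ≤ 1} := rfl
  rw [heq] at h
  rw [h, MeasureTheory.Measure.volume_eq_prod, MeasureTheory.Measure.prod_apply hmeas]
  have hslice : ∀ x : ℝ, MeasureTheory.volume
      (Prod.mk x ⁻¹' {p : ℝ × ℝ | 0 ≤ p.1 ∧ 0 ≤ p.2 ∧ p.1 + p.2 ≤ 1}) =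
      (Set.Icc (0 : ℝ) 1).indicator (fun x => ENNReal.ofReal (1 - x)) x := by
    intro x
    by_cases hx : x ∈ Set.Icc (0 : ℝ) 1
    · have : Prod.mk x ⁻¹' {p : ℝ × ℝ | 0 ≤ p.1 ∧ 0 ≤ p.2 ∧ p.1 + p.2 ≤ 1} = Set.Icc 0 (1 - x) := by
        ext y
        simp only [Set.mem_preimage, Set.mem_ofPred_eq, Set.mem_Icc]
        exact ⟨fun h => ⟨h.2.1, by linarith [h.2.2]⟩, fun h => ⟨hx.1, h.1, by linarith [h.2]⟩⟩
      rw [this, Real.volume_Icc, Set.indicator_of_mem hx, sub_zero]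
    · have : Prod.mk x ⁻¹' {p : ℝ × ℝ | 0 ≤ p.1 ∧ 0 ≤ p.2 ∧ p.1 + p.2 ≤ 1} = ∅ := by
        ext y
        simp only [Set.mem_preimage, Set.mem_ofPred_eq, Set.mem_empty_iff_false, iff_false]
        exact fun h => hx ⟨h.1, by linarith [h.2.1, h.2.2]⟩
      rw [this, Set.indicator_of_notMem hx, MeasureTheory.measure_empty]
  simp_rw [hslice]
  rw [MeasureTheory.lintegral_indicator measurableSet_Icc,
    ← MeasureTheory.ofReal_integral_eq_lintegral_ofReal]
  · rw [MeasureTheory.integral_Icc_eq_integral_Ioc, ← intervalIntegral.integral_of_le zero_le_one]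
    have : ∫ x in (0 : ℝ)..1, (1 - x) = 1 / 2 := by
      rw [intervalIntegral.integral_sub (by simp) (by simp)]
      simp
      norm_num
    rw [this, ENNReal.ofReal_div_of_pos (by norm_num)]
    simp
  · exact (continuous_const.sub continuous_id).integrableOn_Icc
  · exact (MeasureTheory.ae_restrict_iff' measurableSet_Icc).2
      (Filter.Eventually.of_forall fun x hx => by simpa using hx.2)

theorem volume_triangle (a b c : Fin 2 → ℤ) :
    MeasureTheory.volume (triangle a b c) =
      ENNReal.ofReal |(det (b - a) (c - a) : ℝ)| * (1 / 2) := by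
  have h : triangle a b c = (fun x => latticePoint a + x) ''
      (Matrix.toLin' !![((b 0 - a 0 : ℤ) : ℝ), ((c 0 - a 0 : ℤ) : ℝ);
        ((b 1 - a 1 : ℤ) : ℝ), ((c 1 - a 1 : ℤ) : ℝ)] ''
        {x : Plane | 0 ≤ x 0 ∧ 0 ≤ x 1 ∧ x 0 + x 1 ≤ 1}) := by
    ext x
    rw [Set.image_image]
    constructor
    · rintro ⟨β, γ, hβ, hγ, h, hx⟩
      refine ⟨![β, γ], ⟨by simpa using hβ, by simpa using hγ, by simpa using h⟩, ?_⟩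
      funext i
      fin_cases i <;> simp [hx, latticePoint] <;> ring
    · rintro ⟨y, ⟨h0, h1, h2⟩, rfl⟩
      refine ⟨y 0, y 1, h0, h1, h2, fun i => ?_⟩
      fin_cases i <;> simp [latticePoint, dotProduct, Fin.sum_univ_two] <;> ring
  rw [h, Set.image_add_left, MeasureTheory.measure_preimage_add,
    MeasureTheory.Measure.addHaar_image_linearMap, volume_standard_triangle, LinearMap.det_toLin',
    Matrix.det_fin_two_of]
  congr 3
  simp only [det, Pi.sub_apply]
  push_cast
  ring

/-- The vertices `a`, `b`, `c` span a triangle of area `1 / 2`. -/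
def IsUnimodular (a b c : Fin 2 → ℤ) : Prop := det (b - a) (c - a) = 1 ∨ det (b - a) (c - a) = -1

theorem IsUnimodular.swap {a b c : Fin 2 → ℤ} (h : IsUnimodular a b c) : IsUnimodular b a c := by
  have : det (a - b) (c - b) = - det (b - a) (c - a) := by simp only [det, Pi.sub_apply]; ring
  rcases h with h | h
  · right; rw [this, h]
  · left; rw [this, h]; rfl

theorem IsUnimodular.rotate {a b c : Fin 2 → ℤ} (h : IsUnimodular a b c) : IsUnimodular b c a := by
  have : det (c - b) (a - b) = det (b - a) (c - a) := by simp only [det, Pi.sub_apply]; ring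
  rwa [IsUnimodular, this]

theorem exists_triangle (hT : IsUnimodularTriangulation P T) {Q : Set Plane} (hQ : Q ∈ T) :
    ∃ a b c, IsUnimodular a b c ∧ Q = triangle a b c := by
  obtain ⟨v, -, hv⟩ := hT.isLatticeTriangle Q hQ
  have hQ' : Q = triangle (v 0) (v 1) (v 2) := by
    rw [triangle_eq_convexHull, hv]
    congr 1
    ext x
    simp [Fin.exists_fin_succ, eq_comm]
  refine ⟨v 0, v 1, v 2, ?_, hQ'⟩
  have hvol := hT.area_eq Q hQ
  rw [hQ', volume_triangle] at hvol
  have h1 : ENNReal.ofReal |(det (v 1 - v 0) (v 2 - v 0) : ℝ)| = 1 := by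
    have h2 := congrArg (· * (2 : ENNReal)) hvol
    simp only [one_div, mul_assoc] at h2
    rwa [ENNReal.inv_mul_cancel (by norm_num) (by norm_num), mul_one] at h2
  rw [ENNReal.ofReal_eq_one] at h1
  have h3 : |det (v 1 - v 0) (v 2 - v 0)| = 1 := by exact_mod_cast h1
  exact (abs_eq zero_le_one).1 h3

/-- In the lattice basis given by two sides, points of (1/k)ℤ² have coordinates in (1/k)ℤ. The case
`k = 1` finds the lattice points of the triangle, `k = 2` the midpoints. -/
theorem exists_int_of_mem_triangle {a b c s : Fin 2 → ℤ} {k : ℤ} (hk : 0 < k)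
    (h : IsUnimodular a b c) (hs : (fun i => (s i : ℝ) / k) ∈ triangle a b c) :
    ∃ m n : ℤ, 0 ≤ m ∧ 0 ≤ n ∧ m + n ≤ k ∧
      ∀ i, s i = k * a i + m * (b i - a i) + n * (c i - a i) := by
  obtain ⟨ε, hε, hdet⟩ : ∃ ε : ℤ, ε * ε = 1 ∧ det (b - a) (c - a) = ε := by
    rcases h with h | h
    · exact ⟨1, by norm_num, h⟩
    · exact ⟨-1, by norm_num, h⟩
  obtain ⟨β, γ, hβ, hγ, hβγ, hx⟩ := hs
  have hkR : (0 : ℝ) < k := by exact_mod_cast hk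
  have hcomb := eq_combination hε hdet (fun i => s i - k * a i)
  obtain ⟨m, hm⟩ : ∃ m, m = ε * det (fun i => s i - k * a i) (c - a) := ⟨_, rfl⟩
  obtain ⟨n, hn⟩ : ∃ n, n = ε * det (b - a) (fun i => s i - k * a i) := ⟨_, rfl⟩
  rw [← hm, ← hn] at hcomb
  have hx' : ∀ i, (s i : ℝ) - k * a i = k * β * (b i - a i) + k * γ * (c i - a i) := by
    intro i
    have := hx i
    rw [div_eq_iff hkR.ne'] at this
    rw [this]; ring
  have hdetR : ((b 0 - a 0 : ℝ) * (c 1 - a 1) - (b 1 - a 1) * (c 0 - a 0)) = ε := by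
    rw [← hdet]; simp [det]
  have hεR : (ε : ℝ) * ε = 1 := by exact_mod_cast hε
  have hmR : (m : ℝ) = k * β := by
    rw [hm]
    simp only [det, Pi.sub_apply]
    push_cast
    rw [hx' 0, hx' 1]
    linear_combination (k * β * ε : ℝ) * hdetR + (k * β : ℝ) * hεR
  have hnR : (n : ℝ) = k * γ := by
    rw [hn]
    simp only [det, Pi.sub_apply]
    push_cast
    rw [hx' 0, hx' 1]
    linear_combination (k * γ * ε : ℝ) * hdetR + (k * γ : ℝ) * hεR
  refine ⟨m, n, ?_, ?_, ?_, fun i => ?_⟩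
  · have : (0 : ℝ) ≤ m := by rw [hmR]; positivity
    exact_mod_cast this
  · have : (0 : ℝ) ≤ n := by rw [hnR]; positivity
    exact_mod_cast this
  · have : (m : ℝ) + n ≤ k := by rw [hmR, hnR]; nlinarith
    exact_mod_cast this
  · have := hcomb i
    simp only [Pi.sub_apply] at this
    linarith

theorem eq_vertex_of_mem_triangle {a b c p : Fin 2 → ℤ} (h : IsUnimodular a b c)
    (hp : latticePoint p ∈ triangle a b c) : p = a ∨ p = b ∨ p = c := by
  obtain ⟨m, n, hm, hn, hmn, hs⟩ := exists_int_of_mem_triangle (k := 1) (s := p) one_pos h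
    (by convert hp using 1; funext i; simp [latticePoint])
  have hm1 : m ≤ 1 := by omega
  have hn1 : n ≤ 1 := by omega
  interval_cases m <;> interval_cases n
  · left; funext i; have := hs i; linarith
  · right; right; funext i; have := hs i; linarith
  · right; left; funext i; have := hs i; linarith
  · omega

/-- A unimodular triangle has six half-integral points, the vertices and the midpoints of the sides;
oddness excludes the vertices. -/
theorem eq_sum_of_halfPoint_mem {a b c s : Fin 2 → ℤ} (h : IsUnimodular a b c)
    (hs : halfPoint s ∈ triangle a b c) (hodd : IsOddVector s) :
    a + b = s ∨ b + c = s ∨ c + a = s := by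
  obtain ⟨m, n, hm, hn, hmn, hs⟩ := exists_int_of_mem_triangle (k := 2) (s := s) two_pos h
    (by push_cast; exact hs)
  have heven : ∀ p : Fin 2 → ℤ, (∀ i, s i = 2 * p i) → False := by
    intro p hp
    rcases hodd with h | h
    · rw [hp 0] at h; exact (Int.not_even_iff_odd.2 h) (even_two_mul _)
    · rw [hp 1] at h; exact (Int.not_even_iff_odd.2 h) (even_two_mul _)
  have hm1 : m ≤ 2 := by omega
  have hn1 : n ≤ 2 := by omega
  interval_cases m <;> interval_cases n <;> first | omega | skip
  · exact (heven a fun i => by rw [hs i]; ring).elim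
  · right; right; funext i; rw [Pi.add_apply, hs i]; ring
  · exact (heven c fun i => by rw [hs i]; ring).elim
  · left; funext i; rw [Pi.add_apply, hs i]; ring
  · right; left; funext i; rw [Pi.add_apply, hs i]; ring
  · exact (heven b fun i => by rw [hs i]; ring).elim

/-- `a b` is an edge of the triangulation `T`. -/
def IsEdge (T : Set (Set Plane)) (a b : Fin 2 → ℤ) : Prop :=
  ∃ c, IsUnimodular a b c ∧ triangle a b c ∈ T

theorem subset_of_mem (hT : IsUnimodularTriangulation P T) {Q : Set Plane} (hQ : Q ∈ T) : Q ⊆ P := by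
  rw [← hT.isSubdivision.sUnion_eq]
  exact Set.subset_sUnion_of_mem hQ

theorem isEdge_symm {a b : Fin 2 → ℤ} (h : IsEdge T a b) : IsEdge T b a := by
  obtain ⟨c, hc, hcT⟩ := h
  exact ⟨c, hc.swap, by rwa [triangle_swap]⟩

theorem isEdge_of_triangle_mem {a b c : Fin 2 → ℤ} (h : IsUnimodular a b c)
    (hT : triangle a b c ∈ T) : IsEdge T a b ∧ IsEdge T b c ∧ IsEdge T c a :=
  ⟨⟨c, h, hT⟩, ⟨a, h.rotate, by rwa [triangle_rotate]⟩,
    ⟨b, h.rotate.rotate, by rwa [triangle_rotate, triangle_rotate]⟩⟩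

theorem exists_triangle_of_halfPoint_mem (hT : IsUnimodularTriangulation P T) {Q : Set Plane}
    (hQ : Q ∈ T) {s : Fin 2 → ℤ} (hs : halfPoint s ∈ Q) (hodd : IsOddVector s) :
    ∃ a b c, IsUnimodular a b c ∧ a + b = s ∧ Q = triangle a b c := by
  obtain ⟨a, b, c, h, rfl⟩ := exists_triangle hT hQ
  rcases eq_sum_of_halfPoint_mem h hs hodd with hs | hs | hs
  · exact ⟨a, b, c, h, hs, rfl⟩
  · exact ⟨b, c, a, h.rotate, hs, (triangle_rotate _ _ _).symm⟩
  · exact ⟨c, a, b, h.rotate.rotate, hs, by rw [triangle_rotate, triangle_rotate]⟩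

/-- The common face of two triangles is extreme in each of them. If it contains a relatively
interior point of a side, it contains both ends of that side. -/
theorem mem_of_exposed (hT : IsUnimodularTriangulation P T) {a b e : Fin 2 → ℤ} {R : Set Plane}
    (hQ : triangle a b e ∈ T) (hR : R ∈ T) {x : Plane} (hxR : x ∈ R) {lam : ℝ} (hlam : |lam| < 1)
    (hx : ∀ i, 2 * x i = ((a i : ℝ) + b i) + lam * (b i - a i)) :
    latticePoint a ∈ R ∧ latticePoint b ∈ R := by
  have hab : latticePoint a ∈ triangle a b e ∧ latticePoint b ∈ triangle a b e :=
    ⟨left_mem_triangle a b e, by rw [← triangle_rotate]; exact left_mem_triangle _ _ _⟩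
  rw [abs_lt] at hlam
  have hseg : x ∈ openSegment ℝ (latticePoint a) (latticePoint b) := by
    refine ⟨(1 - lam) / 2, (1 + lam) / 2, by linarith, by linarith, by ring, ?_⟩
    funext i
    have := hx i
    simp only [Pi.add_apply, Pi.smul_apply, smul_eq_mul, latticePoint]
    linarith
  have hxQ : x ∈ triangle a b e := (convex_triangle a b e).openSegment_subset hab.1 hab.2 hseg
  by_cases h : triangle a b e = R
  · rwa [← h]
  · have hext := ((hT.isSubdivision.inter_isFace _ hQ _ hR h).1).isExtreme
    have h1 := hext.left_mem_of_mem_openSegment hab.1 hab.2 ⟨hxQ, hxR⟩ hseg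
    have h2 := hext.left_mem_of_mem_openSegment hab.2 hab.1 ⟨hxQ, hxR⟩
      (by rwa [openSegment_symm])
    exact ⟨h1.2, h2.2⟩

/-- The noncrossing property is the substantial one. A common relatively interior point of two edges
puts the ends of the first into the triangle of the second, where the vertices are the only lattice
points. So both edges are sides of one triangle, and two different sides have no common relatively
interior point. -/
theorem isEdgeSystem (hT : IsUnimodularTriangulation P T) : IsEdgeSystem P (IsEdge T) where
  symm := isEdge_symm
  mem := by
    rintro a b ⟨c, -, hc⟩
    exact subset_of_mem hT hc (left_mem_triangle a b c)
  exists_det_eq_one := by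
    rintro a b ⟨c, h | h, -⟩
    · exact ⟨c - a, h⟩
    · refine ⟨a - c, ?_⟩
      have : det (b - a) (a - c) = - det (b - a) (c - a) := by simp only [det, Pi.sub_apply]; ring
      rw [this, h]; rfl
  exists_edge := by
    intro s hs hodd
    rw [← hT.isSubdivision.sUnion_eq] at hs
    obtain ⟨Q, hQ, hsQ⟩ := hs
    obtain ⟨a, b, c, h, hab, rfl⟩ := exists_triangle_of_halfPoint_mem hT hQ hsQ hodd
    exact ⟨a, b, ⟨c, h, hQ⟩, hab⟩
  eq_of_cross := by
    rintro a b c d lam mu ⟨e, he, heT⟩ ⟨f, hf, hfT⟩ hlam hmu heq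
    have hxR : (fun i => ((c i : ℝ) + d i + mu * (d i - c i)) / 2) ∈ triangle c d f := by
      rw [abs_lt] at hmu
      refine ⟨(1 + mu) / 2, 0, by linarith, le_rfl, by linarith, fun i => by ring⟩
    obtain ⟨ha, hb⟩ := mem_of_exposed hT heT hfT hxR hlam (fun i => by rw [heq i]; ring)
    have hdet : ((d 0 - c 0 : ℝ) * (f 1 - c 1) - (d 1 - c 1) * (f 0 - c 0)) ≠ 0 := by
      have : det (d - c) (f - c) ≠ 0 := by rcases hf with h | h <;> rw [h] <;> norm_num
      have h2 : ((det (d - c) (f - c) : ℤ) : ℝ) ≠ 0 := by exact_mod_cast this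
      simpa [det] using h2
    have hab : a ≠ b := by
      rintro rfl
      rcases he with h | h <;> simp [det] at h
    have h0 := heq 0
    have h1 := heq 1
    rw [abs_lt] at hlam
    have hl1 : 1 - lam ≠ 0 := by linarith
    have hl2 : 1 + lam ≠ 0 := by linarith
    -- If one end of `a b` were the third vertex `f`, the common point would have a barycentric
    -- coordinate (1 ± lam)/2 ≠ 0 at `f`, although it lies on the line through `c` and `d`.
    have hfalse : ∀ r : ℝ, r ≠ 0 → ¬ (r *
        ((d 0 - c 0 : ℝ) * (f 1 - c 1) - (d 1 - c 1) * (f 0 - c 0)) = 0) :=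
      fun r hr h => (mul_ne_zero hr hdet) h
    rcases eq_vertex_of_mem_triangle hf ha with rfl | rfl | rfl <;>
      rcases eq_vertex_of_mem_triangle hf hb with rfl | rfl | rfl
    · exact (hab rfl).elim
    · exact Or.inl ⟨rfl, rfl⟩
    · refine (hfalse _ hl2 ?_).elim
      linear_combination (d 0 - a 0 : ℝ) * h1 - (d 1 - a 1 : ℝ) * h0
    · exact Or.inr ⟨rfl, rfl⟩
    · exact (hab rfl).elim
    · refine (hfalse _ hl2 ?_).elim
      linear_combination (a 0 - c 0 : ℝ) * h1 - (a 1 - c 1 : ℝ) * h0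
    · refine (hfalse _ hl1 ?_).elim
      linear_combination (d 0 - b 0 : ℝ) * h1 - (d 1 - b 1 : ℝ) * h0
    · refine (hfalse _ hl1 ?_).elim
      linear_combination (b 0 - c 0 : ℝ) * h1 - (b 1 - c 1 : ℝ) * h0
    · exact (hab rfl).elim

theorem finite_latticePoint_mem (hP : Bornology.IsBounded P) :
    {z : Fin 2 → ℤ | latticePoint z ∈ P}.Finite := by
  obtain ⟨C, hC⟩ := hP.exists_norm_le
  refine (Set.finite_Icc (fun _ : Fin 2 => -⌈C⌉) (fun _ => ⌈C⌉)).subset fun z hz => ?_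
  have h : ∀ i, |(z i : ℝ)| ≤ C := fun i => (norm_le_pi_norm (latticePoint z) i).trans (hC _ hz)
  constructor
  · intro i
    have h1 := (abs_le.1 (h i)).1
    have h2 : -(⌈C⌉ : ℝ) ≤ z i := by linarith [Int.le_ceil C]
    exact_mod_cast h2
  · intro i
    have h1 := (abs_le.1 (h i)).2
    have h2 : (z i : ℝ) ≤ ⌈C⌉ := by linarith [Int.le_ceil C]
    exact_mod_cast h2

theorem finite_of_isUnimodularTriangulation (hP : Bornology.IsBounded P)
    (hT : IsUnimodularTriangulation P T) : T.Finite := by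
  have hfin := finite_latticePoint_mem hP
  refine ((hfin.prod (hfin.prod hfin)).image fun p => triangle p.1 p.2.1 p.2.2).subset ?_
  intro Q hQ
  obtain ⟨a, b, c, -, rfl⟩ := exists_triangle hT hQ
  have hsub := subset_of_mem hT hQ
  refine ⟨(a, b, c), ⟨?_, ?_, ?_⟩, rfl⟩
  · exact hsub (left_mem_triangle a b c)
  · exact hsub (by rw [← triangle_rotate]; exact left_mem_triangle _ _ _)
  · exact hsub (by rw [← triangle_rotate, ← triangle_rotate]; exact left_mem_triangle _ _ _)

end LatticePlane

/-! ### Reconstruction of a triangulation from its edges, and Anclin's bound. -/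

namespace LatticePlane

open Finset

variable {P : Set Plane} {T T' : Set (Set Plane)}

/-- A triangulation contains every unimodular triangle whose sides are edges of it. -/
theorem triangle_mem_of_isEdge (hP : Convex ℝ P) (hPb : Bornology.IsBounded P)
    (hT : IsUnimodularTriangulation P T) {a b c : Fin 2 → ℤ} (h : IsUnimodular a b c)
    (hab : IsEdge T a b) (hbc : IsEdge T b c) (hca : IsEdge T c a) : triangle a b c ∈ T := by
  have hE := isEdgeSystem hT
  have hsub : triangle a b c ⊆ P := by
    rw [triangle_eq_convexHull]
    refine convexHull_min ?_ hP
    rintro x (rfl | rfl | rfl)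
    · exact hE.mem hab
    · exact hE.mem hbc
    · exact hE.mem hca
  -- a point of the triangle near the midpoint of `a b`
  obtain ⟨ε, hε0, hε1, R, hR, hxR, hqR⟩ : ∃ ε : ℝ, 0 < ε ∧ ε < 1 ∧ ∃ R ∈ T,
      (fun i => (a i : ℝ) + ((1 - ε) / 2) * (b i - a i) + ε * (c i - a i)) ∈ R ∧
        halfPoint (a + b) ∈ R := by
    have hfin := finite_of_isUnimodularTriangulation hPb hT
    -- The triangles of `T` that miss the midpoint of `a b` form a closed set, so points close
    -- enough to the midpoint lie only in triangles that contain it.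
    have hclosed : IsClosed (⋃ R ∈ {R ∈ T | halfPoint (a + b) ∉ R}, R) := by
      refine (hfin.subset fun R hR => hR.1).isClosed_biUnion fun R hR => ?_
      obtain ⟨a, b, c, -, rfl⟩ := exists_triangle hT hR.1
      exact isClosed_triangle a b c
    have hcont : Continuous fun (ε : ℝ) (i : Fin 2) =>
        (a i : ℝ) + ((1 - ε) / 2) * (b i - a i) + ε * (c i - a i) := by fun_prop
    have hev := hcont.continuousAt.preimage_mem_nhds (x := 0)
      (hclosed.isOpen_compl.mem_nhds (by
        simp only [Set.mem_compl_iff, Set.mem_iUnion, not_exists]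
        rintro R ⟨hR, hR'⟩ hmem
        apply hR'
        convert hmem using 1
        funext i
        simp [halfPoint]
        ring))
    obtain ⟨ε, hε, hε1⟩ := Filter.nonempty_of_mem (Filter.inter_mem
      (mem_nhdsWithin_of_mem_nhds (t := Set.Ioi 0) hev) (Ioo_mem_nhdsGT one_pos))
    have hxP : (fun i => (a i : ℝ) + ((1 - ε) / 2) * (b i - a i) + ε * (c i - a i)) ∈ P :=
      hsub ⟨(1 - ε) / 2, ε, by linarith [hε1.2], hε1.1.le, by linarith [hε1.2], fun i => rfl⟩
    rw [← hT.isSubdivision.sUnion_eq] at hxP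
    obtain ⟨R, hR, hxR⟩ := hxP
    refine ⟨ε, hε1.1, hε1.2, R, hR, hxR, ?_⟩
    by_contra hq
    apply hε
    simp only [Set.mem_iUnion]
    exact ⟨R, ⟨hR, hq⟩, hxR⟩
  obtain ⟨w, hw, rfl⟩ : ∃ w, IsUnimodular a b w ∧ R = triangle a b w := by
    obtain ⟨p, q, w, hw, hsum, rfl⟩ :=
      exists_triangle_of_halfPoint_mem hT hR hqR (hE.isOddVector hab)
    rcases hE.eq_of_sum_eq (isEdge_of_triangle_mem hw hR).1 hab hsum with ⟨rfl, rfl⟩ | ⟨rfl, rfl⟩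
    · exact ⟨w, hw, rfl⟩
    · exact ⟨w, hw.swap, (triangle_swap _ _ _).symm⟩
  -- The chosen point is off the line `a b` on the side of `c` and lies in the triangle `a b w`, so
  -- `w` and `c` are on the same side; both determinants are ±1.
  have hdet : det (b - a) (w - a) = det (b - a) (c - a) := by
    obtain ⟨β, γ, hβ, hγ, -, hx⟩ := hxR
    have key : γ * (det (b - a) (w - a) : ℤ) = ε * (det (b - a) (c - a) : ℤ) := by
      have h0 := hx 0
      have h1 := hx 1
      simp only [det, Pi.sub_apply]
      push_cast
      linear_combination (b 1 - a 1 : ℝ) * h0 - (b 0 - a 0 : ℝ) * h1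
    rcases h with h | h <;> rcases hw with hw | hw <;> rw [h, hw] at key ⊢ <;> push_cast at key <;>
      linarith
  obtain ⟨k, hk⟩ : ∃ k : ℤ, ∀ i, w i = c i + k * (b i - a i) := by
    obtain ⟨η, hη, hηd⟩ : ∃ η : ℤ, η * η = 1 ∧ det (b - a) (c - a) = η := by
      rcases h with h | h
      · exact ⟨1, by norm_num, h⟩
      · exact ⟨-1, by norm_num, h⟩
    have h0 : det (b - a) (w - c) = 0 := by
      have : det (b - a) (w - c) = det (b - a) (w - a) - det (b - a) (c - a) := by
        simp only [det, Pi.sub_apply]; ring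
      rw [this, hdet, sub_self]
    refine ⟨η * det (w - c) (c - a), fun i => ?_⟩
    have := eq_combination hη hηd (w - c) i
    rw [h0] at this
    simp only [Pi.sub_apply] at this ⊢
    linarith
  obtain ⟨-, hbw, hwa⟩ := isEdge_of_triangle_mem hw hR
  have hne : a ≠ b ∧ a ≠ c ∧ b ≠ c := by
    refine ⟨?_, ?_, ?_⟩ <;> rintro rfl <;> rcases h with h | h <;> simp [det] at h <;>
      simp [mul_comm] at h
  -- If `w ≠ c`, then `a`, `b`, `c`, `w` are the corners of a trapezoid with parallel sides `a b`
  -- and `c w`. Its diagonals are edges of `T` that cross.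
  rcases lt_trichotomy k 0 with hk0 | hk0 | hk0
  · exfalso
    have hkR : (k : ℝ) ≤ -1 := by exact_mod_cast (by omega : k ≤ -1)
    have h1k : (1 - k : ℝ) ≠ 0 := by linarith
    have hlt : |(1 + k : ℝ) / (1 - k)| < 1 := by
      rw [abs_div, abs_of_pos (by linarith : (0 : ℝ) < 1 - k), div_lt_one (by linarith), abs_lt]
      constructor <;> linarith
    rcases hE.eq_of_cross hbw (hE.symm hca) hlt hlt (fun i => by
      have : (w i : ℝ) = c i + k * (b i - a i) := by exact_mod_cast hk i
      rw [this]
      field_simp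
      ring) with h | h
    · exact hne.1 h.1.symm
    · exact hne.2.2 h.1
  · have : w = c := by funext i; rw [hk i, hk0]; ring
    rwa [← this]
  · exfalso
    have hkR : (1 : ℝ) ≤ k := by exact_mod_cast (by omega : 1 ≤ k)
    have h1k : (1 + k : ℝ) ≠ 0 := by linarith
    have hlt : |(1 - k : ℝ) / (1 + k)| < 1 := by
      rw [abs_div, abs_of_pos (by linarith : (0 : ℝ) < 1 + k), div_lt_one (by linarith), abs_lt]
      constructor <;> linarith
    rcases hE.eq_of_cross (hE.symm hwa) hbc hlt hlt (fun i => by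
      have : (w i : ℝ) = c i + k * (b i - a i) := by exact_mod_cast hk i
      rw [this]
      field_simp
      ring) with h | h
    · exact hne.1 h.1
    · exact hne.2.1 h.1

/-- A triangulation is determined by its edges. -/
theorem eq_of_isEdge_iff (hP : Convex ℝ P) (hPb : Bornology.IsBounded P)
    (hT : IsUnimodularTriangulation P T) (hT' : IsUnimodularTriangulation P T')
    (h : ∀ a b, IsEdge T a b ↔ IsEdge T' a b) : T = T' := by
  have key : ∀ {T T' : Set (Set Plane)}, IsUnimodularTriangulation P T →
      IsUnimodularTriangulation P T' → (∀ a b, IsEdge T a b ↔ IsEdge T' a b) → T ⊆ T' := by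
    intro T T' hT hT' h Q hQ
    obtain ⟨a, b, c, hu, rfl⟩ := exists_triangle hT hQ
    obtain ⟨h1, h2, h3⟩ := isEdge_of_triangle_mem hu hQ
    exact triangle_mem_of_isEdge hP hPb hT' hu ((h _ _).1 h1) ((h _ _).1 h2) ((h _ _).1 h3)
  exact (key hT hT' h).antisymm (key hT' hT fun a b => (h a b).symm)

theorem IsLatticePolygon.convex (hP : IsLatticePolygon P) : Convex ℝ P := by
  obtain ⟨⟨S, rfl⟩, -⟩ := hP
  exact convex_convexHull ℝ _

theorem IsLatticePolygon.isCompact (hP : IsLatticePolygon P) : IsCompact P := by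
  obtain ⟨⟨S, rfl⟩, -⟩ := hP
  exact (S.finite_toSet.image _).isCompact_convexHull (𝕜 := ℝ)

/-- The interior half-integral points of `P` that are not lattice points; the point `s / 2` is
represented by `s`. -/
def innerMidpoints (P : Set Plane) : Set (Fin 2 → ℤ) :=
  {s | halfPoint s ∈ interior P ∧ IsOddVector s}

open scoped Pointwise in
theorem finite_innerMidpoints (hP : Bornology.IsBounded P) : (innerMidpoints P).Finite := by
  have hb : Bornology.IsBounded ((2 : ℝ) • P) := hP.smul₀ 2
  refine (finite_latticePoint_mem hb).subset fun s hs => ?_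
  refine Set.mem_smul_set.2 ⟨halfPoint s, interior_subset hs.1, ?_⟩
  funext i
  simp [halfPoint, latticePoint]
  ring

/-- **Anclin's bound** on the number of unimodular triangulations. -/
theorem ncard_isUnimodularTriangulation_le (hP : IsLatticePolygon P) :
    {T | IsUnimodularTriangulation P T}.Finite ∧
      {T | IsUnimodularTriangulation P T}.ncard ≤ 2 ^ (innerMidpoints P).ncard := by
  have hb := hP.isCompact.isBounded
  have hfin := finite_innerMidpoints hb
  have := ncard_le_of_isEdgeSystem hP.convex hP.2 {T | IsUnimodularTriangulation P T} IsEdge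
    (fun T hT => isEdgeSystem hT) (fun T hT T' hT' => eq_of_isEdge_iff hP.convex hb hT hT')
    hfin.toFinset (fun s => by simp [innerMidpoints])
  rwa [← Set.ncard_eq_toFinset_card _ hfin] at this

end LatticePlane

namespace LatticePlane

open Finset

variable {P : Set Plane}

/-! ### Horizontal chords -/

/-- The largest first coordinate of a point of `P` at height `y`. -/
noncomputable def rightEnd (P : Set Plane) (y : ℝ) : ℝ := sSup {x | (![x, y] : Plane) ∈ P}

/-- The smallest first coordinate of a point of `P` at height `y`. -/
noncomputable def leftEnd (P : Set Plane) (y : ℝ) : ℝ := sInf {x | (![x, y] : Plane) ∈ P}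

theorem isCompact_chord (hP : IsCompact P) (y : ℝ) : IsCompact {x | (![x, y] : Plane) ∈ P} := by
  have hcont : Continuous fun x : ℝ => (![x, y] : Plane) := by fun_prop
  refine Metric.isCompact_of_isClosed_isBounded (hP.isClosed.preimage hcont) ?_
  obtain ⟨C, hC⟩ := hP.isBounded.exists_norm_le
  refine isBounded_iff_forall_norm_le.2 ⟨C, fun x hx => ?_⟩
  simpa using (norm_le_pi_norm (![x, y] : Plane) 0).trans (hC _ hx)

theorem le_rightEnd (hP : IsCompact P) {x y : ℝ} (h : (![x, y] : Plane) ∈ P) : x ≤ rightEnd P y :=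
  le_csSup (isCompact_chord hP y).bddAbove h

theorem leftEnd_le (hP : IsCompact P) {x y : ℝ} (h : (![x, y] : Plane) ∈ P) : leftEnd P y ≤ x :=
  csInf_le (isCompact_chord hP y).bddBelow h

theorem rightEnd_mem (hP : IsCompact P) {y : ℝ} (h : ∃ x, (![x, y] : Plane) ∈ P) :
    (![rightEnd P y, y] : Plane) ∈ P := (isCompact_chord hP y).sSup_mem h

theorem leftEnd_mem (hP : IsCompact P) {y : ℝ} (h : ∃ x, (![x, y] : Plane) ∈ P) :
    (![leftEnd P y, y] : Plane) ∈ P := (isCompact_chord hP y).sInf_mem h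

theorem chord_combination (hPc : Convex ℝ P) {x y x' y' s t : ℝ} (h : (![x, y] : Plane) ∈ P)
    (h' : (![x', y'] : Plane) ∈ P) (hs : 0 ≤ s) (ht : 0 ≤ t) (hst : s + t = 1) :
    (![s * x + t * x', s * y + t * y'] : Plane) ∈ P := by
  have := hPc h h' hs ht hst
  convert this using 1
  funext i
  fin_cases i <;> simp

/-- The convex set `P` touches the lines of heights `0` and `W` and lies between them. -/
structure HasHeight (P : Set Plane) (W : ℝ) : Prop where
  isCompact : IsCompact P
  convex : Convex ℝ P
  pos : 0 < W
  between : ∀ p ∈ P, 0 ≤ p 1 ∧ p 1 ≤ W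
  bottom : ∃ x, (![x, 0] : Plane) ∈ P
  top : ∃ x, (![x, W] : Plane) ∈ P

variable {W : ℝ}

theorem HasHeight.exists_mem (h : HasHeight P W) {y : ℝ} (hy : y ∈ Set.Icc 0 W) :
    ∃ x, (![x, y] : Plane) ∈ P := by
  obtain ⟨x, hx⟩ := h.bottom
  obtain ⟨x', hx'⟩ := h.top
  have hW := h.pos
  have := chord_combination h.convex hx hx' (s := 1 - y / W) (t := y / W)
    (by rw [sub_nonneg, div_le_one hW]; exact hy.2) (div_nonneg hy.1 hW.le) (by ring)
  rw [mul_zero, zero_add, div_mul_cancel₀ _ hW.ne'] at this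
  exact ⟨_, this⟩

theorem HasHeight.leftEnd_le_rightEnd (h : HasHeight P W) {y : ℝ} (hy : y ∈ Set.Icc 0 W) :
    leftEnd P y ≤ rightEnd P y :=
  leftEnd_le h.isCompact (rightEnd_mem h.isCompact (h.exists_mem hy))

theorem HasHeight.concaveOn (h : HasHeight P W) : ConcaveOn ℝ (Set.Icc 0 W) (rightEnd P) := by
  refine ⟨convex_Icc 0 W, fun y hy y' hy' s t hs ht hst => ?_⟩
  exact le_rightEnd h.isCompact (chord_combination h.convex
    (rightEnd_mem h.isCompact (h.exists_mem hy)) (rightEnd_mem h.isCompact (h.exists_mem hy'))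
    hs ht hst)

theorem HasHeight.convexOn (h : HasHeight P W) : ConvexOn ℝ (Set.Icc 0 W) (leftEnd P) := by
  refine ⟨convex_Icc 0 W, fun y hy y' hy' s t hs ht hst => ?_⟩
  exact leftEnd_le h.isCompact (chord_combination h.convex
    (leftEnd_mem h.isCompact (h.exists_mem hy)) (leftEnd_mem h.isCompact (h.exists_mem hy'))
    hs ht hst)

theorem exists_add_mem_of_mem_interior {p : Plane} (hp : p ∈ interior P) (v : Plane) :
    ∃ ε : ℝ, 0 < ε ∧ p + ε • v ∈ P := by
  have hcont : Continuous fun ε : ℝ => p + ε • v := by fun_prop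
  have hev := hcont.continuousAt.preimage_mem_nhds (x := 0)
    (by simpa using mem_interior_iff_mem_nhds.1 hp)
  obtain ⟨ε, hε, hε1⟩ := Filter.nonempty_of_mem (Filter.inter_mem
    (mem_nhdsWithin_of_mem_nhds (t := Set.Ioi 0) hev) self_mem_nhdsWithin)
  exact ⟨ε, hε1, hε⟩

theorem HasHeight.of_mem_interior (h : HasHeight P W) {x y : ℝ}
    (hxy : (![x, y] : Plane) ∈ interior P) :
    0 < y ∧ y < W ∧ leftEnd P y < x ∧ x < rightEnd P y := by
  obtain ⟨ε₁, h₁, m₁⟩ := exists_add_mem_of_mem_interior hxy ![1, 0]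
  obtain ⟨ε₂, h₂, m₂⟩ := exists_add_mem_of_mem_interior hxy ![-1, 0]
  obtain ⟨ε₃, h₃, m₃⟩ := exists_add_mem_of_mem_interior hxy ![0, 1]
  obtain ⟨ε₄, h₄, m₄⟩ := exists_add_mem_of_mem_interior hxy ![0, -1]
  have b₃ := (h.between _ m₃).2
  have b₄ := (h.between _ m₄).1
  simp at m₁ m₂ b₃ b₄
  have r₁ := le_rightEnd h.isCompact m₁
  have r₂ := leftEnd_le h.isCompact m₂
  exact ⟨by linarith, by linarith, by linarith, by linarith⟩

/-- A supporting functional at the point would have no horizontal part, since the chord extends to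
both sides, and no vertical part, since `P` has points at heights 0 and `W`. -/
theorem HasHeight.mem_interior (h : HasHeight P W) (hint : (interior P).Nonempty) {x y : ℝ}
    (hy : 0 < y) (hyW : y < W) (hl : leftEnd P y < x) (hr : x < rightEnd P y) :
    (![x, y] : Plane) ∈ interior P := by
  by_contra hcon
  obtain ⟨α, β, hαβ, hle⟩ := exists_functional h.convex hint hcon
  have hex := h.exists_mem (y := y) ⟨hy.le, hyW.le⟩
  have h1 := hle _ (rightEnd_mem h.isCompact hex)
  have h2 := hle _ (leftEnd_mem h.isCompact hex)
  simp at h1 h2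
  have hα : α = 0 := by nlinarith
  obtain ⟨x₁, hx₁⟩ := h.bottom
  obtain ⟨x₂, hx₂⟩ := h.top
  have h3 := hle _ hx₁
  have h4 := hle _ hx₂
  subst hα
  simp at h3 h4
  have hβ : β = 0 := by nlinarith
  simp [hβ] at hαβ

/-- The chord length is concave and nonnegative on [0, W] and positive at the height of an interior
point. Every height strictly between 0 and `W` is a combination of that height, with positive
weight, and 0 or `W`. -/
theorem HasHeight.leftEnd_lt_rightEnd (h : HasHeight P W) (hint : (interior P).Nonempty) {y : ℝ}
    (hy : 0 < y) (hyW : y < W) : leftEnd P y < rightEnd P y := by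
  obtain ⟨p, hp⟩ := hint
  have hp' : p = ![p 0, p 1] := by funext i; fin_cases i <;> rfl
  rw [hp'] at hp
  obtain ⟨h0, h1, h2, h3⟩ := h.of_mem_interior hp
  have key : ∀ e ∈ Set.Icc (0 : ℝ) W, ∀ s t : ℝ, 0 < s → 0 ≤ t → s + t = 1 →
      y = s * p 1 + t * e → leftEnd P y < rightEnd P y := by
    intro e he s t hs ht hst hyy
    have c1 := h.concaveOn.2 ⟨h0.le, h1.le⟩ he hs.le ht hst
    have c2 := h.convexOn.2 ⟨h0.le, h1.le⟩ he hs.le ht hst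
    have c3 := h.leftEnd_le_rightEnd he
    simp only [smul_eq_mul] at c1 c2
    rw [← hyy] at c1 c2
    nlinarith
  have hW := h.pos
  rcases le_or_gt y (p 1) with hle | hlt
  · refine key 0 ⟨le_rfl, hW.le⟩ (y / p 1) (1 - y / p 1) (by positivity) ?_ (by ring) ?_
    · rw [sub_nonneg, div_le_one h0]; exact hle
    · field_simp; ring
  · have hd : 0 < W - p 1 := by linarith
    refine key W ⟨hW.le, le_rfl⟩ ((W - y) / (W - p 1)) ((y - p 1) / (W - p 1))
      (div_pos (by linarith) hd) (div_nonneg (by linarith) hd.le) ?_ ?_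
    · field_simp; ring
    · field_simp; ring

/-! ### Lattice polygons -/

theorem convexHull_le {S : Finset (Fin 2 → ℤ)} {α β c : ℝ}
    (h : ∀ s ∈ S, α * s 0 + β * s 1 ≤ c) :
    ∀ p ∈ convexHull ℝ (latticePoint '' (S : Set (Fin 2 → ℤ))), α * p 0 + β * p 1 ≤ c := by
  intro p hp
  refine convexHull_min (t := {p : Plane | α * p 0 + β * p 1 ≤ c}) ?_ ?_ hp
  · rintro _ ⟨s, hs, rfl⟩
    exact h s hs
  · intro x hx y hy s t hs ht hst
    simp only [Set.mem_ofPred_eq, Pi.add_apply, Pi.smul_apply, smul_eq_mul] at *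
    have : c = s * c + t * c := by rw [← add_mul, hst, one_mul]
    rw [this]
    nlinarith

/-- Between two consecutive horizontal lattice lines the boundary of a lattice polygon is linear. -/
theorem exists_of_half_row {S : Finset (Fin 2 → ℤ)} {i : ℤ} {p : Plane}
    (hp : p ∈ convexHull ℝ (latticePoint '' (S : Set (Fin 2 → ℤ)))) (hpi : p 1 = i + 1 / 2) :
    ∃ x₁ x₂ : ℝ, (![x₁, (i : ℝ)] : Plane) ∈ convexHull ℝ (latticePoint '' (S : Set (Fin 2 → ℤ))) ∧
      (![x₂, (i : ℝ) + 1] : Plane) ∈ convexHull ℝ (latticePoint '' (S : Set (Fin 2 → ℤ))) ∧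
      2 * p 0 = x₁ + x₂ := by
  set P := convexHull ℝ (latticePoint '' (S : Set (Fin 2 → ℤ))) with hPdef
  have hPc : Convex ℝ P := convex_convexHull ℝ _
  set A : Set Plane := latticePoint '' {s | s ∈ S ∧ s 1 ≤ i} with hA
  set B : Set Plane := latticePoint '' {s | s ∈ S ∧ i + 1 ≤ s 1} with hB
  have hAB : latticePoint '' (S : Set (Fin 2 → ℤ)) = A ∪ B := by
    rw [hA, hB, ← Set.image_union]
    congr 1
    ext s
    simp only [Finset.mem_coe, Set.mem_union, Set.mem_ofPred_eq]
    constructor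
    · intro hs
      rcases le_or_gt (s 1) i with h | h
      · exact Or.inl ⟨hs, h⟩
      · exact Or.inr ⟨hs, h⟩
    · rintro (h | h) <;> exact h.1
  have hAsub : convexHull ℝ A ⊆ P := convexHull_mono (by rw [hAB]; exact Set.subset_union_left)
  have hBsub : convexHull ℝ B ⊆ P := convexHull_mono (by rw [hAB]; exact Set.subset_union_right)
  have hAle : ∀ q ∈ convexHull ℝ A, q 1 ≤ i := by
    intro q hq
    refine convexHull_min (t := {q : Plane | q 1 ≤ i}) ?_ ?_ hq
    · rintro _ ⟨s, hs, rfl⟩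
      simp only [Set.mem_ofPred_eq, latticePoint]
      exact_mod_cast hs.2
    · exact convex_halfSpace_le (f := fun q : Plane => q 1) ⟨fun _ _ => rfl, fun _ _ => rfl⟩ _
  have hBle : ∀ q ∈ convexHull ℝ B, (i : ℝ) + 1 ≤ q 1 := by
    intro q hq
    refine convexHull_min (t := {q : Plane | (i : ℝ) + 1 ≤ q 1}) ?_ ?_ hq
    · rintro _ ⟨s, hs, rfl⟩
      simp only [Set.mem_ofPred_eq, latticePoint]
      exact_mod_cast hs.2
    · exact convex_halfSpace_ge (f := fun q : Plane => q 1) ⟨fun _ _ => rfl, fun _ _ => rfl⟩ _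
  have hAne : A.Nonempty := by
    by_contra hcon
    rw [Set.not_nonempty_iff_eq_empty] at hcon
    have := hBle p (by rwa [hPdef, hAB, hcon, Set.empty_union] at hp)
    linarith
  have hBne : B.Nonempty := by
    by_contra hcon
    rw [Set.not_nonempty_iff_eq_empty] at hcon
    have := hAle p (by rwa [hPdef, hAB, hcon, Set.union_empty] at hp)
    linarith
  -- No vertex lies strictly between the two rows, so `p` is on a segment from the hull of the
  -- vertices below to the hull of those above; this segment meets both rows.
  rw [hPdef, hAB, convexHull_union hAne hBne, mem_convexJoin] at hp
  obtain ⟨a, ha, b, hb, hab⟩ := hp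
  obtain ⟨s, t, hs, ht, hst, rfl⟩ := hab
  have ha1 := hAle a ha
  have hb1 := hBle b hb
  have haP := hAsub ha
  have hbP := hBsub hb
  have ea : a = ![a 0, a 1] := by funext i; fin_cases i <;> rfl
  have eb : b = ![b 0, b 1] := by funext i; fin_cases i <;> rfl
  rw [ea] at haP
  rw [eb] at hbP
  have hd : 0 < b 1 - a 1 := by linarith
  have key : ∀ y : ℝ, a 1 ≤ y → y ≤ b 1 →
      (![a 0 + (y - a 1) / (b 1 - a 1) * (b 0 - a 0), y] : Plane) ∈ P := by
    intro y h1 h2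
    have := chord_combination hPc haP hbP (s := (b 1 - y) / (b 1 - a 1))
      (t := (y - a 1) / (b 1 - a 1)) (div_nonneg (by linarith) hd.le)
      (div_nonneg (by linarith) hd.le) (by field_simp; ring)
    convert this using 2
    · field_simp; ring
    · congr 1; field_simp; ring
  refine ⟨_, _, key i ha1 (by linarith), key (i + 1) (by linarith) hb1, ?_⟩
  simp only [Pi.add_apply, Pi.smul_apply, smul_eq_mul] at hpi ⊢
  have hs' : s = 1 - t := by linarith
  subst hs'
  have ht' : t * (b 1 - a 1) = i + 1 / 2 - a 1 := by linarith
  field_simp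
  linear_combination 2 * (b 0 - a 0) * ht'

/-- The extreme values of a coordinate on a horizontal side of a lattice polygon are integers. -/
theorem exists_max_on_side {S : Finset (Fin 2 → ℤ)} (σ τ c : ℤ) (hS : ∀ s ∈ S, τ * s 1 ≤ c)
    (hex : ∃ s ∈ S, τ * s 1 = c) :
    ∃ s ∈ S, τ * s 1 = c ∧ ∀ p ∈ convexHull ℝ (latticePoint '' (S : Set (Fin 2 → ℤ))),
      τ * p 1 = c → σ * p 0 ≤ σ * s 0 := by
  classical
  obtain ⟨s, hs, hmax⟩ := (S.filter fun s => τ * s 1 = c).exists_max_image (fun s => σ * s 0)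
    (by obtain ⟨s, hs, h⟩ := hex; exact ⟨s, by simp [hs, h]⟩)
  rw [mem_filter] at hs
  -- The functional σx + Kτy is maximal over `S` at `s`: a vertex off the side loses at least `K` in
  -- the second term, by integrality, which pays for any gain in the first.
  obtain ⟨K, hK⟩ : ∃ K : ℤ, ∀ t ∈ S, σ * t 0 - σ * s 0 ≤ K := by
    obtain ⟨t, ht, h⟩ := S.exists_max_image (fun t => σ * t 0 - σ * s 0) ⟨s, hs.1⟩
    exact ⟨_, h⟩
  have hK0 : 0 ≤ K := by have := hK s hs.1; linarith
  refine ⟨s, hs.1, hs.2, fun p hp hpc => ?_⟩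
  have := convexHull_le (S := S) (α := σ) (β := K * τ) (c := σ * s 0 + K * c) (by
    intro t ht
    have h1 : σ * t 0 + K * τ * t 1 ≤ σ * s 0 + K * c := by
      rcases eq_or_lt_of_le (hS t ht) with h | h
      · have := hmax t (by simp [ht, h])
        rw [mul_assoc, h]; linarith
      · have h2 := hK t ht
        have h3 : K * (τ * t 1) ≤ K * (c - 1) := mul_le_mul_of_nonneg_left (by omega) hK0
        linarith
    exact_mod_cast h1) p hp
  rw [mul_assoc, hpc] at this
  linarith

end LatticePlane

/-! ### Counting lattice points and midpoints row by row. -/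

namespace LatticePlane

open Finset

/-- The convex hull of a finite set of lattice points. -/
noncomputable def latticeHull (S : Finset (Fin 2 → ℤ)) : Set Plane :=
  convexHull ℝ (latticePoint '' (S : Set (Fin 2 → ℤ)))

variable {S : Finset (Fin 2 → ℤ)}

theorem latticePoint_mem_latticeHull {s : Fin 2 → ℤ} (hs : s ∈ S) :
    latticePoint s ∈ latticeHull S :=
  subset_convexHull ℝ _ ⟨s, hs, rfl⟩

theorem latticePoint_eq (s : Fin 2 → ℤ) : latticePoint s = ![(s 0 : ℝ), (s 1 : ℝ)] := by
  funext i; fin_cases i <;> rfl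

theorem isCompact_latticeHull : IsCompact (latticeHull S) :=
  (S.finite_toSet.image _).isCompact_convexHull (𝕜 := ℝ)

/-- Used for the bottom row with `τ = -1` and the top row with `τ = 1`: the chord there is a face of
the hull, so its ends are points of `S`. -/
theorem exists_int_ends {τ c y : ℤ} (hτ : τ ≠ 0) (hy : τ * y = c) (hS : ∀ s ∈ S, τ * s 1 ≤ c)
    (hex : ∃ x, (![x, (y : ℝ)] : Plane) ∈ latticeHull S) :
    (∃ m : ℤ, rightEnd (latticeHull S) y = m) ∧ ∃ m : ℤ, leftEnd (latticeHull S) y = m := by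
  have hex' : ∃ s ∈ S, τ * s 1 = c := by
    by_contra! hcon
    obtain ⟨x, hx⟩ := hex
    have := convexHull_le (S := S) (α := 0) (β := τ) (c := c - 1) (by
      intro s hs
      have := lt_of_le_of_ne (hS s hs) (hcon s hs)
      have h2 : τ * s 1 ≤ c - 1 := by omega
      have h3 : (τ : ℝ) * s 1 ≤ c - 1 := by exact_mod_cast h2
      linarith) _ hx
    simp at this
    rw [← hy] at this
    push_cast at this
    linarith
  have hyR : (τ : ℝ) * y = c := by exact_mod_cast hy
  have hmem : ∀ s ∈ S, τ * s 1 = c → (![(s 0 : ℝ), (y : ℝ)] : Plane) ∈ latticeHull S := by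
    intro s hs hsc
    have hsy : s 1 = y := by
      rw [← hy] at hsc
      exact mul_left_cancel₀ hτ hsc
    have := latticePoint_mem_latticeHull hs
    rwa [latticePoint_eq, hsy] at this
  constructor
  · obtain ⟨s, hs, hsc, hmax⟩ := exists_max_on_side 1 τ c hS hex'
    refine ⟨s 0, le_antisymm ?_ (le_rightEnd isCompact_latticeHull (hmem s hs hsc))⟩
    have := hmax _ (rightEnd_mem isCompact_latticeHull hex) (by simpa using hyR)
    simpa using this
  · obtain ⟨s, hs, hsc, hmax⟩ := exists_max_on_side (-1) τ c hS hex'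
    refine ⟨s 0, le_antisymm (leftEnd_le isCompact_latticeHull (hmem s hs hsc)) ?_⟩
    have := hmax _ (leftEnd_mem isCompact_latticeHull hex) (by simpa using hyR)
    simpa using this

/-- The number of integers strictly between the ends of the chord at height `i`, if the chord is not
a lattice point. -/
noncomputable def rowCount (P : Set Plane) (i : ℕ) : ℤ :=
  ⌈rightEnd P i⌉ - ⌊leftEnd P i⌋ - 1

theorem chord_le_rowCount (P : Set Plane) (i : ℕ) :
    rightEnd P i - leftEnd P i - 1 ≤ rowCount P i := by
  rw [rowCount]
  push_cast
  linarith [Int.le_ceil (rightEnd P i), Int.floor_le (leftEnd P i)]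

theorem rowCount_nonneg {P : Set Plane} {i : ℕ} (h : leftEnd P i < rightEnd P i) :
    0 ≤ rowCount P i := by
  have h1 : ((⌊leftEnd P i⌋ : ℤ) : ℝ) < ⌈rightEnd P i⌉ :=
    lt_of_le_of_lt (Int.floor_le _) (lt_of_lt_of_le h (Int.le_ceil _))
  have h2 : ⌊leftEnd P i⌋ < ⌈rightEnd P i⌉ := by exact_mod_cast h1
  rw [rowCount]; omega

theorem sum_rowCount_le_genus {P : Set Plane} {W : ℕ} (h : HasHeight P W)
    (hint : (interior P).Nonempty) : ∑ i ∈ Ico 1 W, rowCount P i ≤ genus P := by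
  have hfin : {z : Fin 2 → ℤ | latticePoint z ∈ interior P}.Finite :=
    finite_latticePoint_mem (h.isCompact.isBounded.subset interior_subset)
  let F : Finset (Σ _ : ℕ, ℤ) :=
    (Ico 1 W).sigma fun i => Icc (⌊leftEnd P i⌋ + 1) (⌈rightEnd P i⌉ - 1)
  have hcard : (#F : ℤ) = ∑ i ∈ Ico 1 W, rowCount P i := by
    rw [card_sigma]
    push_cast
    refine sum_congr rfl fun i hi => ?_
    rw [mem_Ico] at hi
    have h0 := rowCount_nonneg (h.leftEnd_lt_rightEnd hint (y := i) (by exact_mod_cast hi.1)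
      (by exact_mod_cast hi.2))
    rw [rowCount] at h0 ⊢
    rw [Int.card_Icc, Int.toNat_of_nonneg (by omega)]
    ring
  rw [← hcard, genus, Set.ncard_eq_toFinset_card _ hfin]
  norm_cast
  refine card_le_card_of_injOn (fun p => ![p.2, (p.1 : ℤ)]) ?_ ?_
  · rintro ⟨i, k⟩ hik
    simp only [F, Finset.mem_coe, mem_sigma, mem_Ico, mem_Icc] at hik
    simp only [Set.Finite.coe_toFinset, Set.mem_ofPred_eq]
    rw [latticePoint_eq]
    have h1 : ((⌊leftEnd P i⌋ : ℤ) : ℝ) + 1 ≤ k := by exact_mod_cast hik.2.1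
    have h2 : (k : ℝ) ≤ ⌈rightEnd P i⌉ - 1 := by exact_mod_cast hik.2.2
    have := h.mem_interior hint (x := k) (y := i) (by exact_mod_cast hik.1.1)
      (by exact_mod_cast hik.1.2) (by linarith [Int.lt_floor_add_one (leftEnd P i)])
      (by linarith [Int.ceil_lt_add_one (rightEnd P i)])
    simpa using this
  · rintro ⟨i, k⟩ - ⟨j, l⟩ - heq
    have h0 := congrFun heq 0
    have h1 := congrFun heq 1
    simp at h0 h1
    subst h0 h1
    rfl

theorem sum_Ico_add_succ (n : ℕ → ℤ) {W : ℕ} (hW : 1 ≤ W) :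
    ∑ i ∈ range W, (n i + n (i + 1)) = 2 * ∑ i ∈ Ico 1 W, n i + n 0 + n W := by
  induction W, hW using Nat.le_induction with
  | base => simp
  | succ W hW ih => rw [sum_range_succ, ih, sum_Ico_succ_top hW]; ring

/-- The number of midpoints of edges in the interior of a lattice polygon, in terms of its horizontal
chords. -/
theorem ncard_innerMidpoints_le {W : ℕ} (hW : 2 ≤ W) (h : HasHeight (latticeHull S) W)
    (hint : (interior (latticeHull S)).Nonempty) :
    ((innerMidpoints (latticeHull S)).ncard : ℝ) ≤ 3 * genus (latticeHull S) +
      (rightEnd (latticeHull S) 0 - leftEnd (latticeHull S) 0) +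
      (rightEnd (latticeHull S) W - leftEnd (latticeHull S) W) + 2 * W - 3 := by
  classical
  set P := latticeHull S with hP
  have hfin := finite_innerMidpoints h.isCompact.isBounded
  have hSb : ∀ s ∈ S, 0 ≤ s 1 ∧ s 1 ≤ W := by
    intro s hs
    obtain ⟨h1, h2⟩ := h.between _ (latticePoint_mem_latticeHull hs)
    simp only [latticePoint] at h1 h2
    exact ⟨by exact_mod_cast h1, by exact_mod_cast h2⟩
  obtain ⟨⟨r₀, hr₀⟩, l₀, hl₀⟩ := exists_int_ends (S := S) (τ := -1) (c := 0) (y := 0) (by norm_num)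
    (by norm_num) (fun s hs => by linarith [(hSb s hs).1]) (by simpa using h.bottom)
  obtain ⟨⟨r₁, hr₁⟩, l₁, hl₁⟩ := exists_int_ends (S := S) (τ := 1) (c := W) (y := W) (by norm_num)
    (by norm_num) (fun s hs => by linarith [(hSb s hs).2]) (by simpa using h.top)
  simp only [Int.cast_zero, Int.cast_natCast, ← hP] at hr₀ hl₀ hr₁ hl₁
  let n : ℕ → ℤ := rowCount P
  -- The ends are integers, so `n 0` is the side length minus 1. It is -1 when the side is a single
  -- vertex; the same holds at the top.
  have hn₀ : n 0 + 1 = r₀ - l₀ := by simp [n, rowCount, hr₀, hl₀]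
  have hn₁ : n W + 1 = r₁ - l₁ := by simp [n, rowCount, hr₁, hl₁]
  have hWpos := h.pos
  have hn₀' : -1 ≤ n 0 := by
    have := h.leftEnd_le_rightEnd (y := 0) ⟨le_rfl, hWpos.le⟩
    rw [hr₀, hl₀] at this
    have : l₀ ≤ r₀ := by exact_mod_cast this
    omega
  have hn₁' : -1 ≤ n W := by
    have := h.leftEnd_le_rightEnd (y := W) ⟨hWpos.le, le_rfl⟩
    rw [hr₁, hl₁] at this
    have : l₁ ≤ r₁ := by exact_mod_cast this
    omega
  have hn : ∀ i, 0 < i → i < W → 0 ≤ n i := fun i h0 h1 =>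
    rowCount_nonneg (h.leftEnd_lt_rightEnd hint (by exact_mod_cast h0) (by exact_mod_cast h1))
  -- In doubled coordinates, `A i` covers the midpoints at the integral height i, whose first
  -- coordinate is odd, and `B i` those at height i + 1/2, whose first coordinate is arbitrary.
  let A : ℕ → Finset (Fin 2 → ℤ) := fun i =>
    (Icc ⌊leftEnd P i⌋ (⌈rightEnd P i⌉ - 1)).image fun k => ![2 * k + 1, 2 * (i : ℤ)]
  let B : ℕ → Finset (Fin 2 → ℤ) := fun i =>
    (Icc (⌊leftEnd P i⌋ + ⌊leftEnd P (i + 1 : ℕ)⌋ + 1)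
      (⌈rightEnd P i⌉ + ⌈rightEnd P (i + 1 : ℕ)⌉ - 1)).image fun k => ![k, 2 * (i : ℤ) + 1]
  have hsub : hfin.toFinset ⊆ (Ico 1 W).biUnion A ∪ (range W).biUnion B := by
    intro s hs
    rw [Set.Finite.mem_toFinset] at hs
    obtain ⟨hs, hodd⟩ := hs
    have hse : halfPoint s = ![(s 0 : ℝ) / 2, (s 1 : ℝ) / 2] := by
      funext i; fin_cases i <;> rfl
    rw [hse] at hs
    obtain ⟨h0, h1, h2, h3⟩ := h.of_mem_interior hs
    have h0' : 0 < s 1 := by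
      have : (0 : ℝ) < s 1 := by linarith
      exact_mod_cast this
    have h1' : s 1 < 2 * W := by
      have : (s 1 : ℝ) < 2 * W := by linarith
      exact_mod_cast this
    rw [mem_union]
    rcases Int.even_or_odd' (s 1) with ⟨j, hj | hj⟩
    · left
      have hj0 : 0 < j := by omega
      obtain ⟨i, rfl⟩ := Int.eq_ofNat_of_zero_le hj0.le
      have hs0 : Odd (s 0) := by
        rcases hodd with h | h
        · exact h
        · rw [hj] at h; exact absurd h (Int.not_odd_iff_even.2 (even_two_mul _))
      obtain ⟨k, hk⟩ := hs0
      rw [mem_biUnion]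
      refine ⟨i, by rw [mem_Ico]; omega, ?_⟩
      have hy : (s 1 : ℝ) / 2 = i := by rw [hj]; push_cast; ring
      rw [hy, hk] at h2 h3
      push_cast at h2 h3
      simp only [A, mem_image, mem_Icc]
      refine ⟨k, ⟨?_, ?_⟩, ?_⟩
      · have : ((⌊leftEnd P i⌋ : ℤ) : ℝ) < k + 1 := by linarith [Int.floor_le (leftEnd P i)]
        have : ⌊leftEnd P i⌋ < k + 1 := by exact_mod_cast this
        omega
      · have : (k : ℝ) < ⌈rightEnd P i⌉ := by linarith [Int.le_ceil (rightEnd P i)]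
        have : k < ⌈rightEnd P i⌉ := by exact_mod_cast this
        omega
      · funext t
        fin_cases t
        · simp [hk]
        · simp [hj]
    · right
      have hj0 : 0 ≤ j := by omega
      obtain ⟨i, rfl⟩ := Int.eq_ofNat_of_zero_le hj0
      rw [mem_biUnion]
      refine ⟨i, by rw [mem_range]; omega, ?_⟩
      have hy : (s 1 : ℝ) / 2 = ((i : ℤ) : ℝ) + 1 / 2 := by rw [hj]; push_cast; ring
      have hex := h.exists_mem (y := (s 1 : ℝ) / 2) ⟨h0.le, h1.le⟩
      -- The ends of the chord at height i + 1/2 are averages of points of rows i and i + 1, so the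
      -- doubled first coordinate is confined by the sums of the ends of these rows.
      obtain ⟨x₁, x₂, m₁, m₂, hx⟩ := exists_of_half_row (S := S) (i := i)
        (leftEnd_mem h.isCompact hex) (by simpa using hy)
      obtain ⟨x₃, x₄, m₃, m₄, hx'⟩ := exists_of_half_row (S := S) (i := i)
        (rightEnd_mem h.isCompact hex) (by simpa using hy)
      have e₁ := leftEnd_le h.isCompact m₁
      have e₂ := leftEnd_le h.isCompact m₂
      have e₃ := le_rightEnd h.isCompact m₃
      have e₄ := le_rightEnd h.isCompact m₄
      have hcast : ((i : ℤ) : ℝ) = i := by norm_cast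
      have hcast' : ((i + 1 : ℕ) : ℝ) = (i : ℝ) + 1 := by push_cast; ring
      simp only [Matrix.cons_val_zero] at hx hx'
      rw [hcast] at e₁ e₂ e₃ e₄
      rw [← hcast'] at e₂ e₄
      simp only [B, mem_image, mem_Icc]
      refine ⟨s 0, ⟨?_, ?_⟩, ?_⟩
      · have : ((⌊leftEnd P i⌋ : ℤ) : ℝ) + (⌊leftEnd P (i + 1 : ℕ)⌋ : ℤ) < s 0 := by
          linarith [Int.floor_le (leftEnd P i), Int.floor_le (leftEnd P (i + 1 : ℕ))]
        have : ⌊leftEnd P i⌋ + ⌊leftEnd P (i + 1 : ℕ)⌋ < s 0 := by exact_mod_cast this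
        omega
      · have : (s 0 : ℝ) < ((⌈rightEnd P i⌉ : ℤ) : ℝ) + (⌈rightEnd P (i + 1 : ℕ)⌉ : ℤ) := by
          linarith [Int.le_ceil (rightEnd P i), Int.le_ceil (rightEnd P (i + 1 : ℕ))]
        have : s 0 < ⌈rightEnd P i⌉ + ⌈rightEnd P (i + 1 : ℕ)⌉ := by exact_mod_cast this
        omega
      · funext t
        fin_cases t
        · simp
        · simp [hj]
  have hA : ∀ i ∈ Ico 1 W, (#(A i) : ℤ) ≤ n i + 1 := by
    intro i hi
    rw [mem_Ico] at hi
    have h0 := hn i (by omega) hi.2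
    have h1 : (#(A i) : ℤ) ≤ #(Icc ⌊leftEnd P i⌋ (⌈rightEnd P i⌉ - 1)) := by
      exact_mod_cast card_image_le
    refine h1.trans ?_
    simp only [n, rowCount] at h0 ⊢
    rw [Int.card_Icc, Int.toNat_of_nonneg (by omega)]
    omega
  have hB : ∀ i ∈ range W, (#(B i) : ℤ) ≤ n i + n (i + 1) + 1 := by
    intro i hi
    rw [mem_range] at hi
    -- Only the rows 0 and `W` can have the value -1, and they are not adjacent because `W ≥ 2`. The
    -- interval defining `B i` therefore has no negative formal length.
    have h0 : -1 ≤ n i + n (i + 1) := by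
      rcases Nat.eq_zero_or_pos i with rfl | hi0
      · have := hn (0 + 1) (by omega) (by omega); omega
      · have h1 := hn i hi0 hi
        rcases eq_or_lt_of_le (show i + 1 ≤ W from hi) with h | h
        · rw [h]; omega
        · have := hn (i + 1) (by omega) h; omega
    have h1 : (#(B i) : ℤ) ≤ #(Icc (⌊leftEnd P i⌋ + ⌊leftEnd P (i + 1 : ℕ)⌋ + 1)
        (⌈rightEnd P i⌉ + ⌈rightEnd P (i + 1 : ℕ)⌉ - 1)) := by
      exact_mod_cast card_image_le
    refine h1.trans ?_
    simp only [n, rowCount] at h0 ⊢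
    rw [Int.card_Icc, Int.toNat_of_nonneg (by omega)]
    omega
  have hcount : ((innerMidpoints P).ncard : ℤ) ≤
      3 * ∑ i ∈ Ico 1 W, n i + (r₀ - l₀) + (r₁ - l₁) + 2 * W - 3 := by
    rw [Set.ncard_eq_toFinset_card _ hfin]
    calc (#hfin.toFinset : ℤ) ≤ #((Ico 1 W).biUnion A ∪ (range W).biUnion B) := by
          exact_mod_cast card_le_card hsub
      _ ≤ #((Ico 1 W).biUnion A) + #((range W).biUnion B) := by exact_mod_cast card_union_le _ _
      _ ≤ ∑ i ∈ Ico 1 W, (#(A i) : ℤ) + ∑ i ∈ range W, (#(B i) : ℤ) := by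
          have h1 : #((Ico 1 W).biUnion A) ≤ ∑ i ∈ Ico 1 W, #(A i) := card_biUnion_le
          have h2 : #((range W).biUnion B) ≤ ∑ i ∈ range W, #(B i) := card_biUnion_le
          exact_mod_cast add_le_add h1 h2
      _ ≤ ∑ i ∈ Ico 1 W, (n i + 1) + ∑ i ∈ range W, (n i + n (i + 1) + 1) :=
          add_le_add (sum_le_sum hA) (sum_le_sum hB)
      _ = _ := by
          rw [sum_add_distrib, sum_add_distrib (s := range W), sum_Ico_add_succ n (by omega)]
          simp only [sum_const, Nat.card_Ico, card_range, nsmul_eq_mul, mul_one]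
          rw [← hn₀, ← hn₁, Nat.cast_sub (by omega)]
          push_cast
          ring
  have hg := sum_rowCount_le_genus h hint
  rw [hr₀, hl₀, hr₁, hl₁]
  have : ((innerMidpoints P).ncard : ℤ) ≤ 3 * genus P + (r₀ - l₀) + (r₁ - l₁) + 2 * W - 3 := by
    simp only [n] at hcount
    linarith
  exact_mod_cast this

end LatticePlane

namespace LatticePlane

open Finset

/-! ### Area and lattice width -/

/-- The weights come from adding the linear interpolations between `A` and `B` at k and k + 1,
scaled by j - i. The free upper limit `m` serves the induction; `m = j` gives (j - i)² (A + B). -/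
theorem sum_Ico_interpolation (i j : ℝ) (A B : ℝ) (m₀ m : ℕ) (hm : m₀ ≤ m) (hi : i = m₀) :
    ∑ k ∈ Ico m₀ m, ((2 * j - 2 * k - 1) * A + (2 * k + 1 - 2 * i) * B) =
      (m - i) * (2 * j - i - m) * A + (m - i) ^ 2 * B := by
  subst hi
  induction m, hm using Nat.le_induction with
  | base => simp
  | succ m hm ih => rw [sum_Ico_succ_top hm, ih]; push_cast; ring

/-- The trapezoid inequality for concave functions. -/
theorem trapezoid_le_sum {f : ℝ → ℝ} {W : ℝ} (hf : ConcaveOn ℝ (Set.Icc 0 W) f) {i j : ℕ}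
    (hij : i ≤ j) (hj : (j : ℝ) ≤ W) :
    (j - i : ℝ) * (f i + f j) ≤ ∑ k ∈ Ico i j, (f k + f (k + 1 : ℕ)) := by
  rcases eq_or_lt_of_le hij with rfl | hlt
  · simp
  have hd : (0 : ℝ) < j - i := by
    have : (i : ℝ) < j := by exact_mod_cast hlt
    linarith
  have hmem : ∀ k : ℕ, k ≤ j → (k : ℝ) ∈ Set.Icc 0 W := fun k hk =>
    ⟨Nat.cast_nonneg k, le_trans (by exact_mod_cast hk) hj⟩
  have key : ∀ k : ℕ, i ≤ k → k ≤ j →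
      (j - k : ℝ) * f i + (k - i : ℝ) * f j ≤ (j - i : ℝ) * f k := by
    intro k h1 h2
    have h1' : (i : ℝ) ≤ k := by exact_mod_cast h1
    have h2' : (k : ℝ) ≤ j := by exact_mod_cast h2
    have := hf.2 (hmem i hij) (hmem j le_rfl)
      (show (0 : ℝ) ≤ (j - k) / (j - i) from div_nonneg (by linarith) hd.le)
      (show (0 : ℝ) ≤ (k - i) / (j - i) from div_nonneg (by linarith) hd.le) (by field_simp; ring)
    simp only [smul_eq_mul] at this
    rw [show (j - k : ℝ) / (j - i) * i + (k - i : ℝ) / (j - i) * j = k by field_simp; ring] at this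
    have h3 := mul_le_mul_of_nonneg_left this hd.le
    calc (j - k : ℝ) * f i + (k - i : ℝ) * f j
        = (j - i : ℝ) * ((j - k : ℝ) / (j - i) * f i + (k - i : ℝ) / (j - i) * f j) := by
          field_simp
      _ ≤ _ := h3
  have hsum : ∑ k ∈ Ico i j, ((2 * (j : ℝ) - 2 * k - 1) * f i + (2 * k + 1 - 2 * (i : ℝ)) * f j) ≤
      ∑ k ∈ Ico i j, (j - i : ℝ) * (f k + f (k + 1 : ℕ)) := by
    refine sum_le_sum fun k hk => ?_
    rw [mem_Ico] at hk
    have h1 := key k hk.1 hk.2.le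
    have h2 := key (k + 1) (by omega) hk.2
    push_cast at h2 ⊢
    linarith
  rw [sum_Ico_interpolation _ _ _ _ i j hij rfl, ← mul_sum] at hsum
  nlinarith

/-- In the box [0, N] × [0, W], let the polygon touch the left side at height W - δ, the right side
at height α, the bottom at N - β and the top at γ. The subtracted terms bound twice the areas cut
off at the four corners, where `u` and `v` are the depths of the cuts at (N, 0) and (0, W) in the
direction x - y. With p = W - α and q = N - γ, the expression decreases when β is lowered to max(u,
q) and δ to max(v, p). The worst case leaves WN - (u - q)(v - p), and u + v ≤ W bounds the product
by W²/4. -/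
theorem quadratic_aux₁ {W N α β γ δ u v : ℝ} (hα : α ≤ W) (hγ : γ ≤ N)
    (hβ : β ≤ N) (hδ : δ ≤ W) (hαδ : W ≤ α + δ) (hβγ : N ≤ β + γ)
    (hγ0 : 0 ≤ γ) (hα0 : 0 ≤ α)
    (huβ : u ≤ β) (hvδ : v ≤ δ) (huv : u + v ≤ W) :
    W * N - W ^ 2 / 4 ≤ 2 * W * N - (W - δ) * (N - β) - (W - α) * (N - γ) - u * α - v * γ := by
  obtain ⟨p, rfl⟩ : ∃ p, α = W - p := ⟨W - α, by ring⟩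
  obtain ⟨q, rfl⟩ : ∃ q, γ = N - q := ⟨N - γ, by ring⟩
  have key : ∀ β₀ δ₀, β₀ ≤ β → δ₀ ≤ δ → W * N - W ^ 2 / 4 ≤
      W * N - p * q + N * (δ₀ - v) + W * (β₀ - u) - β₀ * δ₀ + u * p + v * q →
      W * N - W ^ 2 / 4 ≤ 2 * W * N - (W - δ) * (N - β) - (W - (W - p)) * (N - (N - q)) -
        u * (W - p) - v * (N - q) := by
    intro β₀ δ₀ h1 h2 h
    have h3 : 0 ≤ (W - δ) * (β - β₀) := mul_nonneg (by linarith) (by linarith)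
    have h4 : 0 ≤ (N - β₀) * (δ - δ₀) := mul_nonneg (by linarith) (by linarith)
    linarith
  have hW2 : 0 ≤ W ^ 2 / 4 := by positivity
  rcases le_total q u with h1 | h1 <;> rcases le_total p v with h2 | h2
  · refine key u v huβ hvδ ?_
    have h3 : (u - q + (v - p)) ^ 2 ≤ W ^ 2 := pow_le_pow_left₀ (by linarith) (by linarith) 2
    nlinarith [sq_nonneg (u - q - (v - p))]
  · refine key u p huβ (by linarith) ?_
    have : 0 ≤ (N - q) * (p - v) := mul_nonneg hγ0 (by linarith)
    linarith
  · refine key q v (by linarith) hvδ ?_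
    have : 0 ≤ (W - p) * (q - u) := mul_nonneg hα0 (by linarith)
    linarith
  · refine key q p (by linarith) (by linarith) ?_
    have h3 : 0 ≤ (N - q) * (p - v) := mul_nonneg hγ0 (by linarith)
    have h4 : 0 ≤ (W - p) * (q - u) := mul_nonneg hα0 (by linarith)
    linarith

/-- Here nothing is lost. With q = N - γ and r = N - β, the right side is at least 2WN - W(max(u, q)
+ max(v, r)), and each of the four possible sums of maxima is at most N. -/
theorem quadratic_aux₂ {W N α β γ δ u v : ℝ} (hWN : W ≤ N) (hW : 0 ≤ W) (hα : α ≤ W) (hγ : γ ≤ N)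
    (hβ : β ≤ N) (hδ : δ ≤ W) (hβγ : N ≤ β + γ) (huβ : u ≤ β) (hvγ : v ≤ γ) (huv : u + v ≤ W)
    (hαβ : β ≤ α) (hγδ : γ ≤ δ) :
    W * N ≤ 2 * W * N - (W - δ) * (N - β) - (W - α) * (N - γ) - u * α - v * δ := by
  obtain ⟨p, rfl⟩ : ∃ p, α = W - p := ⟨W - α, by ring⟩
  obtain ⟨s, rfl⟩ : ∃ s, δ = W - s := ⟨W - δ, by ring⟩
  obtain ⟨q, rfl⟩ : ∃ q, γ = N - q := ⟨N - γ, by ring⟩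
  obtain ⟨r, rfl⟩ : ∃ r, β = N - r := ⟨N - β, by ring⟩
  have e : 2 * W * N - (W - (W - s)) * (N - (N - r)) - (W - (W - p)) * (N - (N - q)) -
      u * (W - p) - v * (W - s) = 2 * W * N - W * (u + v) - p * (q - u) - s * (r - v) := by ring
  rw [e]
  have hq0 : 0 ≤ q := by linarith
  have hr0 : 0 ≤ r := by linarith
  have hp : p ≤ W - q := by linarith
  have hs : s ≤ W - r := by linarith
  have hp0 : 0 ≤ p := by linarith
  have hs0 : 0 ≤ s := by linarith
  have hWuv : W * (u + v) ≤ W * N := mul_le_mul_of_nonneg_left (by linarith) hW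
  rcases le_total q u with h1 | h1 <;> rcases le_total r v with h2 | h2
  · have h3 : 0 ≤ p * (u - q) := mul_nonneg hp0 (by linarith)
    have h4 : 0 ≤ s * (v - r) := mul_nonneg hs0 (by linarith)
    linarith
  · have h3 : 0 ≤ p * (u - q) := mul_nonneg hp0 (by linarith)
    have h4 : 0 ≤ (W - r - s) * (r - v) := mul_nonneg (by linarith) (by linarith)
    have h5 : 0 ≤ r * (r - v) := mul_nonneg hr0 (by linarith)
    have h6 : W * (u + r) ≤ W * N := mul_le_mul_of_nonneg_left (by linarith) hW
    linarith
  · have h3 : 0 ≤ s * (v - r) := mul_nonneg hs0 (by linarith)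
    have h4 : 0 ≤ (W - q - p) * (q - u) := mul_nonneg (by linarith) (by linarith)
    have h5 : 0 ≤ q * (q - u) := mul_nonneg hq0 (by linarith)
    have h6 : W * (q + v) ≤ W * N := mul_le_mul_of_nonneg_left (by linarith) hW
    linarith
  · have h3 : 0 ≤ (W - r - s) * (r - v) := mul_nonneg (by linarith) (by linarith)
    have h4 : 0 ≤ (W - q - p) * (q - u) := mul_nonneg (by linarith) (by linarith)
    have h5 : 0 ≤ q * (q - u) := mul_nonneg hq0 (by linarith)
    have h5' : 0 ≤ r * (r - v) := mul_nonneg hr0 (by linarith)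
    have h6 : W * (q + r) ≤ W * N := mul_le_mul_of_nonneg_left (by linarith) hW
    linarith

/-- The cut-off terms are affine in τ and σ, so they are largest at the ends 0 ≤ τ ≤ u and 0 ≤ σ ≤
v. The order of α and β and that of γ and δ decide which end is the worst. -/
theorem quadratic_ineq {W N α β γ δ u v τ σ : ℝ} (hWN : W ≤ N) (hW : 0 ≤ W) (hα : α ≤ W)
    (hγ : γ ≤ N) (hβ : β ≤ N) (hδ : δ ≤ W) (hα0 : 0 ≤ α) (hβ0 : 0 ≤ β) (hγ0 : 0 ≤ γ) (hδ0 : 0 ≤ δ)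
    (hαδ : W ≤ α + δ) (hβγ : N ≤ β + γ) (huα : u ≤ α)
    (huβ : u ≤ β) (hvγ : v ≤ γ) (hvδ : v ≤ δ) (huv : u + v ≤ W) (hτ : 0 ≤ τ) (hτu : τ ≤ u)
    (hσ : 0 ≤ σ) (hσv : σ ≤ v) :
    W * N - W ^ 2 / 4 ≤ 2 * W * N - (W - δ) * (N - β) - (W - α) * (N - γ) -
      (α * (u - τ) + β * τ) - (δ * σ + γ * (v - σ)) := by
  have hW2 : 0 ≤ W ^ 2 / 4 := by positivity
  have hu : 0 ≤ u := by linarith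
  have hv : 0 ≤ v := by linarith
  rcases le_total β α with h1 | h1 <;> rcases le_total δ γ with h2 | h2
  · have := quadratic_aux₁ hα hγ hβ hδ hαδ hβγ hγ0 hα0 huβ hvδ huv
    have h3 : 0 ≤ (α - β) * τ := mul_nonneg (by linarith) hτ
    have h4 : 0 ≤ (γ - δ) * σ := mul_nonneg (by linarith) hσ
    linarith
  · have := quadratic_aux₂ hWN hW hα hγ hβ hδ hβγ huβ hvγ huv h1 h2
    have h3 : 0 ≤ (α - β) * τ := mul_nonneg (by linarith) hτ
    have h4 : 0 ≤ (δ - γ) * (v - σ) := mul_nonneg (by linarith) (by linarith)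
    linarith
  · -- here the roles of the two coordinates are exchanged
    have key : W * N ≤ 2 * W * N - (W - δ) * (N - β) - (W - α) * (N - γ) - u * β - v * γ := by
      obtain ⟨p, rfl⟩ : ∃ p, β = N - p := ⟨N - β, by ring⟩
      obtain ⟨s, rfl⟩ : ∃ s, γ = N - s := ⟨N - γ, by ring⟩
      obtain ⟨q, rfl⟩ : ∃ q, δ = W - q := ⟨W - δ, by ring⟩
      obtain ⟨r, rfl⟩ : ∃ r, α = W - r := ⟨W - α, by ring⟩
      have e : 2 * W * N - (W - (W - q)) * (N - (N - p)) - (W - (W - r)) * (N - (N - s)) -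
          u * (N - p) - v * (N - s) = 2 * W * N - N * (u + v) - p * (q - u) - s * (r - v) := by ring
      rw [e]
      have hN : 0 ≤ N := by linarith
      have hp : p ≤ N - q := by linarith
      have hs : s ≤ N - r := by linarith
      have hq0 : 0 ≤ q := by linarith
      have hr0 : 0 ≤ r := by linarith
      have hp0 : 0 ≤ p := by linarith
      have hs0 : 0 ≤ s := by linarith
      rcases le_total q u with h1 | h1 <;> rcases le_total r v with h2 | h2
      · have h3 : 0 ≤ p * (u - q) := mul_nonneg hp0 (by linarith)
        have h4 : 0 ≤ s * (v - r) := mul_nonneg hs0 (by linarith)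
        have h6 : N * (u + v) ≤ N * W := mul_le_mul_of_nonneg_left huv hN
        linarith
      · have h3 : 0 ≤ p * (u - q) := mul_nonneg hp0 (by linarith)
        have h4 : 0 ≤ (N - r - s) * (r - v) := mul_nonneg (by linarith) (by linarith)
        have h5 : 0 ≤ r * (r - v) := mul_nonneg hr0 (by linarith)
        have h6 : N * (u + r) ≤ N * W := mul_le_mul_of_nonneg_left (by linarith) hN
        linarith
      · have h3 : 0 ≤ s * (v - r) := mul_nonneg hs0 (by linarith)
        have h4 : 0 ≤ (N - q - p) * (q - u) := mul_nonneg (by linarith) (by linarith)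
        have h5 : 0 ≤ q * (q - u) := mul_nonneg hq0 (by linarith)
        have h6 : N * (q + v) ≤ N * W := mul_le_mul_of_nonneg_left (by linarith) hN
        linarith
      · have h3 : 0 ≤ (N - r - s) * (r - v) := mul_nonneg (by linarith) (by linarith)
        have h4 : 0 ≤ (N - q - p) * (q - u) := mul_nonneg (by linarith) (by linarith)
        have h5 : 0 ≤ q * (q - u) := mul_nonneg hq0 (by linarith)
        have h5' : 0 ≤ r * (r - v) := mul_nonneg hr0 (by linarith)
        have h6 : N * (q + r) ≤ N * W := mul_le_mul_of_nonneg_left (by linarith) hN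
        linarith
    have h3 : 0 ≤ (β - α) * (u - τ) := mul_nonneg (by linarith) (by linarith)
    have h4 : 0 ≤ (γ - δ) * σ := mul_nonneg (by linarith) hσ
    linarith
  · have key : W * N - W ^ 2 / 4 ≤
        2 * W * N - (W - δ) * (N - β) - (W - α) * (N - γ) - u * β - v * δ := by
      obtain ⟨p, rfl⟩ : ∃ p, β = N - p := ⟨N - β, by ring⟩
      obtain ⟨q, rfl⟩ : ∃ q, δ = W - q := ⟨W - δ, by ring⟩
      have key : ∀ α₀ γ₀, α₀ ≤ α → γ₀ ≤ γ → W * N - W ^ 2 / 4 ≤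
          W * N - p * q + N * (α₀ - u) + W * (γ₀ - v) - α₀ * γ₀ + u * p + v * q →
          W * N - W ^ 2 / 4 ≤ 2 * W * N - (W - (W - q)) * (N - (N - p)) - (W - α) * (N - γ) -
            u * (N - p) - v * (W - q) := by
        intro α₀ γ₀ h1 h2 h
        have h3 : 0 ≤ (N - γ) * (α - α₀) := mul_nonneg (by linarith) (by linarith)
        have h4 : 0 ≤ (W - α₀) * (γ - γ₀) := mul_nonneg (by linarith) (by linarith)
        linarith
      rcases le_total q u with h1 | h1 <;> rcases le_total p v with h2 | h2
      · refine key u v huα hvγ ?_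
        have h3 : (u - q + (v - p)) ^ 2 ≤ W ^ 2 := pow_le_pow_left₀ (by linarith) (by linarith) 2
        nlinarith [sq_nonneg (u - q - (v - p))]
      · refine key u p huα (by linarith) ?_
        have : 0 ≤ (W - q) * (p - v) := mul_nonneg hδ0 (by linarith)
        linarith
      · refine key q v (by linarith) hvγ ?_
        have : 0 ≤ (N - p) * (q - u) := mul_nonneg hβ0 (by linarith)
        linarith
      · refine key q p (by linarith) (by linarith) ?_
        have h3 : 0 ≤ (W - q) * (p - v) := mul_nonneg hδ0 (by linarith)
        have h4 : 0 ≤ (N - p) * (q - u) := mul_nonneg hβ0 (by linarith)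
        linarith
    have h3 : 0 ≤ (β - α) * (u - τ) := mul_nonneg (by linarith) (by linarith)
    have h4 : 0 ≤ (δ - γ) * (v - σ) := mul_nonneg (by linarith) (by linarith)
    linarith

end LatticePlane

/-! ### The area of a polygon in reduced position. -/

namespace LatticePlane

open Finset

/-- The trapezoid sum between a concave and a convex function, when the region between them contains
points on the four sides of the rectangle `[0, N] × [0, W]`, increasing on opposite sides, and two
points that are far apart in the direction `x - y`. -/
theorem sum_trapezoid_ge_of_diagonal {r l : ℝ → ℝ} {W N : ℕ} (hWN : W ≤ N)
    (hr : ConcaveOn ℝ (Set.Icc 0 (W : ℝ)) r) (hl : ConvexOn ℝ (Set.Icc 0 (W : ℝ)) l)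
    {a c y₁ y₂ : ℕ} {b d x₁ x₂ : ℝ} (hac : a ≤ c) (hbd : b ≤ d) (hcW : c ≤ W)
    (hb : 0 ≤ b) (hdN : d ≤ N) (hx₁ : x₁ ≤ N) (hx₂ : 0 ≤ x₂) (hy₂ : y₂ ≤ W)
    (hr0 : b ≤ r 0) (hr1 : x₁ ≤ r y₁) (hrc : N ≤ r c) (hrW : d ≤ r W)
    (hl0 : l 0 ≤ b) (hl1 : l y₂ ≤ x₂) (hla : l a ≤ 0) (hlW : l W ≤ d)
    (h₁b : b ≤ x₁ - y₁) (h₁c : (N : ℝ) - c ≤ x₁ - y₁) (h₂a : x₂ - y₂ ≤ -a) (h₂d : x₂ - y₂ ≤ d - W)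
    (hdiff : (N : ℝ) ≤ (x₁ - y₁) - (x₂ - y₂)) :
    (W : ℝ) * N - W ^ 2 / 4 ≤
      ∑ k ∈ Ico 0 W, ((r k - l k) + (r (k + 1 : ℕ) - l (k + 1 : ℕ))) := by
  have hacR : (a : ℝ) ≤ c := by exact_mod_cast hac
  have hcWR : (c : ℝ) ≤ W := by exact_mod_cast hcW
  have hy₂R : (y₂ : ℝ) ≤ W := by exact_mod_cast hy₂
  have hWNR : (W : ℝ) ≤ N := by exact_mod_cast hWN
  have ha0 : (0 : ℝ) ≤ a := Nat.cast_nonneg a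
  have hy0 : (0 : ℝ) ≤ y₁ := Nat.cast_nonneg y₁
  -- The extremality of the two diagonal points places them in the right order on the boundary, so
  -- the right boundary can be split at the rows 0, y₁, c, W and the left one at 0, a, y₂, W.
  have hy₁cR : (y₁ : ℝ) ≤ c := by linarith
  have hay₂R : (a : ℝ) ≤ y₂ := by linarith
  have hy₁c : y₁ ≤ c := by exact_mod_cast hy₁cR
  have hay₂ : a ≤ y₂ := by exact_mod_cast hay₂R
  have t1 := trapezoid_le_sum hr (Nat.zero_le y₁) (by linarith)
  have t2 := trapezoid_le_sum hr hy₁c hcWR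
  have t3 := trapezoid_le_sum hr hcW le_rfl
  have t4 := trapezoid_le_sum hl.neg (Nat.zero_le a) (by linarith)
  have t5 := trapezoid_le_sum hl.neg hay₂ hy₂R
  have t6 := trapezoid_le_sum hl.neg hy₂ le_rfl
  have s1 := sum_Ico_consecutive (fun k : ℕ => r k + r (k + 1 : ℕ)) (Nat.zero_le y₁) hy₁c
  have s2 := sum_Ico_consecutive (fun k : ℕ => r k + r (k + 1 : ℕ)) (Nat.zero_le c) hcW
  have s3 := sum_Ico_consecutive (fun k : ℕ => (-l) k + (-l) (k + 1 : ℕ)) (Nat.zero_le a) hay₂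
  have s4 := sum_Ico_consecutive (fun k : ℕ => (-l) k + (-l) (k + 1 : ℕ)) (Nat.zero_le y₂) hy₂
  have hsplit : ∑ k ∈ Ico 0 W, ((r k - l k) + (r (k + 1 : ℕ) - l (k + 1 : ℕ))) =
      ∑ k ∈ Ico 0 W, (r k + r (k + 1 : ℕ)) + ∑ k ∈ Ico 0 W, ((-l) k + (-l) (k + 1 : ℕ)) := by
    rw [← sum_add_distrib]
    refine sum_congr rfl fun k _ => ?_
    simp only [Pi.neg_apply]
    ring
  simp only [Pi.neg_apply, Nat.cast_zero, sub_zero] at t1 t2 t3 t4 t5 t6 s3 s4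
  simp only [Pi.neg_apply] at hsplit
  have b1 : (y₁ : ℝ) * (b + x₁) ≤ y₁ * (r 0 + r y₁) := mul_le_mul_of_nonneg_left (by linarith) hy0
  have b2 : (c - y₁ : ℝ) * (x₁ + N) ≤ (c - y₁) * (r y₁ + r c) :=
    mul_le_mul_of_nonneg_left (by linarith) (by linarith)
  have b3 : (W - c : ℝ) * (N + d) ≤ (W - c) * (r c + r W) :=
    mul_le_mul_of_nonneg_left (by linarith) (by linarith)
  have b4 : (a : ℝ) * (-b + 0) ≤ a * (-l 0 + -l a) := mul_le_mul_of_nonneg_left (by linarith) ha0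
  have b5 : (y₂ - a : ℝ) * (0 + -x₂) ≤ (y₂ - a) * (-l a + -l y₂) :=
    mul_le_mul_of_nonneg_left (by linarith) (by linarith)
  have b6 : (W - y₂ : ℝ) * (-x₂ + -d) ≤ (W - y₂) * (-l y₂ + -l W) :=
    mul_le_mul_of_nonneg_left (by linarith) (by linarith)
  have key := quadratic_ineq (W := W) (N := N) (α := c) (β := N - b) (γ := d) (δ := W - a)
    (u := N - (x₁ - y₁)) (v := W + (x₂ - y₂)) (τ := y₁) (σ := x₂) hWNR (by linarith) hcWR hdN
    (by linarith) (by linarith) (by linarith) (by linarith) (by linarith) (by linarith)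
    (by linarith) (by linarith) (by linarith) (by linarith) (by linarith) (by linarith)
    (by linarith) hy0 (by linarith) hx₂ (by linarith)
  rw [hsplit]
  linarith

/-- Twice the area of the quadrilateral spanned by the contact points on the four sides is WN + (c -
a)(b - d). With this sign no diagonal width is needed. -/
theorem sum_trapezoid_ge_of_quadrilateral {r l : ℝ → ℝ} {W N : ℕ}
    (hr : ConcaveOn ℝ (Set.Icc 0 (W : ℝ)) r) (hl : ConvexOn ℝ (Set.Icc 0 (W : ℝ)) l)
    {a c : ℕ} {b d : ℝ} (haW : a ≤ W) (hcW : c ≤ W)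
    (hr0 : b ≤ r 0) (hrc : N ≤ r c) (hrW : d ≤ r W)
    (hl0 : l 0 ≤ b) (hla : l a ≤ 0) (hlW : l W ≤ d)
    (h : 0 ≤ ((c : ℝ) - a) * (b - d)) :
    (W : ℝ) * N - W ^ 2 / 4 ≤
      ∑ k ∈ Ico 0 W, ((r k - l k) + (r (k + 1 : ℕ) - l (k + 1 : ℕ))) := by
  have haWR : (a : ℝ) ≤ W := by exact_mod_cast haW
  have hcWR : (c : ℝ) ≤ W := by exact_mod_cast hcW
  have ha0 : (0 : ℝ) ≤ a := Nat.cast_nonneg a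
  have hc0 : (0 : ℝ) ≤ c := Nat.cast_nonneg c
  have t2 := trapezoid_le_sum hr (Nat.zero_le c) hcWR
  have t3 := trapezoid_le_sum hr hcW le_rfl
  have t5 := trapezoid_le_sum hl.neg (Nat.zero_le a) haWR
  have t6 := trapezoid_le_sum hl.neg haW le_rfl
  have s2 := sum_Ico_consecutive (fun k : ℕ => r k + r (k + 1 : ℕ)) (Nat.zero_le c) hcW
  have s4 := sum_Ico_consecutive (fun k : ℕ => (-l) k + (-l) (k + 1 : ℕ)) (Nat.zero_le a) haW
  have hsplit : ∑ k ∈ Ico 0 W, ((r k - l k) + (r (k + 1 : ℕ) - l (k + 1 : ℕ))) =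
      ∑ k ∈ Ico 0 W, (r k + r (k + 1 : ℕ)) + ∑ k ∈ Ico 0 W, ((-l) k + (-l) (k + 1 : ℕ)) := by
    rw [← sum_add_distrib]
    refine sum_congr rfl fun k _ => ?_
    simp only [Pi.neg_apply]
    ring
  simp only [Pi.neg_apply, Nat.cast_zero, sub_zero] at t2 t3 t5 t6 s4
  simp only [Pi.neg_apply] at hsplit
  have b2 : (c : ℝ) * (b + N) ≤ c * (r 0 + r c) := mul_le_mul_of_nonneg_left (by linarith) hc0
  have b3 : (W - c : ℝ) * (N + d) ≤ (W - c) * (r c + r W) :=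
    mul_le_mul_of_nonneg_left (by linarith) (by linarith)
  have b5 : (a : ℝ) * (-b + 0) ≤ a * (-l 0 + -l a) := mul_le_mul_of_nonneg_left (by linarith) ha0
  have b6 : (W - a : ℝ) * (0 + -d) ≤ (W - a) * (-l a + -l W) :=
    mul_le_mul_of_nonneg_left (by linarith) (by linarith)
  have hW2 : (0 : ℝ) ≤ (W : ℝ) ^ 2 / 4 := by positivity
  rw [hsplit]
  linarith

variable {S : Finset (Fin 2 → ℤ)}

/-- Reduced position: the lattice polygon spanned by `S` is inscribed in `[0, N] × [0, W]`, with
`W ≤ N`, and its widths in the directions `x - y` and `x + y` are at least `N`. -/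
structure IsReduced (S : Finset (Fin 2 → ℤ)) (W N : ℕ) : Prop where
  le : W ≤ N
  mem_box : ∀ s ∈ S, (0 ≤ s 0 ∧ s 0 ≤ N) ∧ 0 ≤ s 1 ∧ s 1 ≤ W
  left : ∃ s ∈ S, s 0 = 0
  right : ∃ s ∈ S, s 0 = N
  bottom : ∃ s ∈ S, s 1 = 0
  top : ∃ s ∈ S, s 1 = W
  diff : ∃ s ∈ S, ∃ t ∈ S, (N : ℤ) ≤ (s 0 - s 1) - (t 0 - t 1)
  sum : ∃ s ∈ S, ∃ t ∈ S, (N : ℤ) ≤ (s 0 + s 1) - (t 0 + t 1)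

theorem IsReduced.hasHeight {W N : ℕ} (h : IsReduced S W N) (hW : 0 < W) :
    HasHeight (latticeHull S) W where
  isCompact := isCompact_latticeHull
  convex := convex_convexHull ℝ _
  pos := by exact_mod_cast hW
  between := by
    intro p hp
    have h1 := convexHull_le (S := S) (α := 0) (β := -1) (c := 0) (fun s hs => by
      have : (0 : ℝ) ≤ s 1 := by exact_mod_cast (h.mem_box s hs).2.1
      linarith) p hp
    have h2 := convexHull_le (S := S) (α := 0) (β := 1) (c := W) (fun s hs => by
      have : (s 1 : ℝ) ≤ W := by exact_mod_cast (h.mem_box s hs).2.2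
      linarith) p hp
    constructor <;> linarith
  bottom := by
    obtain ⟨s, hs, h0⟩ := h.bottom
    have := latticePoint_mem_latticeHull hs
    rw [latticePoint_eq, h0] at this
    exact ⟨_, by simpa using this⟩
  top := by
    obtain ⟨s, hs, h0⟩ := h.top
    have := latticePoint_mem_latticeHull hs
    rw [latticePoint_eq, h0] at this
    exact ⟨_, by simpa using this⟩

/-- Twice the area of a lattice polygon in reduced position is at least `W N - W² / 4`. -/
theorem IsReduced.sum_chord_ge {W N : ℕ} (h : IsReduced S W N) (hW : 0 < W) :
    (W : ℝ) * N - W ^ 2 / 4 ≤ ∑ k ∈ Ico 0 W,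
      ((rightEnd (latticeHull S) k - leftEnd (latticeHull S) k) +
        (rightEnd (latticeHull S) (k + 1 : ℕ) - leftEnd (latticeHull S) (k + 1 : ℕ))) := by
  have hH := h.hasHeight hW
  set P := latticeHull S with hP
  have hpt : ∀ s ∈ S, ∃ y : ℕ, s 1 = y ∧ y ≤ W ∧ (0 : ℝ) ≤ s 0 ∧ (s 0 : ℝ) ≤ N ∧
      (s 0 : ℝ) ≤ rightEnd P y ∧ leftEnd P y ≤ s 0 := by
    intro s hs
    obtain ⟨⟨h1, h2⟩, h3, h4⟩ := h.mem_box s hs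
    obtain ⟨y, hy⟩ := Int.eq_ofNat_of_zero_le h3
    have hmem := latticePoint_mem_latticeHull hs
    rw [latticePoint_eq, hy, Int.cast_natCast] at hmem
    exact ⟨y, hy, by omega, by exact_mod_cast h1, by exact_mod_cast h2,
      le_rightEnd hH.isCompact hmem, leftEnd_le hH.isCompact hmem⟩
  obtain ⟨sL, hsL, eL⟩ := h.left
  obtain ⟨sR, hsR, eR⟩ := h.right
  obtain ⟨sB, hsB, eB⟩ := h.bottom
  obtain ⟨sT, hsT, eT⟩ := h.top
  obtain ⟨a, ha, haW, -, -, hra, hla⟩ := hpt sL hsL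
  obtain ⟨c, hc, hcW, -, -, hrc, hlc⟩ := hpt sR hsR
  obtain ⟨b', hb', -, hb0, hbN, hrb, hlb⟩ := hpt sB hsB
  obtain ⟨d', hd', -, hd0, hdN, hrd, hld⟩ := hpt sT hsT
  obtain rfl : b' = 0 := by omega
  obtain rfl : d' = W := by omega
  rw [eL] at hra hla
  rw [eR] at hrc hlc
  simp only [Int.cast_zero, Int.cast_natCast, Nat.cast_zero] at *
  have haR : (sL 1 : ℝ) = a := by rw [ha]; simp
  have hcR : (sR 1 : ℝ) = c := by rw [hc]; simp
  have eLR : (sL 0 : ℝ) = 0 := by rw [eL]; simp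
  have eRR : (sR 0 : ℝ) = N := by rw [eR]; simp
  have eBR : (sB 1 : ℝ) = 0 := by rw [eB]; simp
  have eTR : (sT 1 : ℝ) = d' := by rw [eT]; simp
  rcases le_total a c with hac | hac <;> rcases le_total (sB 0) (sT 0) with hbd | hbd
  · obtain ⟨s₁, hs₁, m₁⟩ := S.exists_max_image (fun s => s 0 - s 1) ⟨sL, hsL⟩
    obtain ⟨s₂, hs₂, m₂⟩ := S.exists_min_image (fun s => s 0 - s 1) ⟨sL, hsL⟩
    obtain ⟨y₁, e₁, hy₁, hx₁, hx₁', hr₁, hl₁⟩ := hpt s₁ hs₁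
    obtain ⟨y₂, e₂, hy₂, hx₂, hx₂', hr₂, hl₂⟩ := hpt s₂ hs₂
    have e₁R : (s₁ 1 : ℝ) = y₁ := by rw [e₁]; simp
    have e₂R : (s₂ 1 : ℝ) = y₂ := by rw [e₂]; simp
    have m₁R : ∀ s ∈ S, (s 0 : ℝ) - s 1 ≤ s₁ 0 - s₁ 1 := fun s hs => by exact_mod_cast m₁ s hs
    have m₂R : ∀ s ∈ S, (s₂ 0 : ℝ) - s₂ 1 ≤ s 0 - s 1 := fun s hs => by exact_mod_cast m₂ s hs
    obtain ⟨s, hs, t, ht, hst⟩ := h.diff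
    have hstR : (N : ℝ) ≤ (s 0 - s 1) - (t 0 - t 1) := by exact_mod_cast hst
    have n1 := m₁R sB hsB
    have n2 := m₁R sR hsR
    have n3 := m₂R sL hsL
    have n4 := m₂R sT hsT
    have n5 := m₁R s hs
    have n6 := m₂R t ht
    exact sum_trapezoid_ge_of_diagonal h.le hH.concaveOn hH.convexOn hac
      (by exact_mod_cast hbd) hcW hb0 hdN hx₁' hx₂ hy₂ hrb hr₁ hrc hrd hlb hl₂ hla hld
      (by linarith) (by linarith) (by linarith) (by linarith) (by linarith)
  · have hbdR : (sT 0 : ℝ) ≤ sB 0 := by exact_mod_cast hbd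
    have hacR : (a : ℝ) ≤ c := by exact_mod_cast hac
    exact sum_trapezoid_ge_of_quadrilateral hH.concaveOn hH.convexOn haW hcW hrb hrc hrd hlb hla hld
      (mul_nonneg (by linarith) (by linarith))
  · have hbdR : (sB 0 : ℝ) ≤ sT 0 := by exact_mod_cast hbd
    have hacR : (c : ℝ) ≤ a := by exact_mod_cast hac
    exact sum_trapezoid_ge_of_quadrilateral hH.concaveOn hH.convexOn haW hcW hrb hrc hrd hlb hla hld
      (mul_nonneg_of_nonpos_of_nonpos (by linarith) (by linarith))
  · obtain ⟨s₂, hs₂, m₂⟩ := S.exists_max_image (fun s => s 0 + s 1) ⟨sL, hsL⟩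
    obtain ⟨s₁, hs₁, m₁⟩ := S.exists_min_image (fun s => s 0 + s 1) ⟨sL, hsL⟩
    obtain ⟨y₁, e₁, hy₁, hx₁, hx₁', hr₁, hl₁⟩ := hpt s₁ hs₁
    obtain ⟨y₂, e₂, hy₂, hx₂, hx₂', hr₂, hl₂⟩ := hpt s₂ hs₂
    have e₁R : (s₁ 1 : ℝ) = y₁ := by rw [e₁]; simp
    have e₂R : (s₂ 1 : ℝ) = y₂ := by rw [e₂]; simp
    have m₁R : ∀ s ∈ S, (s₁ 0 : ℝ) + s₁ 1 ≤ s 0 + s 1 := fun s hs => by exact_mod_cast m₁ s hs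
    have m₂R : ∀ s ∈ S, (s 0 : ℝ) + s 1 ≤ s₂ 0 + s₂ 1 := fun s hs => by exact_mod_cast m₂ s hs
    obtain ⟨s, hs, t, ht, hst⟩ := h.sum
    have hstR : (N : ℝ) ≤ (s 0 + s 1) - (t 0 + t 1) := by exact_mod_cast hst
    have hbdR : (sT 0 : ℝ) ≤ sB 0 := by exact_mod_cast hbd
    have n1 := m₁R sB hsB
    have n2 := m₁R sL hsL
    have n3 := m₂R sR hsR
    have n4 := m₂R sT hsT
    have n5 := m₂R s hs
    have n6 := m₁R t ht
    -- The reflection x ↦ N - x exchanges the two boundaries and turns x + y into N - (x - y), which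
    -- reduces this case to the first one.
    have := sum_trapezoid_ge_of_diagonal (r := fun y => N - leftEnd P y)
      (l := fun y => N - rightEnd P y) (b := N - sB 0) (d := N - sT 0) (x₁ := N - s₁ 0)
      (x₂ := N - s₂ 0) (y₁ := y₁) (y₂ := y₂) h.le
      ((concaveOn_const (N : ℝ) (convex_Icc _ _)).sub hH.convexOn)
      ((convexOn_const (N : ℝ) (convex_Icc _ _)).sub hH.concaveOn)
      hac (by linarith) haW (by linarith) (by linarith) (by linarith) (by linarith) hy₂
      (by linarith) (by linarith) (by linarith) (by linarith) (by linarith) (by linarith)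
      (by linarith) (by linarith) (by linarith) (by linarith) (by linarith) (by linarith)
      (by linarith)
    refine this.trans (le_of_eq (sum_congr rfl fun k _ => ?_))
    ring

/-- The genus is at least about a quarter of the squared lattice width, and the number of inner
midpoints is bounded by the genus and the width. -/
theorem IsReduced.bounds {W N : ℕ} (h : IsReduced S W N) (hW : 4 ≤ W)
    (hint : (interior (latticeHull S)).Nonempty) :
    3 * (W : ℝ) ^ 2 ≤ 12 * genus (latticeHull S) + 32 ∧
      ((innerMidpoints (latticeHull S)).ncard : ℝ) ≤
        3 * genus (latticeHull S) + 2 * genus (latticeHull S) / (W - 1) + 2 * W - 1 := by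
  have hH := h.hasHeight (by omega)
  have hM := ncard_innerMidpoints_le (by omega) hH hint
  have hA := h.sum_chord_ge (by omega)
  have hg := sum_rowCount_le_genus hH hint
  set P := latticeHull S with hP
  obtain ⟨L, hL⟩ : ∃ L : ℝ → ℝ, L = fun y => rightEnd P y - leftEnd P y := ⟨_, rfl⟩
  have hLy : ∀ y, rightEnd P y - leftEnd P y = L y := fun y => by rw [hL]
  simp only [hLy] at hA hM
  have hLc : ConcaveOn ℝ (Set.Icc 0 (W : ℝ)) L := by rw [hL]; exact hH.concaveOn.sub hH.convexOn
  have hT := trapezoid_le_sum hLc (Nat.zero_le W) le_rfl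
  have hsum : ∀ V : ℕ, 1 ≤ V → ∑ k ∈ Ico 0 V, (L k + L (k + 1 : ℕ)) =
      2 * ∑ k ∈ Ico 1 V, L k + L 0 + L V := by
    intro V hV
    induction V, hV using Nat.le_induction with
    | base => simp
    | succ V hV ih =>
      rw [sum_Ico_succ_top (Nat.zero_le V), ih, sum_Ico_succ_top hV]; ring
  rw [hsum W (by omega)] at hT hA
  obtain ⟨s, hs⟩ : ∃ s, s = ∑ k ∈ Ico 1 W, L k := ⟨_, rfl⟩
  have hsg : s - (W - 1) ≤ genus P := by
    have h1 : s - (W - 1) ≤ ∑ i ∈ Ico 1 W, (rowCount P i : ℝ) := by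
      have h2 : ∑ i ∈ Ico 1 W, (L i - 1) = s - (W - 1) := by
        rw [sum_sub_distrib, ← hs]
        simp only [sum_const, Nat.card_Ico, nsmul_eq_mul, mul_one]
        rw [Nat.cast_sub (by omega)]
        simp
      rw [← h2]
      refine sum_le_sum fun i _ => ?_
      rw [← hLy]
      exact chord_le_rowCount P i
    have h3 : ∑ i ∈ Ico 1 W, (rowCount P i : ℝ) ≤ genus P := by exact_mod_cast hg
    linarith
  rw [← hs] at hT hA
  have hWR : (4 : ℝ) ≤ W := by exact_mod_cast hW
  have hNR : (W : ℝ) ≤ N := by exact_mod_cast h.le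
  simp only [Nat.cast_zero, sub_zero] at hT
  have hτ : (W - 1) * (L 0 + L W) ≤ 2 * s := by linarith
  have hgτ : (W - 1) * (L 0 + L W - 2) ≤ 2 * (genus P : ℝ) := by linarith
  constructor
  · have hA' : 3 / 4 * (W : ℝ) ^ 2 ≤ 2 * s + (L 0 + L W) := by nlinarith
    -- Since (W - 1)(L(0) + L(W)) ≤ 2s, the area bound gives s ≥ 3W(W - 1)/8; then s ≤ g + W - 1 is
    -- inserted.
    have key : ((W : ℝ) - 1) * (3 * W - 8) ≤ 8 * genus P := by nlinarith
    have keyZ : ((W : ℤ) - 1) * (3 * W - 8) ≤ 8 * genus P := by exact_mod_cast key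
    -- For `W = 5` and `W = 6` the real inequality is not sufficient; rounding the genus up to an
    -- integer closes the gap.
    rcases lt_or_ge W 7 with h7 | h7
    · have : 3 * (W : ℤ) ^ 2 ≤ 12 * genus P + 32 := by
        interval_cases W <;> norm_num at keyZ ⊢ <;> omega
      exact_mod_cast this
    · have : (7 : ℝ) ≤ W := by exact_mod_cast h7
      nlinarith
  · have h1 : L 0 + L W - 2 ≤ 2 * genus P / (W - 1) := by
      rw [le_div_iff₀ (by linarith)]
      linarith
    linarith

end LatticePlane

namespace LatticePlane

open Finset

/-! ### Unimodular changes of coordinates -/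

/-- The value of the integer functional `u` at `s`. -/
def pairing (u s : Fin 2 → ℤ) : ℤ := u 0 * s 0 + u 1 * s 1

/-- The width of a finite set of lattice points in the direction `u`. -/
def width (S : Finset (Fin 2 → ℤ)) (u : Fin 2 → ℤ) : ℕ :=
  (S ×ˢ S).sup fun p => (pairing u p.1 - pairing u p.2).toNat

variable {S : Finset (Fin 2 → ℤ)}

theorem pairing_sub_le_width {u s t : Fin 2 → ℤ} (hs : s ∈ S) (ht : t ∈ S) :
    pairing u s - pairing u t ≤ width S u := by
  have h : (pairing u s - pairing u t).toNat ≤ width S u :=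
    le_sup (f := fun p : (Fin 2 → ℤ) × (Fin 2 → ℤ) => (pairing u p.1 - pairing u p.2).toNat)
      (mem_product.2 ⟨hs, ht⟩ : (s, t) ∈ S ×ˢ S)
  omega

theorem exists_width_eq (hS : S.Nonempty) (u : Fin 2 → ℤ) :
    ∃ s ∈ S, ∃ t ∈ S, pairing u s - pairing u t = width S u := by
  obtain ⟨⟨s, t⟩, hst, h⟩ := exists_mem_eq_sup (S ×ˢ S) (hS.product hS)
    fun p => (pairing u p.1 - pairing u p.2).toNat
  rw [mem_product] at hst
  rcases le_or_gt 0 (pairing u s - pairing u t) with h0 | h0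
  · exact ⟨s, hst.1, t, hst.2, by rw [width, h, Int.toNat_of_nonneg h0]⟩
  · refine ⟨s, hst.1, s, hst.1, ?_⟩
    rw [width, h, Int.toNat_of_nonpos h0.le]
    simp

/-- A unimodular basis of functionals in which the widths are as small as possible. -/
theorem exists_reduced_basis (S : Finset (Fin 2 → ℤ)) :
    ∃ u v : Fin 2 → ℤ, det u v = 1 ∧ width S v ≤ width S u ∧ width S u ≤ width S (u - v) ∧
      width S u ≤ width S (u + v) := by
  have hne : ({p : (Fin 2 → ℤ) × (Fin 2 → ℤ) | det p.1 p.2 = 1}).Nonempty :=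
    ⟨(![1, 0], ![0, 1]), by simp [det]⟩
  -- First the width of `v` is minimized over all bases, then that of `u` over all completions of
  -- `v`. The basis (-v, u) shows that `u` is not narrower than `v`, and `u ± v` are competing
  -- completions.
  obtain ⟨p, hp, hpmin⟩ := exists_minimalFor_of_wellFoundedLT
    (fun p : (Fin 2 → ℤ) × (Fin 2 → ℤ) => det p.1 p.2 = 1) (fun p => width S p.2) hne
  obtain ⟨u, hu, humin⟩ := exists_minimalFor_of_wellFoundedLT
    (fun u : Fin 2 → ℤ => det u p.2 = 1) (fun u => width S u) ⟨p.1, hp⟩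
  have hle : ∀ u' : Fin 2 → ℤ, det u' p.2 = 1 → width S u ≤ width S u' := fun u' h' => by
    rcases le_total (width S u) (width S u') with h | h
    · exact h
    · exact humin h' h
  refine ⟨u, p.2, hu, ?_, hle _ ?_, hle _ ?_⟩
  · rcases le_total (width S p.2) (width S u) with h | h
    · exact h
    · refine hpmin (j := (-p.2, u)) ?_ h
      rw [← hu]; simp only [det, Pi.neg_apply]; ring
  · rw [← hu]; simp only [det, Pi.sub_apply]; ring
  · rw [← hu]; simp only [det, Pi.add_apply]; ring

theorem pairing_bounds {v : Fin 2 → ℤ} {m M : ℤ} (h : ∀ s ∈ S, m ≤ pairing v s ∧ pairing v s ≤ M) :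
    ∀ p ∈ latticeHull S, m ≤ v 0 * p 0 + v 1 * p 1 ∧ v 0 * p 0 + v 1 * p 1 ≤ M := by
  intro p hp
  have h1 := convexHull_le (S := S) (α := -v 0) (β := -v 1) (c := -m) (fun s hs => by
    have := (h s hs).1
    rw [pairing] at this
    have h2 : (m : ℝ) ≤ v 0 * s 0 + v 1 * s 1 := by exact_mod_cast this
    linarith) p hp
  have h2 := convexHull_le (S := S) (α := v 0) (β := v 1) (c := M) (fun s hs => by
    have := (h s hs).2
    rw [pairing] at this
    exact_mod_cast this) p hp
  constructor <;> linarith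

/-- The matrix with rows `u` and `v` is in SL₂(ℤ) and turns the functional `v` into the second
coordinate. -/
theorem latticeWidth_le_width (hS : S.Nonempty) {u v : Fin 2 → ℤ} (huv : det u v = 1) :
    latticeWidth (latticeHull S) ≤ width S v := by
  obtain ⟨s, hs, t, ht, hst⟩ := exists_width_eq hS v
  have hb := pairing_bounds (S := S) (v := v) (m := pairing v t) (M := pairing v s) (fun r hr => by
    have h1 := pairing_sub_le_width (u := v) hr ht
    have h2 := pairing_sub_le_width (u := v) hs hr
    constructor <;> linarith)
  have hstR : (pairing v s : ℝ) - pairing v t = width S v := by exact_mod_cast hst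
  refine csInf_le ⟨0, ?_⟩ ⟨_, ⟨⟨!![u 0, u 1; v 0, v 1], ?_⟩, rfl⟩, pairing v t, pairing v s, ?_,
    hstR.symm, ?_⟩
  · rintro w ⟨Q, -, a, b, hab, rfl, -⟩
    linarith
  · rw [Matrix.det_fin_two_of, ← huv, det]
  · have : (0 : ℝ) ≤ width S v := Nat.cast_nonneg _
    linarith
  · rintro _ ⟨x, hx, rfl⟩
    have := hb x hx
    simpa [horizontalStrip, Matrix.mulVec, dotProduct, Fin.sum_univ_two] using this

/-- The lattice points of the image of `S` in the coordinates `u - m₀`, `v - m₁`. -/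
def coordMap (u v : Fin 2 → ℤ) (m₀ m₁ : ℤ) (s : Fin 2 → ℤ) : Fin 2 → ℤ :=
  ![pairing u s - m₀, pairing v s - m₁]

/-- The inverse of `coordMap`. -/
def coordInv (u v : Fin 2 → ℤ) (m₀ m₁ : ℤ) (z : Fin 2 → ℤ) : Fin 2 → ℤ :=
  ![v 1 * (z 0 + m₀) - u 1 * (z 1 + m₁), -v 0 * (z 0 + m₀) + u 0 * (z 1 + m₁)]

theorem coordMap_coordInv {u v : Fin 2 → ℤ} (huv : det u v = 1) (m₀ m₁ : ℤ) (z : Fin 2 → ℤ) :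
    coordMap u v m₀ m₁ (coordInv u v m₀ m₁ z) = z := by
  rw [det] at huv
  funext i
  fin_cases i
  · simp only [coordMap, coordInv, pairing, Fin.zero_eta, Matrix.cons_val_zero, Matrix.cons_val_one]
    linear_combination (z 0 + m₀) * huv
  · simp only [coordMap, coordInv, pairing, Fin.mk_one, Matrix.cons_val_zero, Matrix.cons_val_one]
    linear_combination (z 1 + m₁) * huv

theorem coordInv_coordMap {u v : Fin 2 → ℤ} (huv : det u v = 1) (m₀ m₁ : ℤ) (z : Fin 2 → ℤ) :
    coordInv u v m₀ m₁ (coordMap u v m₀ m₁ z) = z := by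
  rw [det] at huv
  funext i
  fin_cases i
  · simp only [coordMap, coordInv, pairing, Fin.zero_eta, Matrix.cons_val_zero, Matrix.cons_val_one]
    linear_combination z 0 * huv
  · simp only [coordMap, coordInv, pairing, Fin.mk_one, Matrix.cons_val_zero, Matrix.cons_val_one]
    linear_combination z 1 * huv

/-- The affine homeomorphism of the plane that extends `coordMap`. -/
noncomputable def coordHomeomorph {u v : Fin 2 → ℤ} (huv : det u v = 1) (m₀ m₁ : ℤ) :
    Plane ≃ₜ Plane where
  toFun x := ![u 0 * x 0 + u 1 * x 1 - m₀, v 0 * x 0 + v 1 * x 1 - m₁]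
  invFun z := ![v 1 * (z 0 + m₀) - u 1 * (z 1 + m₁), -v 0 * (z 0 + m₀) + u 0 * (z 1 + m₁)]
  left_inv x := by
    have h : (u 0 * v 1 - u 1 * v 0 : ℝ) = 1 := by exact_mod_cast huv
    funext i
    fin_cases i
    · simp only [Fin.zero_eta, Matrix.cons_val_zero, Matrix.cons_val_one]
      linear_combination x 0 * h
    · simp only [Fin.mk_one, Matrix.cons_val_zero, Matrix.cons_val_one]
      linear_combination x 1 * h
  right_inv z := by
    have h : (u 0 * v 1 - u 1 * v 0 : ℝ) = 1 := by exact_mod_cast huv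
    funext i
    fin_cases i
    · simp only [Fin.zero_eta, Matrix.cons_val_zero, Matrix.cons_val_one]
      linear_combination (z 0 + m₀) * h
    · simp only [Fin.mk_one, Matrix.cons_val_zero, Matrix.cons_val_one]
      linear_combination (z 1 + m₁) * h
  continuous_toFun := by fun_prop
  continuous_invFun := by fun_prop

theorem coordHomeomorph_latticePoint {u v : Fin 2 → ℤ} (huv : det u v = 1) (m₀ m₁ : ℤ)
    (s : Fin 2 → ℤ) :
    coordHomeomorph huv m₀ m₁ (latticePoint s) = latticePoint (coordMap u v m₀ m₁ s) := by
  funext i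
  fin_cases i <;> simp [coordHomeomorph, latticePoint, coordMap, pairing]

/-- The translation doubles because `s` stands for the point s/2. -/
theorem coordHomeomorph_halfPoint {u v : Fin 2 → ℤ} (huv : det u v = 1) (m₀ m₁ : ℤ)
    (s : Fin 2 → ℤ) :
    coordHomeomorph huv m₀ m₁ (halfPoint s) =
      halfPoint (coordMap u v (2 * m₀) (2 * m₁) s) := by
  funext i
  fin_cases i <;> simp [coordHomeomorph, halfPoint, coordMap, pairing] <;> ring

theorem latticeHull_image {u v : Fin 2 → ℤ} (huv : det u v = 1) (m₀ m₁ : ℤ)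
    (S : Finset (Fin 2 → ℤ)) :
    latticeHull (S.image (coordMap u v m₀ m₁)) =
      coordHomeomorph huv m₀ m₁ '' latticeHull S := by
  let f : Plane →ᵃ[ℝ] Plane :=
    (Matrix.toLin' !![(u 0 : ℝ), u 1; v 0, v 1]).toAffineMap +
      AffineMap.const ℝ Plane ![-(m₀ : ℝ), -m₁]
  have hf : ∀ x, f x = coordHomeomorph huv m₀ m₁ x := by
    intro x
    funext i
    fin_cases i <;>
      simp [f, coordHomeomorph, dotProduct, Fin.sum_univ_two] <;> ring
  have hf' : (coordHomeomorph huv m₀ m₁ : Plane → Plane) = f := funext fun x => (hf x).symm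
  rw [latticeHull, latticeHull, hf', AffineMap.image_convexHull, coe_image, Set.image_image,
    Set.image_image]
  congr 1
  refine Set.image_congr fun s _ => ?_
  rw [hf, coordHomeomorph_latticePoint]

theorem interior_latticeHull_image {u v : Fin 2 → ℤ} (huv : det u v = 1) (m₀ m₁ : ℤ)
    (S : Finset (Fin 2 → ℤ)) (x : Plane) :
    coordHomeomorph huv m₀ m₁ x ∈ interior (latticeHull (S.image (coordMap u v m₀ m₁))) ↔
      x ∈ interior (latticeHull S) := by
  rw [latticeHull_image huv, ← Homeomorph.image_interior]
  exact (coordHomeomorph huv m₀ m₁).injective.mem_set_image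

/-- Equality holds, but only this direction is needed; for the inner midpoints only the opposite one
is. -/
theorem genus_image_le {u v : Fin 2 → ℤ} (huv : det u v = 1) (m₀ m₁ : ℤ) :
    genus (latticeHull (S.image (coordMap u v m₀ m₁))) ≤ genus (latticeHull S) := by
  refine Set.ncard_le_ncard_of_injOn (coordInv u v m₀ m₁) ?_ ?_
    (finite_latticePoint_mem (isCompact_latticeHull.isBounded.subset interior_subset))
  · intro z hz
    rw [Set.mem_ofPred_eq] at hz ⊢
    rwa [← interior_latticeHull_image huv m₀ m₁, coordHomeomorph_latticePoint,
      coordMap_coordInv huv]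
  · intro z _ w _ h
    rw [← coordMap_coordInv huv m₀ m₁ z, h, coordMap_coordInv huv]

theorem ncard_innerMidpoints_le_image {u v : Fin 2 → ℤ} (huv : det u v = 1) (m₀ m₁ : ℤ) :
    (innerMidpoints (latticeHull S)).ncard ≤
      (innerMidpoints (latticeHull (S.image (coordMap u v m₀ m₁)))).ncard := by
  refine Set.ncard_le_ncard_of_injOn (coordMap u v (2 * m₀) (2 * m₁)) ?_ ?_
    (finite_innerMidpoints isCompact_latticeHull.isBounded)
  · rintro s ⟨hs, hodd⟩
    refine ⟨?_, ?_⟩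
    · rwa [← coordHomeomorph_halfPoint huv, interior_latticeHull_image huv]
    -- The inverse change of coordinates is integral with even translation part, so an even image
    -- would come from an even vector.
    · by_contra hcon
      simp only [IsOddVector, not_or, Int.not_odd_iff_even] at hcon
      obtain ⟨⟨p, hp⟩, ⟨q, hq⟩⟩ := hcon
      have hs := coordInv_coordMap huv (2 * m₀) (2 * m₁) s
      have h0 := congrFun hs 0
      have h1 := congrFun hs 1
      simp only [coordInv, hp, hq, Matrix.cons_val_zero, Matrix.cons_val_one] at h0 h1
      have e0 : s 0 = 2 * (v 1 * (p + m₀) - u 1 * (q + m₁)) := by rw [← h0]; ring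
      have e1 : s 1 = 2 * (-v 0 * (p + m₀) + u 0 * (q + m₁)) := by rw [← h1]; ring
      rcases hodd with h | h
      · rw [e0] at h; exact (Int.not_odd_iff_even.2 (even_two_mul _)) h
      · rw [e1] at h; exact (Int.not_odd_iff_even.2 (even_two_mul _)) h
  · intro z _ w _ h
    rw [← coordInv_coordMap huv (2 * m₀) (2 * m₁) z, h, coordInv_coordMap huv]

theorem isReduced_image {u v : Fin 2 → ℤ} (hS : S.Nonempty)
    (h₁ : width S v ≤ width S u) (h₂ : width S u ≤ width S (u - v))
    (h₃ : width S u ≤ width S (u + v)) :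
    ∃ m₀ m₁, IsReduced (S.image (coordMap u v m₀ m₁)) (width S v) (width S u) := by
  obtain ⟨s, hs, t, ht, hst⟩ := exists_width_eq hS u
  obtain ⟨s', hs', t', ht', hst'⟩ := exists_width_eq hS v
  refine ⟨pairing u t, pairing v t', h₁, ?_, ⟨_, mem_image_of_mem _ ht, ?_⟩,
    ⟨_, mem_image_of_mem _ hs, ?_⟩, ⟨_, mem_image_of_mem _ ht', ?_⟩,
    ⟨_, mem_image_of_mem _ hs', ?_⟩, ?_, ?_⟩
  · intro r hr
    rw [mem_image] at hr
    obtain ⟨r, hr, rfl⟩ := hr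
    have a1 := pairing_sub_le_width (u := u) hr ht
    have a2 := pairing_sub_le_width (u := u) hs hr
    have a3 := pairing_sub_le_width (u := v) hr ht'
    have a4 := pairing_sub_le_width (u := v) hs' hr
    simp only [coordMap, Matrix.cons_val_zero, Matrix.cons_val_one]
    refine ⟨⟨?_, ?_⟩, ?_, ?_⟩ <;> linarith
  · simp [coordMap]
  · simpa [coordMap] using hst
  · simp [coordMap]
  · simpa [coordMap] using hst'
  · obtain ⟨a, ha, b, hb, hab⟩ := exists_width_eq hS (u - v)
    refine ⟨_, mem_image_of_mem _ ha, _, mem_image_of_mem _ hb, ?_⟩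
    simp only [coordMap, Matrix.cons_val_zero, Matrix.cons_val_one]
    simp only [pairing, Pi.sub_apply] at hab ⊢
    have : (width S u : ℤ) ≤ width S (u - v) := by exact_mod_cast h₂
    linarith
  · obtain ⟨a, ha, b, hb, hab⟩ := exists_width_eq hS (u + v)
    refine ⟨_, mem_image_of_mem _ ha, _, mem_image_of_mem _ hb, ?_⟩
    simp only [coordMap, Matrix.cons_val_zero, Matrix.cons_val_one]
    simp only [pairing, Pi.add_apply] at hab ⊢
    have : (width S u : ℤ) ≤ width S (u + v) := by exact_mod_cast h₃
    linarith

/-- The number of inner midpoints of a lattice polygon of lattice width at least `ℓ + 1`. -/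
theorem ncard_innerMidpoints_le_of_latticeWidth {ℓ : ℕ} (hℓ : 3 ≤ ℓ) {P : Set Plane}
    (hP : IsLatticePolygon P) (hw : (ℓ : ℝ) + 1 ≤ latticeWidth P) :
    ((innerMidpoints P).ncard : ℝ) ≤
      (3 + 2 / (ℓ : ℝ)) * genus P + 4 * Real.sqrt (genus P + 8 / 3) - 1 := by
  obtain ⟨⟨S, rfl⟩, hint⟩ := hP
  change (interior (latticeHull S)).Nonempty at hint
  change _ ≤ latticeWidth (latticeHull S) at hw
  change ((innerMidpoints (latticeHull S)).ncard : ℝ) ≤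
    (3 + 2 / (ℓ : ℝ)) * genus (latticeHull S) + 4 * Real.sqrt (genus (latticeHull S) + 8 / 3) - 1
  have hS : S.Nonempty := by
    rw [nonempty_iff_ne_empty]
    rintro rfl
    simp [latticeHull] at hint
  obtain ⟨u, v, huv, h₁, h₂, h₃⟩ := exists_reduced_basis S
  obtain ⟨m₀, m₁, hred⟩ := isReduced_image hS h₁ h₂ h₃
  have hWR : (ℓ : ℝ) + 1 ≤ width S v := hw.trans (latticeWidth_le_width hS huv)
  have hW : 4 ≤ width S v := by
    have : ℓ + 1 ≤ width S v := by exact_mod_cast hWR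
    omega
  have hint' : (interior (latticeHull (S.image (coordMap u v m₀ m₁)))).Nonempty := by
    obtain ⟨x, hx⟩ := hint
    exact ⟨_, (interior_latticeHull_image huv m₀ m₁ S x).2 hx⟩
  obtain ⟨b₁, b₂⟩ := hred.bounds hW hint'
  have hg : (genus (latticeHull (S.image (coordMap u v m₀ m₁))) : ℝ) ≤ genus (latticeHull S) := by
    exact_mod_cast genus_image_le huv m₀ m₁
  have hM : ((innerMidpoints (latticeHull S)).ncard : ℝ) ≤
      (innerMidpoints (latticeHull (S.image (coordMap u v m₀ m₁)))).ncard := by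
    exact_mod_cast ncard_innerMidpoints_le_image huv m₀ m₁
  have hℓR : (3 : ℝ) ≤ ℓ := by exact_mod_cast hℓ
  have hdiv : 2 * (genus (latticeHull (S.image (coordMap u v m₀ m₁))) : ℝ) / (width S v - 1) ≤
      2 * genus (latticeHull S) / ℓ := by
    gcongr
    linarith
  -- This is 3W² ≤ 12g + 32 divided by 12, whence 8/3 = 32/12.
  have hsqrt : (width S v : ℝ) / 2 ≤ Real.sqrt (genus (latticeHull S) + 8 / 3) := by
    apply Real.le_sqrt_of_sq_le
    nlinarith
  have e : (3 + 2 / (ℓ : ℝ)) * genus (latticeHull S) =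
      3 * genus (latticeHull S) + 2 * genus (latticeHull S) / ℓ := by ring
  rw [e]
  linarith

end LatticePlane

theorem proposition4p11 (ℓ g : ℕ) (hℓ : 3 ≤ ℓ) (P : Set LatticePlane.Plane)
    (hP : LatticePlane.IsLatticePolygon P) (hg : LatticePlane.genus P = g)
    (hw : (ℓ : ℝ) + 1 ≤ LatticePlane.latticeWidth P) :
    {T : Set (Set LatticePlane.Plane) | LatticePlane.IsUnimodularTriangulation P T}.Finite ∧
      ({T : Set (Set LatticePlane.Plane) |
          LatticePlane.IsUnimodularTriangulation P T}.ncard : ℝ) ≤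
        (2 : ℝ) ^ ((3 + 2 / (ℓ : ℝ)) * (g : ℝ) + 4 * Real.sqrt ((g : ℝ) + 8 / 3) - 1) := by
  obtain ⟨hfin, hcard⟩ := LatticePlane.ncard_isUnimodularTriangulation_le hP
  refine ⟨hfin, ?_⟩
  have hM := LatticePlane.ncard_innerMidpoints_le_of_latticeWidth hℓ hP hw
  rw [hg] at hM
  calc ({T : Set (Set LatticePlane.Plane) |
          LatticePlane.IsUnimodularTriangulation P T}.ncard : ℝ)
      ≤ (2 : ℝ) ^ (LatticePlane.innerMidpoints P).ncard := by exact_mod_cast hcard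
    _ = (2 : ℝ) ^ ((LatticePlane.innerMidpoints P).ncard : ℝ) := (Real.rpow_natCast _ _).symm
    _ ≤ _ := Real.rpow_le_rpow_of_exponent_le (by norm_num) hM
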